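/- **Setting.** Let $t_0<t_1<\dots<t_S$, $L_i=t_i-t_{i-1}$ ($1\le i\le S$), and let $N\ge 1$. $S_{D,c}$ denotes the space of functions on $[t_0,t_S]$ that are polynomials of degree $\le D$ on each subinterval $I_i=[t_{i-1},t_i]$ and whose derivatives up to order $c$ are continuous at the inner knots. A quadrature rule is a finite family of pairs (node in $[t_0,t_S]$, real weight); it is exact for $S_{D,c}$ if $\sum_i w_i f(x_i)=\int_{t_0}^{t_S} f\,dx$ for all $f\in S_{D,c}$. It is *optimal* (Gaussian) for $S_{D,c}$ if it is exact, its nodes are pairwise distinct, no exact rule has fewer nodes, and twice the number of nodes equals $\dim S_{D,c}$; it is *1-parameter optimal* if the same holds with $\dim S_{D,c}+1$ in place of $\dim S_{D,c}$. $P_n^{(a,b)}$ are the Jacobi polynomials. To "place" pairs $(x,w)$ on $I_i$ means to use the nodes $t_{i-1}+\tfrac{1+x}{2}L_i$ and the weights $\tfrac{L_i}{2}w$. **Formulae for $c=0$.** $F(n)=1+\alpha n(n+1)$ and, with $P=P_n^{(1,0)}$, $Q_n=(F(n)+\alpha n)P+\alpha(1-x)P'$, $Q_{\omega,n}=Q_n+\omega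 Q_{n-1}$; the weight at a root $x$ of $q=Q_n$ or $q=Q_{\omega,n}$ is $$w=\frac{2(2n+1)F(n)^2}{n(n+1)\,q'(x)\,Q_{n-1}(x)\,(1-x)}.$$ Step map: $T_n(\alpha)=\dfrac{1+(n+1)^2\alpha}{(n+1)^2(1+n(n+2)\alpha)}$. Parameter $\omega$: $$\omega=-\frac{n(1+(n+1)^2\alpha)+\lambda(n+1)(1+n(n+2)\alpha)}{(n+1)(1+n^2\alpha)+\lambda n(1+(n-1)(n+1)\alpha)}.$$ Extended step map: $$T_{\omega,n}(\alpha)=\frac{n(1+(n+1)^2\alpha)+\omega(n+1)(1+n^2\alpha)}{n(n+1)\left[(n+1)(1+n(n+2)\alpha)+\omega n(1+(n-1)(n+1)\alpha)\right]}.$$ Middle: with $P=P_n^{(0,0)}$, $H(n)=1+n^2(\alpha_L+\alpha_R+(n^2-1)\alpha_L\alpha_R)$, $H_1=\alpha_L+\alpha_R+2n(n+1)\alpha_L\alpha_R$, $H_2(\alpha)=1+\alpha n(n+1)$, $$M_n(\alpha_L,\alpha_R)=(H(n)+nH_1)P+\left(\alpha_LH_2(\alpha_R)(1-x)-\alpha_RH_2(\alpha_L)(1+x)\right)P',$$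 with weight $\dfrac{2H(n)^2}{n\,M_n'(x)\,M_{n-1}(x)}$ at a root $x$ of $M_n$. **Formulae for $c=1$.** With $P=P_n^{(2,0)}$, $$F(n)=1+n(n+2)\left(\alpha+6(n^2+2n-1)\beta-3(n-1)n(n+1)^2(n+2)(n+3)\beta^2\right),$$ $$F_1=\alpha+12\beta\left(n^2+3n+1-n(n+1)^2(n+2)^2(n+3)\beta\right),\quad F_2=\beta\left(1-3n(n+1)(n+2)(n+3)\beta\right),$$ $$Q_n=(F(n)+nF_1)P+F_1(1-x)P'-36F_2P'+12F_2(1-x)P'',\qquad Q_{\omega,n}=Q_n+\omega Q_{n-1};$$ the weight at a root $x$ of $q=Q_n$ or $q=Q_{\omega,n}$ is $\dfrac{8(n+1)F(n)^2}{n(n+2)\,q'(x)\,Q_{n-1}(x)\,(1-x)^2}$. Step map $T_n(\alpha,\beta)=(\alpha_{new},\beta_{new})$: with $$\Gamma=\tfrac12(n+1)(n+2)\left(1+n(n+3)\alpha+6n(n+3)(n^2+3n-1)\beta-3n^2(n-1)(n+1)(n+2)(n+3)^2(n+4)\beta^2\right),$$ $$E=1+(n+1)(n+2)\left(\alpha+3n(n+3)\beta(2-(n-1)(n+1)(n+2)(n+4)\beta)\right),\quad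 G=1-3n(n+1)(n+2)(n+3)\beta,$$ $$\begin{aligned}\alpha_{new}=-\alpha+\frac{E}{12\Gamma^2}\Big(&8n^2+24n+12+n(n+3)\big[(11n^2+33n+16)\alpha+12(4n^4+24n^3+34n^2-6n-8)\beta\\&+3n(n+1)(n+2)(n+3)\big(-4(n+1)(n+2)(2n^2+6n-5)\beta^2\\&-3(n-1)n(n+1)(n+2)(n+3)(n+4)\alpha\beta^2+2(3n^2+9n-6)\alpha\beta+\alpha^2\big)\big]\Big),\end{aligned}$$ $$\beta_{new}=\beta+\frac{EG}{6(n+1)(n+2)\Gamma}.$$ Extended step map: $T_{\omega,n}(\alpha,\beta)=\left(\dfrac{4\,\mathcal A}{3(n+1)^2\Gamma_\omega^2},\ \dfrac{\mathcal B}{3\,\Gamma_\omega(n+1)^2(n+2)n}\right)$, where $$\begin{aligned}\Gamma_\omega=&-(n+2)\left(1+n(n+3)\alpha+6n(n+3)(n^2+3n-1)\beta-3n^2(n-1)(n+1)(n+2)(n+3)^2(n+4)\beta^2\right)\\&+\omega\left(-\alpha n(n+2)(n-1)+3\beta n(n+2)(n-1)\left(\beta n(n-2)(n+3)(n+1)(n+2)(n-1)-2(n^2+n-3)\right)-n\right),\end{aligned}$$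 $$\begin{aligned}\mathcal B=\ &\omega\left(-\alpha n(n+2)(n+1)+3\beta^2n^3(n-1)(n+2)^2(n+1)^3-6\beta n(n+2)(n+1)(n^2+n-1)-2-n\right)\\&-\alpha n(n+2)(n+1)+3\beta^2n^2(n+3)(n+2)^3(n+1)^3-6\beta n(n+2)(n+1)(n^2+3n+1)-n,\end{aligned}$$ and $\mathcal A=\omega^2a_2+\omega a_1+a_0$ with $$\begin{aligned}a_2=\ &\alpha^2n(n-1)(n+2)(n+1)(2n^2+2n-3)+\alpha\big(-3\beta^2n^2(2n^2+2n-9)(2n^2+2n-3)(n-1)^2(n+2)^2(n+1)^2\\&+6\beta n(n-1)(n+2)(n+1)(2n^2+2n-5)(2n^2+2n-3)+(2n^2+2n-3)(2n^2+2n-1)\big)\\&+9\beta^4n^4(n-2)(n+3)(2n^2+2n-9)(n+2)^3(n-1)^3(n+1)^4\\&-36\beta^3n^2(2n^4+4n^3-9n^2-11n+6)(n^2+n-3)(n-1)^2(n+2)^2(n+1)^2\\&+6\beta^2n(n-1)(n+2)(n+1)(10n^6+30n^5-35n^4-120n^3+67n^2+132n-72)\\&+12\beta(n+2)(n-1)(2n^2+2n-3)(n^2+n-1)+2n^2+2n-1,\end{aligned}$$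 $$\begin{aligned}a_1=\ &2\alpha^2n(n+2)(2n^2+4n-3)(n+1)^2+\alpha\big(-6\beta^2n^2(n+3)(n-1)(4n^4+16n^3+20n^2+8n-27)(n+2)^2(n+1)^2\\&+12\beta n(n+2)(n+1)^2(2n^2+4n-3)^2+2(2n^2+4n-1)(2n^2+4n+3)\big)\\&+18\beta^4n^3(2n^4+8n^3-5n^2-26n+12)(n+3)^2(n-1)^2(n+2)^3(n+1)^4\\&-72\beta^3n^2(n+3)(n-1)(2n^2+4n-7)(n^4+4n^3+4n^2-3)(n+2)^2(n+1)^2\\&+12\beta^2n(n-1)(n+3)(n+2)(10n^4+40n^3-n^2-82n+30)(n+1)^2\\&+\beta(72-192n+480n^3+600n^4+288n^5+48n^6)+6+8n+4n^2,\end{aligned}$$ $$\begin{aligned}a_0=\ &\alpha^2n(n+3)(n+2)(n+1)(2n^2+6n+1)+\alpha\big(-3\beta^2n^2(2n^2+6n-5)(2n^2+6n+1)(n+3)^2(n+2)^2(n+1)^2\\&+6\beta n(n+3)(n+2)(n+1)(2n^2+6n-1)(2n^2+6n+1)+(2n^2+6n+1)(2n^2+6n+3)\big)\\&+9\beta^4n^3(n-1)(n+4)(2n^2+6n-5)(n+3)^3(n+2)^4(n+1)^4\\&-36\beta^3n^2(2n^4+12n^3+15n^2-9n-8)(n^2+3n-1)(n+3)^2(n+2)^2(n+1)^2\\&+6\beta^2n(n+3)(n+2)(n+1)(10n^6+90n^5+265n^4+240n^3-53n^2-24n+12)\\&+12\beta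 n(n+3)(n^2+3n+1)(2n^2+6n+1)+2n^2+6n+3.\end{aligned}$$ Quadratic for $\omega$: $A\omega^2+B\omega+C=0$, where $A,B,C$ (polynomials in $n,\lambda,\alpha,\beta$) are the coefficients in $$A\omega^2+B\omega+C=3(n+1)^2\lambda^4\Gamma_\omega^2+4n(n+2)\lambda^3\mathcal A+6(n^2+2n-1)\lambda^2\mathcal B\,\Gamma_\omega-(n-1)(n+3)\mathcal B^2 .$$ Middle: with $P=P_n^{(0,0)}$, $$H_0(n,\alpha,\beta)=1+n(n-1)\left(\alpha+(n+1)(n-2)\beta(6-3\beta(n+2)n(n-1)(n-3))\right),$$ $I_L=H_0(n+1,\alpha_L,\beta_L)$, $I_R=H_0(n+1,\alpha_R,\beta_R)$, $$H(n)=\tfrac12H_0(n,\alpha_L,\beta_L)I_R+\tfrac12H_0(n,\alpha_R,\beta_R)I_L-36(n-1)n^2(n+1)(\beta_L-\beta_R)^2,$$ $H_1(\alpha,\beta)=\alpha+12n(n+1)\beta(1-(n-1)(n+2)(n^2+n+3)\beta)$, $H_2(\beta)=\beta(1-3(n-1)n(n+1)(n+2)\beta)$, $H_3(\alpha,\beta)=H_0(n+1,\alpha,\beta)+24n(n+1)H_2(\beta)$,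 $H_4(\alpha,\beta)=1+n(n+1)(2\alpha+3(n-1)n(n+1)(n+2)(13n^2+13n-18)\beta^2)$, and $$\begin{aligned}M_n(\alpha_L,\alpha_R,\beta_L,\beta_R)=\ &\tfrac12\left(H_3(\alpha_L,\beta_L)I_R+H_3(\alpha_R,\beta_R)I_L\right)P\\&+\left(H_1(\alpha_L,\beta_L)I_R(1-x)-H_1(\alpha_R,\beta_R)I_L(1+x)\right)P'\\&+12\left(H_2(\beta_L)I_R(1-x)+H_2(\beta_R)I_L(1+x)\right)P''\\&-36(\beta_L-\beta_R)^2n(n+1)\left(n(n+1)P-2xP'+2P''\right)\\&+12\left(H_2(\beta_R)H_4(\alpha_L,\beta_L)-H_2(\beta_L)H_4(\alpha_R,\beta_R)\right)P'\\&+72n(n+1)(\beta_L-\beta_R)\left(\beta_L+\beta_R-6(n-1)n(n+1)(n+2)\beta_L\beta_R\right)xP'',\end{aligned}$$ $M_{\omega,n}=M_n+\omega M_{n-1}$, with weight $\dfrac{2H(n)^2}{n\,m'(x)\,M_{n-1}(x)}$ at a root $x$ of $m=M_n$ or $m=M_{\omega,n}$. Equations at the knot between two middle subintervals: put $$\begin{aligned}\mathsf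 A(\alpha,\beta)&=9n^2(n+2)^2(n+1)^4\left(-\alpha(n+3)(n-1)+3\beta^2n(n+4)(n-2)(n+2)(n+3)^2(n-1)^2-6\beta(n+3)(n-1)(n^2+2n-4)-1\right),\\ \mathsf B(\alpha,\beta)&=18n(n+2)(n+1)^2\left(\alpha(n^2+2n-1)-3\beta^2n(n-1)(n+3)(n+2)(n^2+2n-4)(n+1)^2+6\beta(n^2+2n-2)(n^2+2n-1)+1\right),\\ \mathsf C(\alpha,\beta)&=3\alpha(n+1)^2-9\beta^2n^2(n+2)^2(n+1)^4+18\beta n(n+2)(n+1)^2+3,\\ \mathsf D(\alpha,\beta)&=3(n+1)^2\left(\alpha n(n+2)-3\beta^2n^2(n+3)(n-1)(n+2)^2(n+1)^2+6\beta n(n+2)(n^2+2n-1)+1\right),\end{aligned}$$ let $A_1,B_1,C_1,D_1$ be $\mathsf A,\mathsf B,\mathsf C,\mathsf D$ at $(\alpha_L,\beta_L)$ and $A_2,B_2,C_2,D_2$ be $\mathsf A,\lambda^2\mathsf B,\lambda^4\mathsf C,-\lambda^3\mathsf D$ at $(\alpha_R,\beta_R)$. The equations for $(\alpha_{R,M},\beta_{R,M})$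 are $$A_i\,\beta_{R,M}^2+B_i\,\beta_{R,M}+C_i+D_i\,\alpha_{R,M}=0\qquad(i=1,2).\tag{$*$}$$ **The algorithm.** Let $l,r\ge0$ be integers, $S_M=2l+1$ and $S=2(l+r)+1$ (odd case) or $S=2(l+r)+2$ (even case). *Left side.* Start with all parameters ($\alpha$, or $(\alpha,\beta)$) equal to $0$. For $s=1,3,\dots,2l-1$: with $n=N$ and $\lambda=L_{s+1}/L_s$ let $\omega$ be given by the formula above ($c=0$), or be any chosen real root of the quadratic ($c=1$). Place the $N$ roots of $Q_{\omega,N}$ with their weights on $I_s$. Replace the parameters by their image under $T_{\omega,N}$, then $\alpha$ by $\alpha/\lambda$ and, if $c=1$, $\beta$ by $\beta/\lambda^2$. Place the $N-1$ roots of $Q_{N-1}$ with their weights (with $n=N-1$) on $I_{s+1}$. Replace the parameters by their image under $T_{N-1}$, then divide by $\mu$ and (for $\beta$) by $\mu^2$, $\mu=L_{s+2}/L_{s+1}$. Call the final parameters $\alpha_L$ (and $\beta_L$). *Right side.* Do the same with $r$ steps from the right end, i.e. with the lengths $L_S,L_{S-1},\dots$ and with reflected pairs $(-x,w)$. Call the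 final parameters $\alpha_R$ (and $\beta_R$). *Middle, $S$ odd.* If $c=0$, place the $N$ roots of $M_N(\alpha_L,\alpha_R)$ with their weights on $I_{S_M}$. If $c=1$, place the $N+1$ roots of $M_{\omega,N+1}(\alpha_L,\alpha_R,\beta_L,\beta_R)$ with their weights ($n=N+1$) on $I_{S_M}$; here $\omega\in\mathbb R$ is a free parameter. *Middle, $S$ even.* Let $\lambda=L_{S_M+1}/L_{S_M}$. If $c=0$, let $\alpha_{R,M}=\omega$, a free real parameter. If $c=1$, let $(\alpha_{R,M},\beta_{R,M})$ be a real solution of $(*)$ with $n=N$. Let $\alpha_{L,M}=-\alpha_{R,M}/\lambda$ and, if $c=1$, $\beta_{L,M}=\beta_{R,M}/\lambda^2$. Place the $N$ roots of $M_N$ for the parameters $\alpha_L,\alpha_{R,M}$ (and $\beta_L,\beta_{R,M}$) on $I_{S_M}$ and the $N$ roots of $M_N$ for $\alpha_{L,M},\alpha_R$ (and $\beta_{L,M},\beta_R$) on $I_{S_M+1}$, with their weights. A run is called *admissible* if each of the polynomials used has as many distinct simple real roots as stated ($N$, $N-1$ or $N+1$) and no other real roots, all in $[-1,1)$ for $Q_{\omega,N}$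 and $Q_{N-1}$ and all in $[-1,1]$ for the middle polynomials. **Theorem.** 1. $c=0$, $S$ odd: the run is always admissible and the rule is optimal for $S_{2N-1,0}$. 2. $c=0$, $S$ even: for every $\omega$ for which the run is admissible the rule is 1-parameter optimal for $S_{2N-1,0}$; the run is admissible for all $\omega$ in a neighbourhood of $0$, and distinct admissible $\omega$ give distinct rules. 3. $c=1$, $S$ odd: for all choices of the roots of the quadratics and every $\omega$ in the middle for which the run is admissible, the rule is 1-parameter optimal for $S_{2N,1}$; for fixed choices of the roots, distinct admissible $\omega$ give distinct rules. 4. $c=1$, $S$ even: for all choices of the roots of the quadratics and of a solution of $(*)$ for which the run is admissible, the rule is optimal for $S_{2N,1}$. 5. In case $c=1$ and for all real parameters: if $A\ne0$ and $B^2-4AC\ge0$, then $\omega=\frac{-B\pm\sqrt{B^2-4AC}}{2A}$ solve the quadratic. Put $A_3=D_2A_1-D_1A_2$, $B_3=D_2B_1-D_1B_2$, $C_3=D_2C_1-D_1C_2$, $B_4=A_2B_1-A_1B_2$, $C_4=A_2C_1-A_1C_2$, $D_4=D_1A_2-D_2A_1$; if $A_3\neq0$ and $B_3^2-4A_3C_3\ge0$,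 then $$\beta_{R,M}=\frac{-B_3-\sqrt{B_3^2-4A_3C_3}}{2A_3},\qquad \alpha_{R,M}=-\frac{C_4+B_4\beta_{R,M}}{D_4}$$ solve $(*)$ (with $n=N$). -/

import Mathlib

open Polynomial

namespace SplineQuad

noncomputable section

/-! ## Splines and quadrature rules -/

/-- The spline class of degree `D` and continuity class `c` on the `S` subintervals
`[t i, t (i+1)]`, `i < S`: functions on `[t 0, t S]` (extended by zero) that coincide on each
subinterval with a polynomial of degree at most `D`, such that at every inner knot the derivatives
of order `0, ..., c` of the two adjacent polynomials agree. -/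
def splineSpace (S D c : ℕ) (t : ℕ → ℝ) : Submodule ℝ (ℝ → ℝ) where
  carrier := {f | (∀ x, x ∉ Set.Icc (t 0) (t S) → f x = 0) ∧
    ∃ p : ℕ → ℝ[X],
      (∀ i < S, (p i).natDegree ≤ D ∧ ∀ x ∈ Set.Icc (t i) (t (i + 1)), f x = (p i).eval x) ∧
      ∀ i, i + 1 < S → ∀ k ≤ c,
        (derivative^[k] (p i)).eval (t (i + 1)) = (derivative^[k] (p (i + 1))).eval (t (i + 1))}
  add_mem' := by
    rintro f g ⟨hf0, p, hp, hpk⟩ ⟨hg0, q, hq, hqk⟩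
    refine ⟨fun x hx => by simp [hf0 x hx, hg0 x hx], fun i => p i + q i, ?_, ?_⟩
    · intro i hi
      refine ⟨(natDegree_add_le _ _).trans (max_le (hp i hi).1 (hq i hi).1), fun x hx => ?_⟩
      simp [(hp i hi).2 x hx, (hq i hi).2 x hx]
    · intro i hi k hk
      simp [iterate_map_add, hpk i hi k hk, hqk i hi k hk]
  zero_mem' := ⟨fun _ _ => rfl, fun _ => 0, by simp, by simp⟩
  smul_mem' := by
    rintro a f ⟨hf0, p, hp, hpk⟩
    refine ⟨fun x hx => by simp [hf0 x hx], fun i => a • p i, ?_, ?_⟩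
    · intro i hi
      refine ⟨(natDegree_smul_le _ _).trans (hp i hi).1, fun x hx => ?_⟩
      simp [(hp i hi).2 x hx]
    · intro i hi k hk
      simp [iterate_derivative_smul, hpk i hi k hk]

/-- A quadrature rule is a finite family of pairs (node, weight). It is exact for the spline class
if its nodes lie in `[t 0, t S]` and it integrates every spline of the class exactly. -/
def IsExact (S D c : ℕ) (t : ℕ → ℝ) (R : Multiset (ℝ × ℝ)) : Prop :=
  (∀ q ∈ R, q.1 ∈ Set.Icc (t 0) (t S)) ∧
  ∀ f ∈ splineSpace S D c t, (R.map fun q => q.2 * f q.1).sum = ∫ x in (t 0)..(t S), f x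

/-- An exact rule with pairwise distinct nodes whose number of nodes is minimal among all exact
rules. -/
def IsMinimal (S D c : ℕ) (t : ℕ → ℝ) (R : Multiset (ℝ × ℝ)) : Prop :=
  IsExact S D c t R ∧ (R.map Prod.fst).Nodup ∧
  ∀ R', IsExact S D c t R' → Multiset.card R ≤ Multiset.card R'

/-- Optimal (Gaussian): minimal, and the number of parameters (nodes and weights) is equal to the
dimension of the spline class. -/
def IsOptimal (S D c : ℕ) (t : ℕ → ℝ) (R : Multiset (ℝ × ℝ)) : Prop :=
  IsMinimal S D c t R ∧ 2 * Multiset.card R = Module.finrank ℝ (splineSpace S D c t)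

/-- 1-parameter optimal: minimal, and there is exactly one parameter more than the dimension of the
spline class. -/
def IsOneParamOptimal (S D c : ℕ) (t : ℕ → ℝ) (R : Multiset (ℝ × ℝ)) : Prop :=
  IsMinimal S D c t R ∧ 2 * Multiset.card R = Module.finrank ℝ (splineSpace S D c t) + 1

/-- Length of the `i`-th subinterval (counted from `0`). -/
def len (t : ℕ → ℝ) (i : ℕ) : ℝ := t (i + 1) - t i

/-- The pairs `(x, w x)`, `x` a root of `p`, scaled from `[-1, 1]` to the subinterval `i`. -/
def place (t : ℕ → ℝ) (i : ℕ) (p : ℝ[X]) (w : ℝ → ℝ) : Multiset (ℝ × ℝ) :=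
  p.roots.map fun x => (t i + (1 + x) / 2 * len t i, w x * (len t i / 2))

/-- The reflected pairs `(-x, w x)`, `x` a root of `p`, scaled from `[-1, 1]` to the
subinterval `i`. -/
def placeRefl (t : ℕ → ℝ) (i : ℕ) (p : ℝ[X]) (w : ℝ → ℝ) : Multiset (ℝ × ℝ) :=
  p.roots.map fun x => (t i + (1 + -x) / 2 * len t i, w x * (len t i / 2))

/-- The polynomial `p` has exactly `n` real roots, all of them simple and in `I`. -/
def HasRootsIn (p : ℝ[X]) (n : ℕ) (I : Set ℝ) : Prop :=
  Multiset.card p.roots = n ∧ p.roots.Nodup ∧ ∀ x ∈ p.roots, x ∈ I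

/-- The Jacobi polynomial `P_n^{(a, b)}` for natural numbers `a`, `b`. -/
def jacobi (a b n : ℕ) : ℝ[X] :=
  ∑ s ∈ Finset.range (n + 1),
    C (((n + a).choose (n - s) * (n + b).choose s : ℝ) / 2 ^ n) * (X - 1) ^ s * (X + 1) ^ (n - s)

/-! ## Continuity class 0 -/

namespace C0

def F (n α : ℝ) : ℝ := 1 + α * n * (n + 1)

/-- The polynomial `Q_n(α, x)`. -/
def Q (n : ℕ) (α : ℝ) : ℝ[X] :=
  C (F n α + α * n) * jacobi 1 0 n + C α * (1 - X) * derivative (jacobi 1 0 n)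

/-- `Q_{ω,n} = Q_n + ω Q_{n-1}`. -/
def Qω (n : ℕ) (α ω : ℝ) : ℝ[X] := Q n α + C ω * Q (n - 1) α

/-- The weight at a root `x` of `p`, where `p` is `Q_n` or `Q_{ω,n}`. -/
def weightQ (n : ℕ) (α : ℝ) (p : ℝ[X]) (x : ℝ) : ℝ :=
  2 * (2 * n + 1) * F n α ^ 2 /
    (n * (n + 1) * (derivative p).eval x * (Q (n - 1) α).eval x * (1 - x))

/-- The recursion map for the next subinterval after one that carries the roots of `Q_n`. -/
def step (n α : ℝ) : ℝ :=
  (1 + (n + 1) ^ 2 * α) / ((n + 1) * ((n + 1) * (1 + n * (n + 2) * α)))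

/-- The value of `ω`; `lam` is the stretching factor inside a pair of subintervals. -/
def omega (n lam α : ℝ) : ℝ :=
  -(n * (1 + (n + 1) ^ 2 * α) + lam * (n + 1) * (1 + n * (n + 2) * α)) /
    ((n + 1) * (1 + n ^ 2 * α) + lam * n * (1 + (n - 1) * (n + 1) * α))

def Γω (n ω α : ℝ) : ℝ :=
  (n + 1) * (1 + n * (n + 2) * α) + ω * n * (1 + (n - 1) * (n + 1) * α)

/-- The extended recursion map, after a subinterval that carries the roots of `Q_{ω,n}`. -/
def stepω (n ω α : ℝ) : ℝ :=
  (n * (1 + (n + 1) ^ 2 * α) + ω * (n + 1) * (1 + n ^ 2 * α)) / (n * (n + 1) * Γω n ω α)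

/-- The stretching factor of the subinterval `i + 1` with respect to `i`, for the lengths `L`. -/
def stretch (L : ℕ → ℝ) (i : ℕ) : ℝ := L (i + 1) / L i

/-- The parameter of the first subinterval (number `2 k`, counted from `0` and from the outer end)
of the `k`-th pair, for the subinterval lengths `L`. -/
def param (N : ℕ) (L : ℕ → ℝ) : ℕ → ℝ
  | 0 => 0
  | k + 1 =>
    step ((N : ℝ) - 1)
      (stepω N (omega N (stretch L (2 * k)) (param N L k)) (param N L k) / stretch L (2 * k)) /
      stretch L (2 * k + 1)

/-- The value of `ω` in the `k`-th pair. -/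
def pairω (N : ℕ) (L : ℕ → ℝ) (k : ℕ) : ℝ := omega N (stretch L (2 * k)) (param N L k)

/-- The parameter of the second subinterval (number `2 k + 1`) of the `k`-th pair. -/
def param₂ (N : ℕ) (L : ℕ → ℝ) (k : ℕ) : ℝ :=
  stepω N (pairω N L k) (param N L k) / stretch L (2 * k)

/-- The polynomials of the `k`-th pair. -/
def poly₁ (N : ℕ) (L : ℕ → ℝ) (k : ℕ) : ℝ[X] := Qω N (param N L k) (pairω N L k)
def poly₂ (N : ℕ) (L : ℕ → ℝ) (k : ℕ) : ℝ[X] := Q (N - 1) (param₂ N L k)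

/-- The roots in the first `m` pairs are simple and lie in `[-1, 1)`, as the weights need. -/
def SideOK (N m : ℕ) (L : ℕ → ℝ) : Prop :=
  ∀ k < m, HasRootsIn (poly₁ N L k) N (Set.Ico (-1) 1) ∧
    HasRootsIn (poly₂ N L k) (N - 1) (Set.Ico (-1) 1)

/-- The subinterval lengths, from left to right and from right to left. -/
def lenL (t : ℕ → ℝ) : ℕ → ℝ := len t
def lenR (S : ℕ) (t : ℕ → ℝ) (i : ℕ) : ℝ := len t (S - 1 - i)

/-- The nodes and weights in the `l` pairs of subintervals left from the middle. -/
def leftRule (N l : ℕ) (t : ℕ → ℝ) : Multiset (ℝ × ℝ) :=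
  ∑ k ∈ Finset.range l,
    (place t (2 * k) (poly₁ N (lenL t) k)
        (weightQ N (param N (lenL t) k) (poly₁ N (lenL t) k)) +
      place t (2 * k + 1) (poly₂ N (lenL t) k)
        (weightQ (N - 1) (param₂ N (lenL t) k) (poly₂ N (lenL t) k)))

/-- The nodes and weights in the `r` pairs of subintervals right from the middle. -/
def rightRule (N r S : ℕ) (t : ℕ → ℝ) : Multiset (ℝ × ℝ) :=
  ∑ k ∈ Finset.range r,
    (placeRefl t (S - 1 - 2 * k) (poly₁ N (lenR S t) k)
        (weightQ N (param N (lenR S t) k) (poly₁ N (lenR S t) k)) +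
      placeRefl t (S - 1 - (2 * k + 1)) (poly₂ N (lenR S t) k)
        (weightQ (N - 1) (param₂ N (lenR S t) k) (poly₂ N (lenR S t) k)))

def H (n αL αR : ℝ) : ℝ := 1 + n ^ 2 * (αL + αR + (n - 1) * (n + 1) * αL * αR)
def H₁ (n αL αR : ℝ) : ℝ := αL + αR + 2 * n * (n + 1) * αL * αR
def H₂ (n α : ℝ) : ℝ := 1 + α * n * (n + 1)

/-- The polynomial `M_n(αL, αR, x)`. -/
def M (n : ℕ) (αL αR : ℝ) : ℝ[X] :=
  C (H n αL αR + n * H₁ n αL αR) * jacobi 0 0 n +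
    (C (αL * H₂ n αR) * (1 - X) - C (αR * H₂ n αL) * (1 + X)) * derivative (jacobi 0 0 n)

/-- The weight at a root `x` of `M_n`. -/
def weightM (n : ℕ) (αL αR x : ℝ) : ℝ :=
  2 * H n αL αR ^ 2 / (n * (derivative (M n αL αR)).eval x * (M (n - 1) αL αR).eval x)

/-- One middle subinterval, `S = 2 (l + r) + 1`: the roots behave. -/
def OddOK (N l r : ℕ) (t : ℕ → ℝ) : Prop :=
  let S := 2 * (l + r) + 1
  SideOK N l (lenL t) ∧ SideOK N r (lenR S t) ∧
  HasRootsIn (M N (param N (lenL t) l) (param N (lenR S t) r)) N (Set.Icc (-1) 1)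

/-- One middle subinterval, `S = 2 (l + r) + 1`: the rule. -/
def oddRule (N l r : ℕ) (t : ℕ → ℝ) : Multiset (ℝ × ℝ) :=
  let S := 2 * (l + r) + 1
  let αL := param N (lenL t) l
  let αR := param N (lenR S t) r
  leftRule N l t + place t (2 * l) (M N αL αR) (weightM N αL αR) + rightRule N r S t

/-- Two middle subintervals, `S = 2 (l + r) + 2`: the roots behave. The parameters at the knot
between the middle subintervals are `ω` on its left and `-ω / λ` on its right, with `ω` free. -/
def EvenOK (N l r : ℕ) (t : ℕ → ℝ) (ω : ℝ) : Prop :=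
  let S := 2 * (l + r) + 2
  let lam := stretch (lenL t) (2 * l)
  SideOK N l (lenL t) ∧ SideOK N r (lenR S t) ∧
  HasRootsIn (M N (param N (lenL t) l) ω) N (Set.Icc (-1) 1) ∧
  HasRootsIn (M N (-ω / lam) (param N (lenR S t) r)) N (Set.Icc (-1) 1)

/-- Two middle subintervals, `S = 2 (l + r) + 2`: the rule. -/
def evenRule (N l r : ℕ) (t : ℕ → ℝ) (ω : ℝ) : Multiset (ℝ × ℝ) :=
  let S := 2 * (l + r) + 2
  let lam := stretch (lenL t) (2 * l)
  let αL := param N (lenL t) l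
  let αR := param N (lenR S t) r
  leftRule N l t + place t (2 * l) (M N αL ω) (weightM N αL ω) +
    place t (2 * l + 1) (M N (-ω / lam) αR) (weightM N (-ω / lam) αR) + rightRule N r S t

end C0

/-! ## Continuity class 1 -/

namespace C1

open C0 (stretch lenL lenR)

def F (n α β : ℝ) : ℝ :=
  1 + n * (n + 2) * (α + 6 * (n ^ 2 + 2 * n - 1) * β -
    3 * (n - 1) * n * (n + 1) ^ 2 * (n + 2) * (n + 3) * β ^ 2)
def F₁ (n α β : ℝ) : ℝ :=
  α + 12 * β * (n ^ 2 + 3 * n + 1 - n * (n + 1) ^ 2 * (n + 2) ^ 2 * (n + 3) * β)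
def F₂ (n β : ℝ) : ℝ := β * (1 - 3 * n * (n + 1) * (n + 2) * (n + 3) * β)

/-- The polynomial `Q_n(α, β, x)`. -/
def Q (n : ℕ) (α β : ℝ) : ℝ[X] :=
  C (F n α β + n * F₁ n α β) * jacobi 2 0 n +
    C (F₁ n α β) * (1 - X) * derivative (jacobi 2 0 n) -
    C (36 * F₂ n β) * derivative (jacobi 2 0 n) +
    C (12 * F₂ n β) * (1 - X) * derivative (derivative (jacobi 2 0 n))

/-- `Q_{ω,n} = Q_n + ω Q_{n-1}`. -/
def Qω (n : ℕ) (α β ω : ℝ) : ℝ[X] := Q n α β + C ω * Q (n - 1) α β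

/-- The weight at a root `x` of `p`, where `p` is `Q_n` or `Q_{ω,n}`. -/
def weightQ (n : ℕ) (α β : ℝ) (p : ℝ[X]) (x : ℝ) : ℝ :=
  8 * (n + 1) * F n α β ^ 2 /
    (n * (n + 2) * ((derivative p).eval x * (Q (n - 1) α β).eval x * (1 - x) ^ 2))

def Γ (n α β : ℝ) : ℝ :=
  (1 + n * (n + 3) * α + 6 * n * (n + 3) * (n ^ 2 + 3 * n - 1) * β -
    3 * n ^ 2 * (n - 1) * (n + 4) * (n + 2) * (1 + n) * (n + 3) ^ 2 * β ^ 2) * (1 + n) * (n + 2) / 2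
def E (n α β : ℝ) : ℝ :=
  1 + (n + 1) * (n + 2) * (α + 3 * n * (n + 3) * β * (2 - (n - 1) * (n + 1) * (n + 2) * (n + 4) * β))
def G (n β : ℝ) : ℝ := 1 - 3 * n * (n + 1) * (n + 2) * (n + 3) * β

/-- The recursion map for the next subinterval after one that carries the roots of `Q_n`. -/
def stepα (n α β : ℝ) : ℝ :=
  -α + E n α β * (8 * n ^ 2 + 24 * n + 12 + n * (n + 3) * ((11 * n ^ 2 + 33 * n + 16) * α +
    12 * (4 * n ^ 4 + 24 * n ^ 3 + 34 * n ^ 2 - 6 * n - 8) * β +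
    3 * n * (n + 1) * (n + 2) * (n + 3) * (
      -4 * (n + 1) * (n + 2) * (2 * n ^ 2 + 6 * n - 5) * β ^ 2 -
      3 * (n - 1) * n * (n + 1) * (n + 2) * (n + 3) * (n + 4) * α * β ^ 2 +
      2 * (3 * n ^ 2 + 9 * n - 6) * α * β + α ^ 2))) / (12 * Γ n α β ^ 2)
def stepβ (n α β : ℝ) : ℝ := β + E n α β * G n β / (6 * (n + 1) * (n + 2) * Γ n α β)

/-! The coefficients `A = ωA`, `B = ωB`, `C = ωC` of the quadratic equation `A ω² + B ω + C = 0` for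
`ω`; `lam` is the stretching factor inside a pair of subintervals. The suffix `_ij` marks the
coefficient of `α ^ i * β ^ j`. -/

def ωA_00 (n lam : ℝ) : ℝ :=
    3 * lam^4 * n^2 * (n + 1)^2 + 4 * lam^3 * n * (n + 2) * (2 * n^2 + 2 * n - 1) + 6 * lam^2 *
    n * (n + 2) * (n^2 + 2 * n - 1) - (n - 1) * (n + 3) * (n + 2)^2
def ωA_01 (n lam : ℝ) : ℝ :=
    36 * lam^4 * n^2 * (n + 2) * (n - 1) * (n^2 + n - 3) * (n + 1)^2 + 48 * lam^3 * n * (n - 1)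
    * (2 * n^2 + 2 * n - 3) * (n^2 + n - 1) * (n + 2)^2 + 72 * lam^2 * n * (n + 2) * (n^2 + 2 *
    n - 1) * (n^4 + 2 * n^3 - 2 * n^2 - 3 * n + 3) - 12 * n * (n - 1) * (n + 3) * (n + 1) * (n^2
    + n - 1) * (n + 2)^2
def ωA_02 (n lam : ℝ) : ℝ :=
    18 * lam^4 * n^2 * (5 * n^4 + 10 * n^3 - 25 * n^2 - 30 * n + 54) * (n - 1)^2 * (n + 2)^2 *
    (n + 1)^2 + 24 * lam^3 * n^2 * (n - 1) * (n + 1) * (10 * n^6 + 30 * n^5 - 35 * n^4 - 120 *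
    n^3 + 67 * n^2 + 132 * n - 72) * (n + 2)^2 + 36 * lam^2 * n^2 * (n - 1) * (n + 1) * (n^2 + 2
    * n - 1) * (5 * n^4 + 10 * n^3 - 15 * n^2 - 20 * n + 12) * (n + 2)^2 - 6 * n^2 * (n - 1) *
    (n + 3) * (5 * n^4 + 10 * n^3 - 5 * n^2 - 10 * n + 6) * (n + 2)^2 * (n + 1)^2
def ωA_03 (n lam : ℝ) : ℝ :=
    - 108 * lam^4 * n^3 * (n - 2) * (n + 3) * (n^2 + n - 3) * (n - 1)^3 * (n + 2)^3 * (n + 1)^3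
    - 144 * lam^3 * n^3 * (2 * n^4 + 4 * n^3 - 9 * n^2 - 11 * n + 6) * (n^2 + n - 3) * (n - 1)^2
    * (n + 1)^2 * (n + 2)^3 - 216 * lam^2 * n^3 * (n^2 + 2 * n - 1) * (n^4 + 2 * n^3 - 4 * n^2 -
    5 * n + 3) * (n - 1)^2 * (n + 1)^2 * (n + 2)^3 + 36 * n^4 * (n + 3) * (n^2 + n - 1) * (n -
    1)^2 * (n + 2)^3 * (n + 1)^4
def ωA_04 (n lam : ℝ) : ℝ :=
    27 * lam^4 * n^4 * (n - 2)^2 * (n + 3)^2 * (n - 1)^4 * (n + 2)^4 * (n + 1)^4 + 36 * lam^3 *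
    n^5 * (n - 2) * (n + 3) * (2 * n^2 + 2 * n - 9) * (n - 1)^3 * (n + 2)^4 * (n + 1)^4 + 54 *
    lam^2 * n^5 * (n - 2) * (n + 3) * (n^2 + 2 * n - 1) * (n - 1)^3 * (n + 2)^4 * (n + 1)^4 - 9
    * n^6 * (n + 3) * (n - 1)^3 * (n + 2)^4 * (n + 1)^6
def ωA_10 (n lam : ℝ) : ℝ :=
    6 * lam^4 * n^2 * (n + 2) * (n - 1) * (n + 1)^2 + 4 * lam^3 * n * (n + 2) * (2 * n^2 + 2 * n
    - 3) * (2 * n^2 + 2 * n - 1) + 12 * lam^2 * n * (n + 2) * (n^2 + n - 1) * (n^2 + 2 * n - 1)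
    - 2 * n * (n - 1) * (n + 3) * (n + 1) * (n + 2)^2
def ωA_11 (n lam : ℝ) : ℝ :=
    36 * lam^4 * n^2 * (n^2 + n - 3) * (n - 1)^2 * (n + 2)^2 * (n + 1)^2 + 24 * lam^3 * n^2 * (n
    - 1) * (n + 1) * (2 * n^2 + 2 * n - 5) * (2 * n^2 + 2 * n - 3) * (n + 2)^2 + 72 * lam^2 *
    n^2 * (n + 1) * (n^2 + 2 * n - 1) * (n - 1)^2 * (n + 2)^3 - 12 * n^2 * (n - 1) * (n + 3) *
    (n^2 + n - 1) * (n + 2)^2 * (n + 1)^2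
def ωA_12 (n lam : ℝ) : ℝ :=
    - 18 * lam^4 * n^3 * (n - 2) * (n + 3) * (n - 1)^3 * (n + 2)^3 * (n + 1)^3 - 12 * lam^3 *
    n^3 * (2 * n^2 + 2 * n - 9) * (2 * n^2 + 2 * n - 3) * (n - 1)^2 * (n + 1)^2 * (n + 2)^3 - 36
    * lam^2 * n^3 * (n^2 + n - 3) * (n^2 + 2 * n - 1) * (n - 1)^2 * (n + 1)^2 * (n + 2)^3 + 6 *
    n^4 * (n + 3) * (n - 1)^2 * (n + 2)^3 * (n + 1)^4
def ωA_20 (n lam : ℝ) : ℝ :=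
    3 * lam^4 * n^2 * (n - 1)^2 * (n + 2)^2 * (n + 1)^2 + 4 * lam^3 * n^2 * (n - 1) * (n + 1) *
    (2 * n^2 + 2 * n - 3) * (n + 2)^2 + 6 * lam^2 * n^2 * (n - 1) * (n + 1) * (n^2 + 2 * n - 1)
    * (n + 2)^2 - n^2 * (n - 1) * (n + 3) * (n + 2)^2 * (n + 1)^2
def ωA (n lam α β : ℝ) : ℝ :=
  α ^ 2 * ωA_20 n lam + α * (β ^ 2 * ωA_12 n lam + β * ωA_11 n lam + ωA_10 n lam) +
    β ^ 4 * ωA_04 n lam + β ^ 3 * ωA_03 n lam + β ^ 2 * ωA_02 n lam + β * ωA_01 n lam + ωA_00 n lam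

def ωB_00 (n lam : ℝ) : ℝ :=
    6 * lam^4 * n * (n + 2) * (n + 1)^2 + 8 * lam^3 * n * (n + 2) * (2 * n^2 + 4 * n + 3) + 12 *
    lam^2 * (n^2 + 2 * n + 2) * (n^2 + 2 * n - 1) - 2 * n * (n - 1) * (n + 3) * (n + 2)
def ωB_01 (n lam : ℝ) : ℝ :=
    72 * lam^4 * n * (n + 2) * (n^4 + 4 * n^3 + 2 * n^2 - 4 * n + 3) * (n + 1)^2 + 96 * lam^3 *
    n * (n + 2) * (3 + 25 * n^4 - 8 * n + 12 * n^5 + 20 * n^3 + 2 * n^6) + 144 * lam^2 * n * (n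
    + 2) * (n^2 + 2 * n - 1) * (n^4 + 4 * n^3 + 6 * n^2 + 4 * n - 2) - 24 * n * (n - 1) * (n +
    3) * (n + 2) * (n + 1)^4
def ωB_02 (n lam : ℝ) : ℝ :=
    36 * lam^4 * n^2 * (n - 1) * (n + 3) * (5 * n^4 + 20 * n^3 - 13 * n^2 - 66 * n + 16) * (n +
    2)^2 * (n + 1)^2 + 48 * lam^3 * n^2 * (n - 1) * (n + 3) * (10 * n^4 + 40 * n^3 - n^2 - 82 *
    n + 30) * (n + 2)^2 * (n + 1)^2 + 72 * lam^2 * n^2 * (n^2 + 2 * n - 1) * (5 * n^4 + 20 * n^3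
    - 3 * n^2 - 46 * n + 36) * (n + 2)^2 * (n + 1)^2 - 12 * n^2 * (n - 1) * (n + 3) * (5 * n^4 +
    20 * n^3 + 7 * n^2 - 26 * n - 12) * (n + 2)^2 * (n + 1)^2
def ωB_03 (n lam : ℝ) : ℝ :=
    - 216 * lam^4 * n^3 * (n^2 + 2 * n - 5) * (n - 1)^2 * (n + 3)^2 * (n + 2)^3 * (n + 1)^4 -
    288 * lam^3 * n^3 * (n - 1) * (n + 3) * (2 * n^2 + 4 * n - 7) * (n^4 + 4 * n^3 + 4 * n^2 -
    3) * (n + 1)^2 * (n + 2)^3 - 432 * lam^2 * n^3 * (n - 1) * (n + 3) * (n^2 + 2 * n + 2) *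
    (n^2 + 2 * n - 1) * (n^2 + 2 * n - 2) * (n + 1)^2 * (n + 2)^3 + 72 * n^3 * (n - 1) * (n + 3)
    * (n^4 + 4 * n^3 + 4 * n^2 - 3) * (n + 2)^3 * (n + 1)^4
def ωB_04 (n lam : ℝ) : ℝ :=
    54 * lam^4 * n^4 * (n + 4) * (n - 2) * (n - 1)^3 * (n + 3)^3 * (n + 2)^4 * (n + 1)^4 + 72 *
    lam^3 * n^4 * (2 * n^4 + 8 * n^3 - 5 * n^2 - 26 * n + 12) * (n - 1)^2 * (n + 3)^2 * (n +
    2)^4 * (n + 1)^4 + 108 * lam^2 * n^4 * (n^2 + 2 * n - 2) * (n^2 + 2 * n - 1) * (n - 1)^2 *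
    (n + 3)^2 * (n + 2)^4 * (n + 1)^4 - 18 * n^5 * (n - 1)^2 * (n + 3)^2 * (n + 2)^5 * (n + 1)^6
def ωB_10 (n lam : ℝ) : ℝ :=
    12 * lam^4 * n * (n + 2) * (n^2 + 2 * n - 1) * (n + 1)^2 + 8 * lam^3 * n * (n + 2) * (2 *
    n^2 + 4 * n - 1) * (2 * n^2 + 4 * n + 3) + 24 * lam^2 * n * (n + 2) * (n^2 + 2 * n + 2) *
    (n^2 + 2 * n - 1) - 4 * n * (n - 1) * (n + 3) * (n + 2) * (n + 1)^2
def ωB_11 (n lam : ℝ) : ℝ :=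
    72 * lam^4 * n^2 * (n - 1) * (n + 3) * (n^2 + 2 * n - 2) * (n + 2)^2 * (n + 1)^2 + 48 *
    lam^3 * n^2 * (n + 2)^2 * (n + 1)^2 * (2 * n^2 + 4 * n - 3)^2 + 144 * lam^2 * n^2 * (n +
    2)^2 * (n + 1)^2 * (n^2 + 2 * n - 1)^2 - 24 * n^3 * (n - 1) * (n + 3) * (n + 1)^2 * (n +
    2)^3
def ωB_12 (n lam : ℝ) : ℝ :=
    - 36 * lam^4 * n^3 * (n - 1)^2 * (n + 3)^2 * (n + 2)^3 * (n + 1)^4 - 24 * lam^3 * n^3 * (n -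
    1) * (n + 3) * (4 * n^4 + 16 * n^3 + 20 * n^2 + 8 * n - 27) * (n + 1)^2 * (n + 2)^3 - 72 *
    lam^2 * n^3 * (n - 1) * (n + 3) * (n^2 + 2 * n + 4) * (n^2 + 2 * n - 1) * (n + 1)^2 * (n +
    2)^3 + 12 * n^3 * (n - 1) * (n + 3) * (3 + 2 * n + n^2) * (n + 2)^3 * (n + 1)^4
def ωB_20 (n lam : ℝ) : ℝ :=
    6 * lam^4 * n^2 * (n - 1) * (n + 3) * (n + 2)^2 * (n + 1)^2 + 8 * lam^3 * n^2 * (2 * n^2 + 4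
    * n - 3) * (n + 2)^2 * (n + 1)^2 + 12 * lam^2 * n^2 * (n^2 + 2 * n - 1) * (n + 2)^2 * (n +
    1)^2 - 2 * n^2 * (n - 1) * (n + 3) * (n + 2)^2 * (n + 1)^2
def ωB (n lam α β : ℝ) : ℝ :=
  α ^ 2 * ωB_20 n lam + α * (β ^ 2 * ωB_12 n lam + β * ωB_11 n lam + ωB_10 n lam) +
    β ^ 4 * ωB_04 n lam + β ^ 3 * ωB_03 n lam + β ^ 2 * ωB_02 n lam + β * ωB_01 n lam + ωB_00 n lam

def ωC_00 (n lam : ℝ) : ℝ :=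
    3 * lam^4 * (n + 2)^2 * (n + 1)^2 + 4 * lam^3 * n * (n + 2) * (2 * n^2 + 6 * n + 3) + 6 *
    lam^2 * n * (n + 2) * (n^2 + 2 * n - 1) - n^2 * (n - 1) * (n + 3)
def ωC_01 (n lam : ℝ) : ℝ :=
    36 * lam^4 * n * (n + 3) * (n^2 + 3 * n - 1) * (n + 2)^2 * (n + 1)^2 + 48 * lam^3 * n^2 * (n
    + 3) * (n + 2) * (n^2 + 3 * n + 1) * (2 * n^2 + 6 * n + 1) + 72 * lam^2 * n * (n + 2) * (n^2
    + 2 * n - 1) * (n^4 + 6 * n^3 + 10 * n^2 + 3 * n + 1) - 12 * n^2 * (n - 1) * (n + 3) * (n +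
    2) * (n + 1) * (n^2 + 3 * n + 1)
def ωC_02 (n lam : ℝ) : ℝ :=
    18 * lam^4 * n^2 * (5 * n^4 + 30 * n^3 + 35 * n^2 - 30 * n + 14) * (n + 3)^2 * (n + 2)^2 *
    (n + 1)^2 + 24 * lam^3 * n^2 * (n + 3) * (n + 1) * (10 * n^6 + 90 * n^5 + 265 * n^4 + 240 *
    n^3 - 53 * n^2 - 24 * n + 12) * (n + 2)^2 + 36 * lam^2 * n^2 * (n + 3) * (n + 1) * (n^2 + 2
    * n - 1) * (5 * n^4 + 30 * n^3 + 45 * n^2 - 8) * (n + 2)^2 - 6 * n^2 * (n - 1) * (n + 3) *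
    (5 * n^4 + 30 * n^3 + 55 * n^2 + 30 * n + 6) * (n + 2)^2 * (n + 1)^2
def ωC_03 (n lam : ℝ) : ℝ :=
    - 108 * lam^4 * n^3 * (n - 1) * (n + 4) * (n^2 + 3 * n - 1) * (n + 3)^3 * (n + 2)^3 * (n +
    1)^3 - 144 * lam^3 * n^3 * (2 * n^4 + 12 * n^3 + 15 * n^2 - 9 * n - 8) * (n^2 + 3 * n - 1) *
    (n + 3)^2 * (n + 1)^2 * (n + 2)^3 - 216 * lam^2 * n^3 * (n^2 + 2 * n - 1) * (n^4 + 6 * n^3 +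
    8 * n^2 - 3 * n - 3) * (n + 3)^2 * (n + 1)^2 * (n + 2)^3 + 36 * n^3 * (n - 1) * (n^2 + 3 * n
    + 1) * (n + 3)^2 * (n + 2)^4 * (n + 1)^4
def ωC_04 (n lam : ℝ) : ℝ :=
    27 * lam^4 * n^4 * (n - 1)^2 * (n + 4)^2 * (n + 3)^4 * (n + 2)^4 * (n + 1)^4 + 36 * lam^3 *
    n^4 * (n - 1) * (n + 4) * (2 * n^2 + 6 * n - 5) * (n + 3)^3 * (n + 1)^4 * (n + 2)^5 + 54 *
    lam^2 * n^4 * (n - 1) * (n + 4) * (n^2 + 2 * n - 1) * (n + 3)^3 * (n + 1)^4 * (n + 2)^5 - 9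
    * n^4 * (n - 1) * (n + 3)^3 * (n + 2)^6 * (n + 1)^6
def ωC_10 (n lam : ℝ) : ℝ :=
    6 * lam^4 * n * (n + 3) * (n + 2)^2 * (n + 1)^2 + 4 * lam^3 * n * (n + 2) * (2 * n^2 + 6 * n
    + 1) * (2 * n^2 + 6 * n + 3) + 12 * lam^2 * n * (n + 2) * (n^2 + 3 * n + 1) * (n^2 + 2 * n -
    1) - 2 * n^2 * (n - 1) * (n + 3) * (n + 2) * (n + 1)
def ωC_11 (n lam : ℝ) : ℝ :=
    36 * lam^4 * n^2 * (n^2 + 3 * n - 1) * (n + 3)^2 * (n + 2)^2 * (n + 1)^2 + 24 * lam^3 * n^2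
    * (n + 3) * (n + 1) * (2 * n^2 + 6 * n - 1) * (2 * n^2 + 6 * n + 1) * (n + 2)^2 + 72 * lam^2
    * n^3 * (n + 1) * (n^2 + 2 * n - 1) * (n + 3)^2 * (n + 2)^2 - 12 * n^2 * (n - 1) * (n + 3) *
    (n^2 + 3 * n + 1) * (n + 2)^2 * (n + 1)^2
def ωC_12 (n lam : ℝ) : ℝ :=
    - 18 * lam^4 * n^3 * (n - 1) * (n + 4) * (n + 3)^3 * (n + 2)^3 * (n + 1)^3 - 12 * lam^3 *
    n^3 * (2 * n^2 + 6 * n - 5) * (2 * n^2 + 6 * n + 1) * (n + 3)^2 * (n + 1)^2 * (n + 2)^3 - 36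
    * lam^2 * n^3 * (n^2 + 2 * n - 1) * (n^2 + 3 * n - 1) * (n + 3)^2 * (n + 1)^2 * (n + 2)^3 +
    6 * n^3 * (n - 1) * (n + 3)^2 * (n + 2)^4 * (n + 1)^4
def ωC_20 (n lam : ℝ) : ℝ :=
    3 * lam^4 * n^2 * (n + 3)^2 * (n + 2)^2 * (n + 1)^2 + 4 * lam^3 * n^2 * (n + 3) * (n + 1) *
    (2 * n^2 + 6 * n + 1) * (n + 2)^2 + 6 * lam^2 * n^2 * (n + 3) * (n + 1) * (n^2 + 2 * n - 1)
    * (n + 2)^2 - n^2 * (n - 1) * (n + 3) * (n + 2)^2 * (n + 1)^2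
def ωC (n lam α β : ℝ) : ℝ :=
  α ^ 2 * ωC_20 n lam + α * (β ^ 2 * ωC_12 n lam + β * ωC_11 n lam + ωC_10 n lam) +
    β ^ 4 * ωC_04 n lam + β ^ 3 * ωC_03 n lam + β ^ 2 * ωC_02 n lam + β * ωC_01 n lam + ωC_00 n lam

/-- The quadratic equation for `ω`. -/
def IsOmega (n lam α β ω : ℝ) : Prop :=
  ωA n lam α β * ω ^ 2 + ωB n lam α β * ω + ωC n lam α β = 0

/-- Numerators and denominator of the extended recursion map. -/
def Γω (n ω α β : ℝ) : ℝ :=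
  -(n + 2) * (1 + n * (n + 3) * α + 6 * n * (n + 3) * (n ^ 2 + 3 * n - 1) * β -
    3 * n ^ 2 * (n - 1) * (n + 1) * (n + 2) * (n + 3) ^ 2 * (n + 4) * β ^ 2) +
  ω * (-α * n * (n + 2) * (n - 1) + 3 * β * n * (n + 2) * (n - 1) *
    (β * n * (n - 2) * (n + 3) * (n + 1) * (n + 2) * (n - 1) - 2 * (n ^ 2 + n - 3)) - n)

def numα (n ω α β : ℝ) : ℝ :=
    ω^2 * (α^2 * n * (n - 1) * (n + 2) * (n + 1) * (2 * n^2 + 2 * n - 3) + α * (-3 * β^2 * n^2 *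
    (2 * n^2 + 2 * n - 9) * (2 * n^2 + 2 * n - 3) * (n - 1)^2 * (n + 2)^2 * (n + 1)^2 + 6 * β *
    n * (n - 1) * (n + 2) * (n + 1) * (2 * n^2 + 2 * n - 5) * (2 * n^2 + 2 * n - 3) + (2 * n^2 +
    2 * n - 3) * (2 * n^2 + 2 * n - 1)) + 9 * β^4 * n^4 * (n - 2) * (n + 3) * (2 * n^2 + 2 * n -
    9) * (n + 2)^3 * (n - 1)^3 * (n + 1)^4 - 36 * β^3 * n^2 * (2 * n^4 + 4 * n^3 - 9 * n^2 - 11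
    * n + 6) * (n^2 + n - 3) * (n - 1)^2 * (n + 2)^2 * (n + 1)^2 + 6 * β^2 * n * (n - 1) * (n +
    2) * (n + 1) * (10 * n^6 + 30 * n^5 - 35 * n^4 - 120 * n^3 + 67 * n^2 + 132 * n - 72) + 12 *
    β * (n + 2) * (n - 1) * (2 * n^2 + 2 * n - 3) * (n^2 + n - 1) + 2 * n^2 + 2 * n - 1) + ω *
    (2 * α^2 * n * (n + 2) * (2 * n^2 + 4 * n - 3) * (n + 1)^2 + α * (-6 * β^2 * n^2 * (n + 3) *
    (n - 1) * (4 * n^4 + 16 * n^3 + 20 * n^2 + 8 * n - 27) * (n + 2)^2 * (n + 1)^2 + 12 * β * n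
    * (n + 2) * (n + 1)^2 * (2 * n^2 + 4 * n - 3)^2 + 2 * (2 * n^2 + 4 * n - 1) * (2 * n^2 + 4 *
    n + 3)) + 18 * β^4 * n^3 * (2 * n^4 + 8 * n^3 - 5 * n^2 - 26 * n + 12) * (n + 3)^2 * (n -
    1)^2 * (n + 2)^3 * (n + 1)^4 - 72 * β^3 * n^2 * (n + 3) * (n - 1) * (2 * n^2 + 4 * n - 7) *
    (n^4 + 4 * n^3 + 4 * n^2 - 3) * (n + 2)^2 * (n + 1)^2 + 12 * β^2 * n * (n - 1) * (n + 3) *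
    (n + 2) * (10 * n^4 + 40 * n^3 - n^2 - 82 * n + 30) * (n + 1)^2 + β * (72 + 600 * n^4 - 192
    * n + 288 * n^5 + 480 * n^3 + 48 * n^6) + 6 + 8 * n + 4 * n^2) + α^2 * n * (n + 3) * (n + 2)
    * (n + 1) * (2 * n^2 + 6 * n + 1) + α * (-3 * β^2 * n^2 * (2 * n^2 + 6 * n - 5) * (2 * n^2 +
    6 * n + 1) * (n + 3)^2 * (n + 2)^2 * (n + 1)^2 + 6 * β * n * (n + 3) * (n + 2) * (n + 1) *
    (2 * n^2 + 6 * n - 1) * (2 * n^2 + 6 * n + 1) + (2 * n^2 + 6 * n + 1) * (2 * n^2 + 6 * n +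
    3)) + 9 * β^4 * n^3 * (n - 1) * (n + 4) * (2 * n^2 + 6 * n - 5) * (n + 3)^3 * (n + 2)^4 * (n
    + 1)^4 - 36 * β^3 * n^2 * (2 * n^4 + 12 * n^3 + 15 * n^2 - 9 * n - 8) * (n^2 + 3 * n - 1) *
    (n + 3)^2 * (n + 2)^2 * (n + 1)^2 + 6 * β^2 * n * (n + 3) * (n + 2) * (n + 1) * (10 * n^6 +
    90 * n^5 + 265 * n^4 + 240 * n^3 - 53 * n^2 - 24 * n + 12) + 12 * β * n * (n + 3) * (n^2 + 3
    * n + 1) * (2 * n^2 + 6 * n + 1) + 2 * n^2 + 6 * n + 3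

def numβ (n ω α β : ℝ) : ℝ :=
    ω * (-α * n * (n + 2) * (n + 1) + 3 * β^2 * n^3 * (n - 1) * (n + 2)^2 * (n + 1)^3 - 6 * β *
    n * (n + 2) * (n + 1) * (n^2 + n - 1) - 2 - n) - α * n * (n + 2) * (n + 1) + 3 * β^2 * n^2 *
    (n + 3) * (n + 2)^3 * (n + 1)^3 - 6 * β * n * (n + 2) * (n + 1) * (n^2 + 3 * n + 1) - n

/-- The extended recursion map, after a subinterval that carries the roots of `Q_{ω,n}`. -/
def stepωα (n ω α β : ℝ) : ℝ := 4 * numα n ω α β / (3 * (n + 1) ^ 2 * Γω n ω α β ^ 2)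
def stepωβ (n ω α β : ℝ) : ℝ := numβ n ω α β / (3 * Γω n ω α β * (n + 1) ^ 2 * (n + 2) * n)

set_option maxHeartbeats 4000000 in
set_option maxRecDepth 100000 in
/-- The quadratic polynomial in `ω`, not expanded. -/
lemma ω_quadratic (n lam α β ω : ℝ) :
    ωA n lam α β * ω ^ 2 + ωB n lam α β * ω + ωC n lam α β =
      3 * (n + 1) ^ 2 * lam ^ 4 * Γω n ω α β ^ 2 + 4 * n * (n + 2) * lam ^ 3 * numα n ω α β +
      6 * (n ^ 2 + 2 * n - 1) * lam ^ 2 * numβ n ω α β * Γω n ω α β -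
      (n - 1) * (n + 3) * numβ n ω α β ^ 2 := by
  simp only [ωA, ωB, ωC, Γω, numα, numβ,
    ωA_20, ωA_12, ωA_11, ωA_10, ωA_04, ωA_03, ωA_02, ωA_01, ωA_00,
    ωB_20, ωB_12, ωB_11, ωB_10, ωB_04, ωB_03, ωB_02, ωB_01, ωB_00,
    ωC_20, ωC_12, ωC_11, ωC_10, ωC_04, ωC_03, ωC_02, ωC_01, ωC_00]
  ring

/-- The parameters of the second subinterval (number `2 k + 1`) of the `k`-th pair, from the
parameters `(α, β)` of the first one. -/
def next₂ (N : ℕ) (L : ℕ → ℝ) (ω : ℕ → ℝ) (k : ℕ) (q : ℝ × ℝ) : ℝ × ℝ :=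
  (stepωα N (ω k) q.1 q.2 / stretch L (2 * k), stepωβ N (ω k) q.1 q.2 / stretch L (2 * k) ^ 2)

/-- The parameters `(α, β)` of the first subinterval (number `2 k`, counted from `0` and from the
outer end) of the `k`-th pair, for the lengths `L` and the chosen values `ω k`. -/
def param (N : ℕ) (L : ℕ → ℝ) (ω : ℕ → ℝ) : ℕ → ℝ × ℝ
  | 0 => (0, 0)
  | k + 1 =>
    let q := next₂ N L ω k (param N L ω k)
    (stepα ((N : ℝ) - 1) q.1 q.2 / stretch L (2 * k + 1),
      stepβ ((N : ℝ) - 1) q.1 q.2 / stretch L (2 * k + 1) ^ 2)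

def param₂ (N : ℕ) (L : ℕ → ℝ) (ω : ℕ → ℝ) (k : ℕ) : ℝ × ℝ := next₂ N L ω k (param N L ω k)

/-- The polynomials of the `k`-th pair. -/
def poly₁ (N : ℕ) (L : ℕ → ℝ) (ω : ℕ → ℝ) (k : ℕ) : ℝ[X] :=
  Qω N (param N L ω k).1 (param N L ω k).2 (ω k)
def poly₂ (N : ℕ) (L : ℕ → ℝ) (ω : ℕ → ℝ) (k : ℕ) : ℝ[X] :=
  Q (N - 1) (param₂ N L ω k).1 (param₂ N L ω k).2

/-- In the first `m` pairs, `ω k` solves the quadratic equation, and the roots are simple and lie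
in `[-1, 1)`, as the weights need. -/
def SideOK (N m : ℕ) (L : ℕ → ℝ) (ω : ℕ → ℝ) : Prop :=
  ∀ k < m, IsOmega N (stretch L (2 * k)) (param N L ω k).1 (param N L ω k).2 (ω k) ∧
    HasRootsIn (poly₁ N L ω k) N (Set.Ico (-1) 1) ∧
    HasRootsIn (poly₂ N L ω k) (N - 1) (Set.Ico (-1) 1)

/-- The nodes and weights in the `l` pairs of subintervals left from the middle. -/
def leftRule (N l : ℕ) (t : ℕ → ℝ) (ω : ℕ → ℝ) : Multiset (ℝ × ℝ) :=
  ∑ k ∈ Finset.range l,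
    (place t (2 * k) (poly₁ N (lenL t) ω k)
        (weightQ N (param N (lenL t) ω k).1 (param N (lenL t) ω k).2 (poly₁ N (lenL t) ω k)) +
      place t (2 * k + 1) (poly₂ N (lenL t) ω k)
        (weightQ (N - 1) (param₂ N (lenL t) ω k).1 (param₂ N (lenL t) ω k).2
          (poly₂ N (lenL t) ω k)))

/-- The nodes and weights in the `r` pairs of subintervals right from the middle. -/
def rightRule (N r S : ℕ) (t : ℕ → ℝ) (ω : ℕ → ℝ) : Multiset (ℝ × ℝ) :=
  ∑ k ∈ Finset.range r,
    (placeRefl t (S - 1 - 2 * k) (poly₁ N (lenR S t) ω k)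
        (weightQ N (param N (lenR S t) ω k).1 (param N (lenR S t) ω k).2
          (poly₁ N (lenR S t) ω k)) +
      placeRefl t (S - 1 - (2 * k + 1)) (poly₂ N (lenR S t) ω k)
        (weightQ (N - 1) (param₂ N (lenR S t) ω k).1 (param₂ N (lenR S t) ω k).2
          (poly₂ N (lenR S t) ω k)))

def H₀ (n α β : ℝ) : ℝ :=
  1 + n * (n - 1) * (α + (n + 1) * (n - 2) * β * (6 - 3 * β * (n + 2) * n * (n - 1) * (n - 3)))
def H (n αL αR βL βR : ℝ) : ℝ :=
  1 / 2 * H₀ n αL βL * H₀ (n + 1) αR βR + 1 / 2 * H₀ n αR βR * H₀ (n + 1) αL βL -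
    36 * (n - 1) * n ^ 2 * (n + 1) * (βL - βR) ^ 2
def H₁ (n α β : ℝ) : ℝ :=
  α + 12 * n * (n + 1) * β * (1 - (n - 1) * (n + 2) * (n ^ 2 + n + 3) * β)
def H₂ (n β : ℝ) : ℝ := β * (1 - 3 * (n - 1) * n * (n + 1) * (n + 2) * β)
def H₃ (n α β : ℝ) : ℝ := H₀ (n + 1) α β + 24 * n * (n + 1) * H₂ n β
def H₄ (n α β : ℝ) : ℝ :=
  1 + n * (n + 1) * (2 * α +
    3 * (n - 1) * n * (n + 1) * (n + 2) * (13 * n ^ 2 + 13 * n - 18) * β ^ 2)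

/-- The polynomial `M_n(αL, αR, βL, βR, x)`. -/
def M (n : ℕ) (αL αR βL βR : ℝ) : ℝ[X] :=
  let P := jacobi 0 0 n
  let IL := H₀ (n + 1) αL βL
  let IR := H₀ (n + 1) αR βR
  C (1 / 2 * (H₃ n αL βL * IR + H₃ n αR βR * IL)) * P +
    (C (H₁ n αL βL * IR) * (1 - X) - C (H₁ n αR βR * IL) * (1 + X)) * derivative P +
    12 * (C (H₂ n βL * IR) * (1 - X) + C (H₂ n βR * IL) * (1 + X)) *
      derivative (derivative P) -
    C (36 * (βL - βR) ^ 2 * n * (n + 1)) *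
      (C ((n : ℝ) * (n + 1)) * P - 2 * X * derivative P + 2 * derivative (derivative P)) +
    C (12 * (H₂ n βR * H₄ n αL βL - H₂ n βL * H₄ n αR βR)) * derivative P +
    C (72 * n * (n + 1) * (βL - βR) *
        (βL + βR - 6 * (n - 1) * n * (n + 1) * (n + 2) * βL * βR)) *
      X * derivative (derivative P)

/-- `M_{ω,n} = M_n + ω M_{n-1}`. -/
def Mω (n : ℕ) (αL αR βL βR ω : ℝ) : ℝ[X] := M n αL αR βL βR + C ω * M (n - 1) αL αR βL βR

/-- The weight at a root `x` of `p`, where `p` is `M_n` or `M_{ω,n}`. -/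
def weightM (n : ℕ) (αL αR βL βR : ℝ) (p : ℝ[X]) (x : ℝ) : ℝ :=
  2 * H n αL αR βL βR ^ 2 / (n * (derivative p).eval x * (M (n - 1) αL αR βL βR).eval x)

/-- One middle subinterval with `N + 1` nodes, `S = 2 (l + r) + 1`: the choices `ωL`, `ωR` in the
pairs are allowed and, for the value `ω` of the free parameter, the roots behave. -/
def OddOK (N l r : ℕ) (t : ℕ → ℝ) (ωL ωR : ℕ → ℝ) (ω : ℝ) : Prop :=
  let S := 2 * (l + r) + 1
  let L := param N (lenL t) ωL l
  let R := param N (lenR S t) ωR r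
  SideOK N l (lenL t) ωL ∧ SideOK N r (lenR S t) ωR ∧
  HasRootsIn (Mω (N + 1) L.1 R.1 L.2 R.2 ω) (N + 1) (Set.Icc (-1) 1)

/-- One middle subinterval with `N + 1` nodes, `S = 2 (l + r) + 1`: the rule. -/
def oddRule (N l r : ℕ) (t : ℕ → ℝ) (ωL ωR : ℕ → ℝ) (ω : ℝ) : Multiset (ℝ × ℝ) :=
  let S := 2 * (l + r) + 1
  let L := param N (lenL t) ωL l
  let R := param N (lenR S t) ωR r
  let p := Mω (N + 1) L.1 R.1 L.2 R.2 ω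
  leftRule N l t ωL + place t (2 * l) p (weightM (N + 1) L.1 R.1 L.2 R.2 p) + rightRule N r S t ωR

/-- The coefficients of the two defining equations for the parameters at the knot between two
middle subintervals. -/
def mA (n α β : ℝ) : ℝ :=
  9 * n ^ 2 * (n + 2) ^ 2 * (n + 1) ^ 4 * (-α * (n + 3) * (n - 1) +
    3 * β ^ 2 * n * (n + 4) * (n - 2) * (n + 2) * (n + 3) ^ 2 * (n - 1) ^ 2 -
    6 * β * (n + 3) * (n - 1) * (n ^ 2 + 2 * n - 4) - 1)
def mB (n α β : ℝ) : ℝ :=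
  18 * n * (n + 2) * (n + 1) ^ 2 * (α * (n ^ 2 + 2 * n - 1) -
    3 * β ^ 2 * n * (n - 1) * (n + 3) * (n + 2) * (n ^ 2 + 2 * n - 4) * (n + 1) ^ 2 +
    6 * β * (n ^ 2 + 2 * n - 2) * (n ^ 2 + 2 * n - 1) + 1)
def mC (n α β : ℝ) : ℝ :=
  3 * α * (n + 1) ^ 2 - 9 * β ^ 2 * n ^ 2 * (n + 2) ^ 2 * (n + 1) ^ 4 +
    18 * β * n * (n + 2) * (n + 1) ^ 2 + 3
def mD (n α β : ℝ) : ℝ :=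
  3 * (n + 1) ^ 2 * (α * n * (n + 2) -
    3 * β ^ 2 * n ^ 2 * (n + 3) * (n - 1) * (n + 2) ^ 2 * (n + 1) ^ 2 +
    6 * β * n * (n + 2) * (n ^ 2 + 2 * n - 1) + 1)

/-- The two defining equations for the parameters `(α, β)` on the left of the knot between the
middle subintervals; `L = (αL, βL)` and `R = (αR, βR)` are the outer parameters. -/
def IsMiddle (n lam : ℝ) (L R : ℝ × ℝ) (α β : ℝ) : Prop :=
  mA n L.1 L.2 * β ^ 2 + mB n L.1 L.2 * β + mC n L.1 L.2 + mD n L.1 L.2 * α = 0 ∧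
  mA n R.1 R.2 * β ^ 2 + lam ^ 2 * mB n R.1 R.2 * β + lam ^ 4 * mC n R.1 R.2 +
    -lam ^ 3 * mD n R.1 R.2 * α = 0

/-- The closed form of a solution, by elimination of `α` and then of `β ^ 2`. -/
def mA₃ (n lam : ℝ) (L R : ℝ × ℝ) : ℝ :=
  -lam ^ 3 * mD n R.1 R.2 * mA n L.1 L.2 - mD n L.1 L.2 * mA n R.1 R.2
def mB₃ (n lam : ℝ) (L R : ℝ × ℝ) : ℝ :=
  -lam ^ 3 * mD n R.1 R.2 * mB n L.1 L.2 - mD n L.1 L.2 * (lam ^ 2 * mB n R.1 R.2)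
def mC₃ (n lam : ℝ) (L R : ℝ × ℝ) : ℝ :=
  -lam ^ 3 * mD n R.1 R.2 * mC n L.1 L.2 - mD n L.1 L.2 * (lam ^ 4 * mC n R.1 R.2)
def mB₄ (n lam : ℝ) (L R : ℝ × ℝ) : ℝ :=
  mA n R.1 R.2 * mB n L.1 L.2 - mA n L.1 L.2 * (lam ^ 2 * mB n R.1 R.2)
def mC₄ (n lam : ℝ) (L R : ℝ × ℝ) : ℝ :=
  mA n R.1 R.2 * mC n L.1 L.2 - mA n L.1 L.2 * (lam ^ 4 * mC n R.1 R.2)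
def mD₄ (n lam : ℝ) (L R : ℝ × ℝ) : ℝ :=
  mD n L.1 L.2 * mA n R.1 R.2 - -lam ^ 3 * mD n R.1 R.2 * mA n L.1 L.2
def mSQ (n lam : ℝ) (L R : ℝ × ℝ) : ℝ := mB₃ n lam L R ^ 2 - 4 * mA₃ n lam L R * mC₃ n lam L R
def midβ (n lam : ℝ) (L R : ℝ × ℝ) : ℝ :=
  1 / 2 * ((-mB₃ n lam L R - √(mSQ n lam L R)) / mA₃ n lam L R)
def midα (n lam : ℝ) (L R : ℝ × ℝ) : ℝ :=
  -(mC₄ n lam L R + mB₄ n lam L R * midβ n lam L R) / mD₄ n lam L R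

/-- Two middle subintervals, `S = 2 (l + r) + 2`: the choices `ωL`, `ωR` in the pairs and `(α, β)`
at the knot between the middle subintervals are allowed and the roots behave. -/
def EvenOK (N l r : ℕ) (t : ℕ → ℝ) (ωL ωR : ℕ → ℝ) (α β : ℝ) : Prop :=
  let S := 2 * (l + r) + 2
  let lam := stretch (lenL t) (2 * l)
  let L := param N (lenL t) ωL l
  let R := param N (lenR S t) ωR r
  SideOK N l (lenL t) ωL ∧ SideOK N r (lenR S t) ωR ∧ IsMiddle N lam L R α β ∧
  HasRootsIn (M N L.1 α L.2 β) N (Set.Icc (-1) 1) ∧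
  HasRootsIn (M N (-α / lam) R.1 (β / lam ^ 2) R.2) N (Set.Icc (-1) 1)

/-- Two middle subintervals, `S = 2 (l + r) + 2`: the rule. -/
def evenRule (N l r : ℕ) (t : ℕ → ℝ) (ωL ωR : ℕ → ℝ) (α β : ℝ) : Multiset (ℝ × ℝ) :=
  let S := 2 * (l + r) + 2
  let lam := stretch (lenL t) (2 * l)
  let L := param N (lenL t) ωL l
  let R := param N (lenR S t) ωR r
  let p := M N L.1 α L.2 β
  let q := M N (-α / lam) R.1 (β / lam ^ 2) R.2
  leftRule N l t ωL + place t (2 * l) p (weightM N L.1 α L.2 β p) +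
    place t (2 * l + 1) q (weightM N (-α / lam) R.1 (β / lam ^ 2) R.2 q) + rightRule N r S t ωR

end C1

end

end SplineQuad

/-!
The idea is to replace the integral over a subinterval, moved to `[-1, 1]`, by the functional
`knotInteg αL βL αR βR`: the integral plus multiples of the values (parameters `α`) and of the first
derivatives (parameters `β`) at the two ends. A rule that is exact for such a functional on every
subinterval is exact for splines as soon as the corrections of neighbouring subintervals cancel at
the common knot. Values and, for `c = 1`, derivatives of a spline agree at a knot, so this is only a
condition on the parameters: they change sign (for `α`) and get multiplied by powers of the ratio of
the lengths. The corrections in the coordinates of the spline are called `jet`, and the cancellation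
is `mul_sum_interval`, `C1.sum_side` and `C0.sum_side`.

On a single subinterval the rules are Gaussian rules of these functionals. `C1.knotInteg_Q_mul` and
`C0.knotInteg_Q_mul` say that `Q_n` is the orthogonal polynomial for the functional multiplied by
`(1 - x) ^ (c + 1)`, a weight that removes the right end; its norm is a multiple of `F (n + 1)`. In
the same way `M_n` is orthogonal for the full functional, and its norm is a multiple of `H (n + 1)`
(`C1.knotInteg_M_mul`). The step maps pick the correction at the right end for which `Q_n`, or
`Q_{ω,n}`, is orthogonal to `1` (and to `1 - x` if `c = 1`), hence to as many polynomials as needed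
(`C1.knotInteg_Q_step`, `C1.knotInteg_Qω_step`). A polynomial with one more degree of orthogonality
gives a rule of one more degree of exactness: the equation for `ω` says that `F` vanishes, so that
`N - 1` nodes are enough on the next subinterval (`C1.IsOmega.F_eq_zero`, `C0.omega_spec`), and the
equations at the knot between two middle subintervals say that `H` vanishes for both
(`C1.IsMiddle.H_eq_zero`). The weights come from the Christoffel-Darboux argument in
`christoffel_darboux` and `gauss_rule`.

That no exact rule has fewer nodes is seen from the second Peano kernel of a rule. It is orthogonal
to polynomials of degree at most `D - 2` on every subinterval, so it has at least `D - 1` zeros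
inside each of them; if `c = 0`, it also vanishes at the inner knots. On the other hand, it is a
quadratic polynomial between consecutive nodes and has no zeros outside of them, so a rule with `k`
different nodes allows for at most `2 * (k - 1)` zeros (`exists_peano_zeros`). The resulting bounds
`IsExact.le_two_mul_card_zero` and `IsExact.le_two_mul_card_one` are attained here, which also shows
that the nodes are different. The dimension `finrank_splineSpace` comes from the truncated power
basis.

For `c = 0`, the parameters can be computed: on the subintervals that carry the roots of
`Q_{ω,N}`, and in the middle at the knots to the pairs, they are nonnegative (`C0.param_nonneg`), so
that the functionals are positive and their orthogonal polynomials have simple roots inside of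
`(-1, 1)` (`hasRootsIn_of_orthogonal`); the roots of `Q_{N-1}` need an extra argument (`C0.sideOK`).
Positivity is stable under small changes of the parameters, so a neighbourhood of `ω = 0` is
admissible for two middle subintervals (`C0.exists_hasRootsIn_M`).

Finally, `ω` can be recovered from the rule: for `c = 0` it is determined by the sum of the weights
left of the middle knot (`C0.injOn_evenRule`), and for `c = 1` by the roots of `M_{ω,N+1}`, because
the leading coefficient of this polynomial does not depend on `ω` (`C1.eq_of_roots_Mω_eq`).
-/

namespace SplineQuad

noncomputable section

/-! ### Jacobi polynomials -/

/-- The integral of a polynomial over `[-1, 1]`. -/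
def integ : ℝ[X] →ₗ[ℝ] ℝ where
  toFun p := ∫ x in (-1 : ℝ)..1, p.eval x
  map_add' p q := by
    simp only [eval_add]
    exact intervalIntegral.integral_add (p.continuous.intervalIntegrable _ _)
      (q.continuous.intervalIntegrable _ _)
  map_smul' a p := by simp

lemma integ_apply (p : ℝ[X]) : integ p = ∫ x in (-1 : ℝ)..1, p.eval x := rfl

lemma integ_derivative (p : ℝ[X]) : integ (derivative p) = p.eval 1 - p.eval (-1) :=
  intervalIntegral.integral_eq_sub_of_hasDerivAt (fun x _ => p.hasDerivAt x)
    (p.derivative.continuous.intervalIntegrable _ _)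

/-- Integration by parts. -/
lemma integ_derivative_mul (p q : ℝ[X]) :
    integ (derivative p * q) =
      p.eval 1 * q.eval 1 - p.eval (-1) * q.eval (-1) - integ (p * derivative q) := by
  have h := integ_derivative (p * q)
  rw [derivative_mul, map_add, eval_mul, eval_mul] at h
  linarith

lemma integ_C_mul (a : ℝ) (p : ℝ[X]) : integ (C a * p) = a * integ p := by
  rw [← smul_eq_C_mul, map_smul, smul_eq_mul]

lemma integ_one : integ 1 = 2 := by simp [integ_apply]; norm_num

/-- A polynomial that is nonnegative on `[-1, 1]` and not zero has a positive integral. -/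
lemma integ_pos {p : ℝ[X]} (hp : p ≠ 0) (h : ∀ x ∈ Set.Icc (-1 : ℝ) 1, 0 ≤ p.eval x) :
    0 < integ p := by
  refine intervalIntegral.integral_pos (by norm_num) p.continuous.continuousOn
    (fun x hx => h x ⟨hx.1.le, hx.2⟩) ?_
  by_contra! hc
  exact hp (eq_zero_of_infinite_isRoot p ((Set.Icc_infinite (by norm_num : (-1 : ℝ) < 1)).mono
    fun x hx => le_antisymm (hc x hx) (h x hx)))

section Jacobi

lemma jacobi_natDegree_le (a b n : ℕ) : (jacobi a b n).natDegree ≤ n := by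
  refine natDegree_sum_le_of_forall_le _ _ fun s hs => ?_
  have hs' : s ≤ n := Nat.lt_succ_iff.1 (Finset.mem_range.1 hs)
  rw [mul_assoc]
  refine (natDegree_C_mul_le _ _).trans ?_
  compute_degree
  omega

lemma jacobi_coeff_pos (a b n : ℕ) : 0 < (jacobi a b n).coeff n := by
  rw [jacobi, finsetSum_coeff]
  refine Finset.sum_pos (fun s hs => ?_) ⟨0, by simp⟩
  have hs' : s ≤ n := Nat.lt_succ_iff.1 (Finset.mem_range.1 hs)
  have hm : ((X - 1 : ℝ[X]) ^ s * (X + 1) ^ (n - s)).Monic := by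
    have h1 : (X - 1 : ℝ[X]).Monic := monic_X_sub_C (1 : ℝ)
    have h2 : (X + 1 : ℝ[X]).Monic := monic_X_add_C (1 : ℝ)
    exact (h1.pow s).mul (h2.pow _)
  have hd : ((X - 1 : ℝ[X]) ^ s * (X + 1) ^ (n - s)).natDegree = n := by
    have h1 : (X - 1 : ℝ[X]).natDegree = 1 := natDegree_X_sub_C (1 : ℝ)
    have h2 : (X + 1 : ℝ[X]).natDegree = 1 := natDegree_X_add_C (1 : ℝ)
    have h3 : (X - 1 : ℝ[X]).Monic := monic_X_sub_C (1 : ℝ)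
    have h4 : (X + 1 : ℝ[X]).Monic := monic_X_add_C (1 : ℝ)
    rw [(h3.pow s).natDegree_mul (h4.pow _), h3.natDegree_pow, h4.natDegree_pow, h1, h2]
    omega
  have h1 : ((X - 1 : ℝ[X]) ^ s * (X + 1) ^ (n - s)).coeff n = 1 := by
    have := hm.coeff_natDegree
    rwa [hd] at this
  rw [mul_assoc, coeff_C_mul, h1, mul_one]
  have : 0 < (n + a).choose (n - s) := Nat.choose_pos (by omega)
  have : 0 < (n + b).choose s := Nat.choose_pos (by omega)
  positivity

lemma jacobi_natDegree (a b n : ℕ) : (jacobi a b n).natDegree = n :=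
  natDegree_eq_of_le_of_coeff_ne_zero (jacobi_natDegree_le a b n) (jacobi_coeff_pos a b n).ne'

/-- Rodrigues' formula, with `(x - 1) ^ a` in place of `(1 - x) ^ a` to avoid signs. -/
lemma jacobi_rodrigues (a n : ℕ) :
    derivative^[n] ((X - C 1) ^ (n + a) * (X - C (-1)) ^ n : ℝ[X]) =
      C (2 ^ n * n.factorial : ℝ) * ((X - 1) ^ a * jacobi a 0 n) := by
  rw [iterate_derivative_mul, jacobi, Finset.mul_sum, Finset.mul_sum]
  refine Finset.sum_congr rfl fun s hs => ?_
  have hs' : s ≤ n := Nat.lt_succ_iff.1 (Finset.mem_range.1 hs)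
  rw [iterate_derivative_X_sub_pow, iterate_derivative_X_sub_pow]
  have e1 : n + a - (n - s) = a + s := by omega
  rw [e1, pow_add]
  simp only [nsmul_eq_mul, ← C_eq_natCast, C_1, C_neg, sub_neg_eq_add]
  have h1 : (n.choose s : ℝ) * ((n + a).descFactorial (n - s) * n.descFactorial s) =
      2 ^ n * n.factorial * (((n + a).choose (n - s) * (n + 0).choose s : ℝ) / 2 ^ n) := by
    rw [Nat.descFactorial_eq_factorial_mul_choose, Nat.descFactorial_eq_factorial_mul_choose,
      ← Nat.choose_mul_factorial_mul_factorial hs']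
    push_cast
    field_simp
    simp
    ring
  have h2 := congrArg (C : ℝ → ℝ[X]) h1
  simp only [C_mul] at h2 ⊢
  linear_combination ((X - 1) ^ a * (X - 1) ^ s * (X + 1) ^ (n - s)) * h2

lemma eval_iterate_derivative_eq_zero {n k : ℕ} {c : ℝ} {p : ℝ[X]} (h : (X - C c) ^ n ∣ p)
    (hk : k < n) : (derivative^[k] p).eval c = 0 := by
  have h1 := pow_sub_dvd_iterate_derivative_of_pow_dvd k h
  exact dvd_iff_isRoot.1 ((dvd_pow_self _ (by omega)).trans h1)

/-- Repeated integration by parts without boundary terms. -/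
lemma integ_iterate_derivative_mul (n : ℕ) (g p : ℝ[X])
    (h1 : ∀ k < n, (derivative^[k] g).eval 1 = 0) (h2 : ∀ k < n, (derivative^[k] g).eval (-1) = 0) :
    integ (derivative^[n] g * p) = (-1) ^ n * integ (g * derivative^[n] p) := by
  induction n generalizing p with
  | zero => simp
  | succ n ih =>
    rw [Function.iterate_succ_apply', integ_derivative_mul, h1 n (by omega), h2 n (by omega),
      ih _ (fun k hk => h1 k (by omega)) (fun k hk => h2 k (by omega)), Function.iterate_succ_apply]
    ring

/-- `P_n^{(a, 0)}` is orthogonal to all polynomials of smaller degree for the weight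
`(1 - x) ^ a`. -/
lemma integ_jacobi_mul (a n : ℕ) {p : ℝ[X]} (hp : p.degree < n) :
    integ ((1 - X) ^ a * jacobi a 0 n * p) = 0 := by
  have h := integ_iterate_derivative_mul n ((X - C 1) ^ (n + a) * (X - C (-1)) ^ n) p
    (fun k hk => eval_iterate_derivative_eq_zero
      ((pow_dvd_pow _ (by omega)).trans (dvd_mul_right _ _)) hk)
    (fun k hk => eval_iterate_derivative_eq_zero (dvd_mul_left _ _) hk)
  rw [iterate_derivative_eq_zero_of_degree_lt hp, mul_zero, map_zero, mul_zero, jacobi_rodrigues,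
    mul_assoc, integ_C_mul] at h
  have h2 : integ ((X - 1) ^ a * jacobi a 0 n * p) = 0 :=
    (mul_eq_zero.1 h).resolve_left (by positivity)
  rw [← neg_sub X 1, neg_pow, mul_assoc, mul_assoc, ← C_1, ← C_neg, ← C_pow, integ_C_mul,
    ← mul_assoc]
  rw [C_1, h2, mul_zero]

lemma coeff_X_mul_derivative (p : ℝ[X]) (n : ℕ) : (X * derivative p).coeff n = n * p.coeff n := by
  cases n with
  | zero => simp
  | succ n => rw [coeff_X_mul, coeff_derivative]; push_cast; ring

/-- The differential operator whose eigenfunctions are the polynomials `P_n^{(a, 0)}`. -/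
def jacobiOp (a : ℕ) (p : ℝ[X]) : ℝ[X] :=
  (1 - X ^ 2) * derivative (derivative p) + (-C (a : ℝ) - C (a + 2 : ℝ) * X) * derivative p

lemma jacobiOp_coeff (a : ℕ) (p : ℝ[X]) (m : ℕ) (h1 : p.coeff (m + 1) = 0)
    (h2 : p.coeff (m + 2) = 0) : (jacobiOp a p).coeff m = -(m * (m + a + 1)) * p.coeff m := by
  have e : jacobiOp a p = derivative (derivative p) - C (a : ℝ) * derivative p
      - C (a + 1 : ℝ) * (X * derivative p) - X * derivative (X * derivative p) := by
    simp only [jacobiOp, derivative_mul, derivative_X, C_add, C_1, map_ofNat]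
    ring
  rw [e]
  simp only [coeff_sub, coeff_C_mul, coeff_X_mul_derivative, coeff_derivative, h1, h2]
  ring

lemma derivative_one_sub_X_pow_mul (a : ℕ) (p : ℝ[X]) :
    derivative ((1 - X) ^ (a + 1) * (1 + X) * derivative p) = (1 - X) ^ a * jacobiOp a p := by
  simp only [jacobiOp, derivative_mul, derivative_pow_succ, derivative_sub, derivative_add,
    derivative_one, derivative_X, C_add, C_1, map_ofNat]
  ring

/-- The operator is symmetric for the weight `(1 - x) ^ a`: it is a total
derivative, whose factor `(1 - x) ^ (a + 1) * (1 + x)` removes the boundary terms. -/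
lemma integ_jacobiOp_mul (a : ℕ) (p q : ℝ[X]) :
    integ ((1 - X) ^ a * jacobiOp a p * q) = integ ((1 - X) ^ a * p * jacobiOp a q) := by
  rw [← derivative_one_sub_X_pow_mul, integ_derivative_mul]
  have e : (1 - X) ^ (a + 1) * (1 + X) * derivative p * derivative q =
      derivative p * ((1 - X) ^ (a + 1) * (1 + X) * derivative q) := by ring
  rw [e, integ_derivative_mul, derivative_one_sub_X_pow_mul, mul_left_comm, mul_assoc]
  simp [mul_assoc]

/-- The differential equation of the Jacobi polynomials. The left side `T` and its image under the
operator have degree less than `n`, so `T` is orthogonal to itself by the orthogonality of the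
Jacobi polynomial and the symmetry of the operator. -/
lemma jacobi_ode (a n : ℕ) :
    jacobiOp a (jacobi a 0 n) + C (n * (n + a + 1) : ℝ) * jacobi a 0 n = 0 := by
  set P := jacobi a 0 n with hP
  set T := jacobiOp a P + C (n * (n + a + 1) : ℝ) * P with hT
  have hPc : ∀ m, n < m → P.coeff m = 0 := fun m hm =>
    coeff_eq_zero_of_natDegree_lt (by rwa [hP, jacobi_natDegree])
  have hTd : T.degree < n := by
    rw [degree_lt_iff_coeff_zero]
    intro m hm
    rw [hT, coeff_add, coeff_C_mul, jacobiOp_coeff a P m (hPc _ (by omega)) (hPc _ (by omega))]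
    rcases hm.eq_or_lt with rfl | hm
    · ring
    · rw [hPc m hm]; ring
  have hLd : (jacobiOp a T).degree < n := by
    rw [degree_lt_iff_coeff_zero] at hTd ⊢
    intro m hm
    rw [jacobiOp_coeff a T m (hTd _ (by omega)) (hTd _ (by omega)), hTd m hm, mul_zero]
  by_contra hT0
  have h0 : integ ((1 - X) ^ a * T * T) = 0 := by
    have e : (1 - X) ^ a * T * T = (1 - X) ^ a * jacobiOp a P * T +
        C (n * (n + a + 1) : ℝ) * ((1 - X) ^ a * P * T) := by
      rw [hT]; ring
    rw [e, map_add, integ_C_mul, integ_jacobiOp_mul, integ_jacobi_mul a n hLd,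
      integ_jacobi_mul a n hTd]
    ring
  have h1 : (1 - X : ℝ[X]) ≠ 0 := fun h => by simpa using congrArg (eval 0) h
  refine (integ_pos (mul_ne_zero (mul_ne_zero (pow_ne_zero _ h1) hT0) hT0) fun x hx => ?_).ne' h0
  have : 0 ≤ 1 - x := by linarith [hx.2]
  simp only [eval_mul, eval_pow, eval_sub, eval_one, eval_X]
  rw [mul_assoc]
  have := mul_self_nonneg (T.eval x)
  positivity

lemma jacobi_eval_neg_one (a n : ℕ) : (jacobi a 0 n).eval (-1) = (-1) ^ n := by
  rw [jacobi, eval_finsetSum, Finset.sum_eq_single n]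
  · simp only [eval_mul, eval_C, eval_pow, eval_sub, eval_X, eval_one, eval_add]
    have : (-1 - 1 : ℝ) ^ n = (-1) ^ n * 2 ^ n := by rw [← mul_pow]; norm_num
    simp [this]
    field_simp
  · intro s hs hsn
    have : n - s ≠ 0 := by have := Finset.mem_range.1 hs; omega
    simp [this]
  · simp

lemma jacobi_eval_one (a n : ℕ) : (jacobi a 0 n).eval 1 = (n + a).choose n := by
  rw [jacobi, eval_finsetSum, Finset.sum_eq_single 0]
  · simp only [eval_mul, eval_C, eval_pow, eval_sub, eval_X, eval_one, eval_add]
    norm_num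
  · intro s hs hsn
    simp [hsn]
  · simp

lemma jacobi_zero_eval_one (n : ℕ) : (jacobi 0 0 n).eval 1 = 1 := by
  simp [jacobi_eval_one]

lemma jacobi_one_eval_one (n : ℕ) : (jacobi 1 0 n).eval 1 = n + 1 := by
  simp [jacobi_eval_one]

lemma jacobi_two_eval_one (n : ℕ) : (jacobi 2 0 n).eval 1 = (n + 1) * (n + 2) / 2 := by
  rw [jacobi_eval_one, Nat.choose_symm_add, Nat.cast_choose_two]
  push_cast
  ring

/-- The values of the first derivatives of `P_n^{(a, 0)}` at the end points, from the differential
equation and its derivatives. -/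
lemma jacobi_derivative_eval (a n : ℕ) :
    let P := jacobi a 0 n
    let P' := derivative P
    let P'' := derivative P'
    let c : ℝ := n * (n + a + 1)
    (2 * P'.eval (-1) = -c * P.eval (-1) ∧ 4 * P''.eval (-1) = -(c - (a + 2)) * P'.eval (-1) ∧
      6 * (derivative P'').eval (-1) = -(c - 2 * (a + 3)) * P''.eval (-1)) ∧
    2 * (a + 1) * P'.eval 1 = c * P.eval 1 ∧ 2 * (a + 2) * P''.eval 1 = (c - (a + 2)) * P'.eval 1 ∧
      2 * (a + 3) * (derivative P'').eval 1 = (c - 2 * (a + 3)) * P''.eval 1 := by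
  intro P P' P'' c
  have h0 : (1 - X ^ 2) * P'' + (-C (a : ℝ) - C (a + 2 : ℝ) * X) * P' + C c * P = 0 :=
    jacobi_ode a n
  have h1 := congrArg derivative h0
  have h2 := congrArg derivative h1
  simp only [derivative_add, derivative_mul, derivative_sub, derivative_neg, derivative_C,
    derivative_X, derivative_one, derivative_X_pow, derivative_zero] at h1 h2
  change _ + (_ + _ * P'') + (_ + _ * P') = 0 at h1
  change _ + (_ + (_ + _ * derivative P'')) + (_ + (_ + _ * P'')) = 0 at h2
  have ev : ∀ x : ℝ, ∀ {p : ℝ[X]}, p = 0 → p.eval x = 0 := fun x p h => by rw [h, eval_zero]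
  have a0 := ev (-1) h0
  have a1 := ev (-1) h1
  have a2 := ev (-1) h2
  have b0 := ev 1 h0
  have b1 := ev 1 h1
  have b2 := ev 1 h2
  simp at a0 a1 a2 b0 b1 b2
  refine ⟨⟨?_, ?_, ?_⟩, ?_, ?_, ?_⟩
  · linear_combination a0
  · linear_combination a1
  · linear_combination a2
  · linear_combination -b0
  · linear_combination -b1
  · linear_combination -b2

end Jacobi

/-! ### Moments of Jacobi polynomials -/

/-- Division by a linear factor, with the bound for the degree of the quotient. -/
lemma exists_eq_C_add_mul (p : ℝ[X]) (c : ℝ) (n : ℕ) (h : p.degree < (n + 1 : ℕ)) :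
    ∃ s : ℝ[X], s.degree < n ∧ p = C (p.eval c) + (X - C c) * s := by
  refine ⟨p /ₘ (X - C c), ?_, ?_⟩
  · rcases eq_or_ne (p /ₘ (X - C c)) 0 with h0 | h0
    · rw [h0, degree_zero]; exact WithBot.bot_lt_coe n
    · rw [degree_eq_natDegree h0, natDegree_divByMonic _ (monic_X_sub_C c), natDegree_X_sub_C]
      have hp : ¬ p.degree < (X - C c).degree := fun h =>
        h0 ((divByMonic_eq_zero_iff (monic_X_sub_C c)).2 h)
      rw [degree_X_sub_C, not_lt] at hp
      have h1 : 1 ≤ p.natDegree := le_natDegree_of_coe_le_degree (by exact_mod_cast hp)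
      have hp0 : p ≠ 0 := fun h => by simp [h] at h1
      rw [degree_eq_natDegree hp0] at h
      have h2 : p.natDegree < n + 1 := by exact_mod_cast h
      exact_mod_cast (by omega : p.natDegree - 1 < n)
  · rw [X_sub_C_mul_divByMonic_eq_sub_modByMonic, modByMonic_X_sub_C_eq_C_eval]
    ring

lemma degree_lt_of_natDegree_le {p : ℝ[X]} {n m : ℕ} (h : p.natDegree ≤ n) (hm : n < m) :
    p.degree < m :=
  (degree_le_of_natDegree_le h).trans_lt (by exact_mod_cast hm)

lemma natDegree_le_of_degree_lt {p : ℝ[X]} {n : ℕ} (h : p.degree < (n + 1 : ℕ)) :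
    p.natDegree ≤ n := by
  rcases eq_or_ne p 0 with rfl | h0
  · simp
  · rw [degree_eq_natDegree h0] at h
    have : p.natDegree < n + 1 := by exact_mod_cast h
    omega

/-- The moment of `P_n^{(a, 0)}` of order `n` for the weight `(1 - x) ^ a`; up to the leading
coefficient, the squared norm. -/
def jacobiMoment (a n : ℕ) : ℝ := integ ((1 - X) ^ a * jacobi a 0 n * X ^ n)

lemma integ_jacobi_mul_of_le (a n : ℕ) {p : ℝ[X]} (hp : p.natDegree ≤ n) :
    integ ((1 - X) ^ a * jacobi a 0 n * p) = p.coeff n * jacobiMoment a n := by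
  have h1 : (p - C (p.coeff n) * X ^ n).degree < (n : WithBot ℕ) := by
    rw [degree_lt_iff_coeff_zero]
    intro m hm
    rw [coeff_sub, coeff_C_mul, coeff_X_pow]
    split_ifs with h
    · simp [h]
    · rw [coeff_eq_zero_of_natDegree_lt (by omega)]; simp
  have h2 := integ_jacobi_mul a n h1
  rw [mul_sub, map_sub, sub_eq_zero] at h2
  rw [h2, mul_left_comm, integ_C_mul, jacobiMoment]

/-- A weight with one factor `1 - x` less only sees the value at `1`. -/
lemma integ_jacobi_succ_mul (a n : ℕ) {p : ℝ[X]} (hp : p.natDegree ≤ n) :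
    integ ((1 - X) ^ a * jacobi (a + 1) 0 n * p) =
      p.eval 1 * integ ((1 - X) ^ a * jacobi (a + 1) 0 n) := by
  obtain ⟨s, hs, h⟩ := exists_eq_C_add_mul p 1 n (degree_lt_of_natDegree_le hp (by omega))
  have e : (1 - X) ^ a * jacobi (a + 1) 0 n * p =
      C (p.eval 1) * ((1 - X) ^ a * jacobi (a + 1) 0 n) -
        (1 - X) ^ (a + 1) * jacobi (a + 1) 0 n * s := by
    rw [C_1] at h
    nth_rw 1 [h]
    ring
  rw [e, map_sub, integ_jacobi_mul _ _ hs, integ_C_mul, sub_zero]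

/-- The integral of `(1 - x) ^ a * P_n * P_{n+1}'`, once from the leading coefficient of the last
factor and once by integration by parts. -/
lemma jacobi_leading_mul_moment_aux (a n : ℕ) :
    (n + 1) * ((jacobi a 0 (n + 1)).coeff (n + 1) * jacobiMoment a n) =
      0 ^ a * (jacobi a 0 (n + 1)).eval 1 * (jacobi a 0 n).eval 1 + 2 ^ a -
        integ (jacobi a 0 (n + 1) * derivative ((1 - X) ^ a * jacobi a 0 n)) := by
  have h := integ_jacobi_mul_of_le a n (p := derivative (jacobi a 0 (n + 1)))
    ((natDegree_derivative_le _).trans (by rw [jacobi_natDegree]; simp))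
  rw [mul_comm, integ_derivative_mul, coeff_derivative] at h
  simp only [eval_mul, eval_pow, eval_sub, eval_one, eval_X, jacobi_eval_neg_one, sub_self] at h
  have e : ((-1 : ℝ) ^ n) ^ 2 = 1 := by rw [← pow_mul, mul_comm, pow_mul]; simp
  norm_num [-derivative_mul] at h
  rw [pow_succ] at h
  linear_combination -h + 2 ^ a * e

lemma jacobi_zero_leading_mul_moment (n : ℕ) :
    (n + 1) * ((jacobi 0 0 (n + 1)).coeff (n + 1) * jacobiMoment 0 n) = 2 := by
  have h1 := integ_jacobi_mul 0 (n + 1) (p := derivative (jacobi 0 0 n))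
    (degree_lt_of_natDegree_le ((natDegree_derivative_le _).trans
      (by rw [jacobi_natDegree]; exact Nat.sub_le _ _)) (Nat.lt_succ_self n))
  rw [jacobi_leading_mul_moment_aux, jacobi_zero_eval_one, jacobi_zero_eval_one]
  simp only [pow_zero, one_mul] at h1 ⊢
  rw [h1]
  norm_num

lemma jacobiOp_eq (a : ℕ) (p : ℝ[X]) : jacobiOp a p =
    derivative ((1 - X ^ 2) * derivative p) - C (a : ℝ) * ((1 + X) * derivative p) := by
  simp only [jacobiOp, derivative_mul, derivative_sub, derivative_one, derivative_X_pow, C_add,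
    map_ofNat]
  norm_num [C_ofNat]
  ring

/-- The integral of the differential equation. -/
lemma integ_jacobi (a n : ℕ) :
    (n * (n + a + 1) + a) * integ (jacobi a 0 n) = 2 * a * (jacobi a 0 n).eval 1 := by
  have h := congrArg integ (jacobi_ode a n)
  rw [map_add, integ_C_mul, jacobiOp_eq, map_sub, integ_C_mul, integ_derivative, mul_comm (1 + X),
    integ_derivative_mul] at h
  simp at h
  linear_combination h

lemma integ_jacobi_one (n : ℕ) : integ (jacobi 1 0 n) = 2 / (n + 1) := by
  have h := integ_jacobi 1 n
  rw [jacobi_one_eval_one] at h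
  rw [eq_div_iff (by positivity)]
  have h1 : (n + 1 : ℝ) ≠ 0 := by positivity
  apply mul_left_cancel₀ h1
  push_cast at h
  linear_combination h

lemma integ_jacobi_two (n : ℕ) : integ (jacobi 2 0 n) = 2 := by
  have h := integ_jacobi 2 n
  rw [jacobi_two_eval_one] at h
  have h1 : ((n + 1) * (n + 2) : ℝ) ≠ 0 := by positivity
  apply mul_left_cancel₀ h1
  push_cast at h
  linear_combination h

lemma integ_one_sub_X_mul_jacobi_two (n : ℕ) :
    integ ((1 - X) * jacobi 2 0 n) = 4 / ((n + 1) * (n + 2)) := by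
  have h := congrArg (fun p => integ (p * (1 - X))) (jacobi_ode 2 n)
  have e : integ ((1 - X ^ 2) * derivative (jacobi 2 0 n)) =
      2 * (integ (jacobi 2 0 n) - integ ((1 - X) * jacobi 2 0 n)) := by
    have e1 : jacobi 2 0 n * derivative (1 - X ^ 2 : ℝ[X]) =
        C (-2) * (jacobi 2 0 n - (1 - X) * jacobi 2 0 n) := by
      simp only [derivative_sub, derivative_one, derivative_X_pow, C_neg, C_ofNat]
      norm_num [C_ofNat]
      ring
    rw [mul_comm, integ_derivative_mul, e1, integ_C_mul, map_sub]
    simp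
  have e2 : C ((2 : ℕ) : ℝ) * ((1 + X) * derivative (jacobi 2 0 n)) * (1 - X) =
      C 2 * ((1 - X ^ 2) * derivative (jacobi 2 0 n)) := by push_cast; ring
  have e3 : (1 - X ^ 2) * derivative (jacobi 2 0 n) * derivative (1 - X : ℝ[X]) =
      C (-1) * ((1 - X ^ 2) * derivative (jacobi 2 0 n)) := by
    simp
  simp only [jacobiOp_eq, add_mul _ _ (1 - X : ℝ[X]), sub_mul _ _ (1 - X : ℝ[X]), map_add,
    map_sub] at h
  rw [e2, integ_C_mul, integ_derivative_mul, e3, integ_C_mul, e, integ_jacobi_two, mul_assoc (C _),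
    integ_C_mul, mul_comm (jacobi 2 0 n)] at h
  simp at h
  rw [eq_div_iff (by positivity)]
  linear_combination h

lemma jacobi_one_leading_mul_moment (n : ℕ) :
    (n + 1) * ((jacobi 1 0 (n + 1)).coeff (n + 1) * jacobiMoment 1 n) =
      2 * (2 * n + 3) / (n + 2) := by
  have h1 := integ_jacobi_mul 1 (n + 1) (p := derivative (jacobi 1 0 n))
    (degree_lt_of_natDegree_le ((natDegree_derivative_le _).trans
      (by rw [jacobi_natDegree]; exact Nat.sub_le _ _)) (Nat.lt_succ_self n))
  have h2 := integ_jacobi_succ_mul 0 (n + 1) (p := jacobi 1 0 n)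
    (by rw [jacobi_natDegree]; omega)
  have e : jacobi 1 0 (n + 1) * derivative ((1 - X) ^ 1 * jacobi 1 0 n) =
      (1 - X) ^ 1 * jacobi 1 0 (n + 1) * derivative (jacobi 1 0 n) -
        (1 - X) ^ 0 * jacobi (0 + 1) 0 (n + 1) * jacobi 1 0 n := by
    simp [derivative_mul]
    ring
  rw [jacobi_leading_mul_moment_aux, e, map_sub, h1, h2, jacobi_one_eval_one,
    jacobi_one_eval_one, pow_zero, one_mul,
    integ_jacobi_one]
  push_cast
  field_simp
  ring

lemma jacobi_two_leading_mul_moment (n : ℕ) :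
    (n + 1) * ((jacobi 2 0 (n + 1)).coeff (n + 1) * jacobiMoment 2 n) =
      8 * (n + 2) / (n + 3) := by
  have h1 := integ_jacobi_mul 2 (n + 1) (p := derivative (jacobi 2 0 n))
    (degree_lt_of_natDegree_le ((natDegree_derivative_le _).trans
      (by rw [jacobi_natDegree]; exact Nat.sub_le _ _)) (Nat.lt_succ_self n))
  have h2 := integ_jacobi_succ_mul 1 (n + 1) (p := jacobi 2 0 n)
    (by rw [jacobi_natDegree]; omega)
  have e : jacobi 2 0 (n + 1) * derivative ((1 - X) ^ 2 * jacobi 2 0 n) =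
      (1 - X) ^ 2 * jacobi 2 0 (n + 1) * derivative (jacobi 2 0 n) -
        C 2 * ((1 - X) ^ 1 * jacobi (1 + 1) 0 (n + 1) * jacobi 2 0 n) := by
    simp [derivative_mul, derivative_pow]
    ring
  rw [jacobi_leading_mul_moment_aux, e, map_sub, h1, integ_C_mul, h2, jacobi_two_eval_one,
    jacobi_two_eval_one, pow_one,
    integ_one_sub_X_mul_jacobi_two]
  push_cast
  field_simp
  ring

/-! ### The integral with corrections at the end points -/

/-- The integral over `[-1, 1]` corrected by values and first derivatives at the end points. The
signs are such that the reflection `x ↦ -x` exchanges the two ends. The factors `2` and `24` fit the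
scaling of the parameters in the formulas for `Q_n` and `M_n`. -/
def knotInteg (αL βL αR βR : ℝ) : ℝ[X] →ₗ[ℝ] ℝ :=
  integ + (2 * αL) • leval (-1) - (24 * βL) • (leval (-1) ∘ₗ derivative) +
    (2 * αR) • leval 1 + (24 * βR) • (leval 1 ∘ₗ derivative)

lemma knotInteg_apply (αL βL αR βR : ℝ) (p : ℝ[X]) :
    knotInteg αL βL αR βR p = integ p + 2 * αL * p.eval (-1) - 24 * βL * (derivative p).eval (-1) +
      2 * αR * p.eval 1 + 24 * βR * (derivative p).eval 1 := by
  simp [knotInteg, leval_apply]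

lemma knotInteg_C_mul (αL βL αR βR a : ℝ) (p : ℝ[X]) :
    knotInteg αL βL αR βR (C a * p) = a * knotInteg αL βL αR βR p := by
  rw [← smul_eq_C_mul, map_smul, smul_eq_mul]

namespace C1

lemma jacobi_two_derivative_eval (n : ℕ) :
    let P' := derivative (jacobi 2 0 n)
    let P'' := derivative P'
    (P'.eval (-1) = -(n * (n + 3)) / 2 * (-1) ^ n ∧
      P''.eval (-1) = n * (n + 3) * (n * (n + 3) - 4) / 8 * (-1) ^ n ∧
      (derivative P'').eval (-1) =
        -(n * (n + 3) * (n * (n + 3) - 4) * (n * (n + 3) - 10)) / 48 * (-1) ^ n) ∧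
    P'.eval 1 = n * (n + 3) * (n + 1) * (n + 2) / 12 ∧
      P''.eval 1 = n * (n + 3) * (n * (n + 3) - 4) * (n + 1) * (n + 2) / 96 := by
  obtain ⟨⟨h1, h2, h3⟩, h4, h5, -⟩ := jacobi_derivative_eval 2 n
  rw [jacobi_eval_neg_one] at h1
  rw [jacobi_two_eval_one] at h4
  push_cast at h1 h2 h3 h4 h5
  have g1 : (derivative (jacobi 2 0 n)).eval (-1) = -(n * (n + 3)) / 2 * (-1) ^ n := by
    linear_combination h1 / 2
  have g2 : (derivative (derivative (jacobi 2 0 n))).eval (-1) =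
      n * (n + 3) * (n * (n + 3) - 4) / 8 * (-1) ^ n := by
    rw [g1] at h2
    linear_combination h2 / 4
  have g3 : (derivative (jacobi 2 0 n)).eval 1 = n * (n + 3) * (n + 1) * (n + 2) / 12 := by
    linear_combination h4 / 6
  refine ⟨⟨g1, g2, ?_⟩, g3, ?_⟩
  · rw [g2] at h3
    linear_combination h3 / 6
  · rw [g3] at h5
    linear_combination h5 / 8

lemma jacobi_coeff_eq_zero (a n : ℕ) {m : ℕ} (hm : n < m) : (jacobi a 0 n).coeff m = 0 :=
  coeff_eq_zero_of_natDegree_lt (by rwa [jacobi_natDegree])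

lemma Q_coeff (n m : ℕ) (α β : ℝ) (hm : n ≤ m) :
    (Q n α β).coeff m = F n α β * (jacobi 2 0 n).coeff m := by
  have e : Q n α β = C (F n α β + n * F₁ n α β) * jacobi 2 0 n +
      C (F₁ n α β) * derivative (jacobi 2 0 n) - C (F₁ n α β) * (X * derivative (jacobi 2 0 n)) -
      C (36 * F₂ n β) * derivative (jacobi 2 0 n) +
      C (12 * F₂ n β) * derivative (derivative (jacobi 2 0 n)) -
      C (12 * F₂ n β) * (X * derivative (derivative (jacobi 2 0 n))) := by
    rw [Q]; ring
  rw [e]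
  simp only [coeff_add, coeff_sub, coeff_C_mul, coeff_X_mul_derivative, coeff_derivative,
    jacobi_coeff_eq_zero 2 n (show n < m + 1 by omega),
    jacobi_coeff_eq_zero 2 n (show n < m + 1 + 1 by omega)]
  rcases hm.eq_or_lt with rfl | hm
  · ring
  · rw [jacobi_coeff_eq_zero 2 n hm]; ring

lemma natDegree_Q_le (n : ℕ) (α β : ℝ) : (Q n α β).natDegree ≤ n := by
  rw [natDegree_le_iff_coeff_eq_zero]
  intro m hm
  rw [Q_coeff n m α β hm.le, jacobi_coeff_eq_zero 2 n hm, mul_zero]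

lemma Q_eval_neg_one (n : ℕ) (α β : ℝ) :
    (Q n α β).eval (-1) = (-1) ^ n * (1 - 3 * n * (n + 1) * (n + 2) * (n + 3) * β) := by
  obtain ⟨⟨h1, h2, h3⟩, h4, h5⟩ := jacobi_two_derivative_eval n
  simp only [Q, eval_add, eval_sub, eval_mul, eval_C, eval_one, eval_X, h1, h2,
    jacobi_eval_neg_one, F, F₁, F₂]
  ring

/-- `Q_n` is orthogonal to all polynomials of smaller degree for the functional
`p ↦ knotInteg α β αR βR ((1 - x) ^ 2 * p)`, which does not depend on `αR` and `βR`. Its norm is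
proportional to `F (n + 1)`. -/
lemma knotInteg_Q_mul (n : ℕ) (α β αR βR : ℝ) {p : ℝ[X]} (hp : p.natDegree ≤ n) :
    knotInteg α β αR βR ((1 - X) ^ 2 * Q n α β * p) =
      p.coeff n * jacobiMoment 2 n * F (n + 1) α β := by
  obtain ⟨⟨h1, h2, h3⟩, h4, h5⟩ := jacobi_two_derivative_eval n
  have hc : ∀ m, n < m → p.coeff m = 0 := fun m hm => coeff_eq_zero_of_natDegree_lt (by omega)
  have T0 := integ_jacobi_mul_of_le 2 n hp
  -- integration by parts moves the derivative to `q`; the coefficient of `x ^ n` in the result is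
  -- `n + 3` times that of `q`
  have T1 : ∀ q : ℝ[X], q.natDegree ≤ n →
      integ (derivative (jacobi 2 0 n) * ((1 - X) ^ 3 * q)) =
        -8 * (-1) ^ n * q.eval (-1) + (n + 3) * (q.coeff n * jacobiMoment 2 n) := by
    intro q hq
    have hqc : q.coeff (n + 1) = 0 := coeff_eq_zero_of_natDegree_lt (by omega)
    have e : jacobi 2 0 n * derivative ((1 - X) ^ 3 * q) =
        (1 - X) ^ 2 * jacobi 2 0 n * (C (-3) * q + derivative q - X * derivative q) := by
      simp [derivative_mul, derivative_pow, C_ofNat]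
      ring
    have hd : (C (-3) * q + derivative q - X * derivative q).natDegree ≤ n := by
      rw [natDegree_le_iff_coeff_eq_zero]
      intro m hm
      simp only [coeff_add, coeff_sub, coeff_C_mul, coeff_X_mul_derivative, coeff_derivative]
      rw [coeff_eq_zero_of_natDegree_lt (show q.natDegree < m by omega),
        coeff_eq_zero_of_natDegree_lt (show q.natDegree < m + 1 by omega)]
      ring
    rw [integ_derivative_mul, e, integ_jacobi_mul_of_le 2 n hd]
    simp only [coeff_add, coeff_sub, coeff_C_mul, coeff_X_mul_derivative, coeff_derivative, hqc,
      eval_mul, eval_pow, eval_sub, eval_one, eval_X, jacobi_eval_neg_one]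
    ring
  have T2 : integ (derivative ((1 - X) ^ 3 * derivative (jacobi 2 0 n)) * p) =
      -8 * (derivative (jacobi 2 0 n)).eval (-1) * p.eval (-1) +
        8 * (-1) ^ n * (derivative p).eval (-1) := by
    have e : (1 - X) ^ 3 * derivative (jacobi 2 0 n) * derivative p =
        derivative (jacobi 2 0 n) * ((1 - X) ^ 3 * derivative p) := by ring
    rw [integ_derivative_mul, e, T1 _ ((natDegree_derivative_le p).trans (by omega)),
      coeff_derivative, hc (n + 1) (by omega)]
    simp only [eval_mul, eval_pow, eval_sub, eval_one, eval_X]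
    ring
  -- the terms with `F₂` in `Q_n` form a total derivative
  have e : (1 - X) ^ 2 * Q n α β * p =
      C (F n α β + n * F₁ n α β) * ((1 - X) ^ 2 * jacobi 2 0 n * p) +
      C (F₁ n α β) * (derivative (jacobi 2 0 n) * ((1 - X) ^ 3 * p)) +
      C (12 * F₂ n β) * (derivative ((1 - X) ^ 3 * derivative (jacobi 2 0 n)) * p) := by
    have e36 : C (36 * F₂ n β) = 3 * C (12 * F₂ n β) := by
      rw [← C_ofNat, ← C_mul]; congr 1; ring
    rw [Q, e36]
    simp [derivative_mul, derivative_pow, C_ofNat]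
    ring
  have ei : integ ((1 - X) ^ 2 * Q n α β * p) = _ := congrArg integ e
  rw [map_add, map_add, integ_C_mul, integ_C_mul, integ_C_mul, T0, T1 p hp, T2] at ei
  rw [knotInteg_apply, ei]
  simp only [derivative_mul, derivative_pow, derivative_sub, derivative_one, derivative_X,
    eval_add, eval_sub, eval_mul, eval_pow, eval_one, eval_X, Q_eval_neg_one, h1]
  simp only [Q, derivative_mul, derivative_add, derivative_sub, derivative_C, derivative_one,
    derivative_X, eval_add, eval_sub, eval_mul, eval_C, eval_one, eval_X, h1, h2, h3, eval_zero,
    jacobi_eval_neg_one, F, F₁, F₂]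
  norm_num
  ring

end C1

/-! ### The step maps in class 1 -/

namespace C1

lemma Q_eval_one (n : ℕ) (α β : ℝ) : (Q n α β).eval 1 = Γ n α β := by
  obtain ⟨⟨h1, h2, h3⟩, h4, h5⟩ := jacobi_two_derivative_eval n
  simp only [Q, eval_add, eval_sub, eval_mul, eval_C, eval_one, eval_X, h4, h5,
    jacobi_two_eval_one, F, F₁, F₂, Γ]
  ring

lemma Q_derivative_eval_one (n : ℕ) (α β : ℝ) : (derivative (Q n α β)).eval 1 =
    n * (n + 1) * (n + 2) * (n + 3) / 12 * (F n α β + (n - 1) * F₁ n α β -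
      6 * (n - 1) * (n + 4) * F₂ n β) := by
  obtain ⟨⟨h1, h2, h3⟩, h4, h5⟩ := jacobi_two_derivative_eval n
  simp only [Q, derivative_mul, derivative_add, derivative_sub, derivative_C, derivative_one,
    derivative_X, eval_add, eval_sub, eval_mul, eval_C, eval_one, eval_X, eval_zero, h4, h5]
  ring

lemma Q_derivative_eval_neg_one (n : ℕ) (α β : ℝ) : (derivative (Q n α β)).eval (-1) =
    (-1) ^ n * (-F₁ n α β - n * (n + 3) / 2 * (F n α β + (n - 1) * F₁ n α β) +
      n * (n + 3) * (n * (n + 3) - 4) / 8 * (2 * F₁ n α β - 48 * F₂ n β) -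
      n * (n + 3) * (n * (n + 3) - 4) * (n * (n + 3) - 10) / 2 * F₂ n β + F₁ n α β) := by
  obtain ⟨⟨h1, h2, h3⟩, h4, h5⟩ := jacobi_two_derivative_eval n
  simp only [Q, derivative_mul, derivative_add, derivative_sub, derivative_C, derivative_one,
    derivative_X, eval_add, eval_sub, eval_mul, eval_C, eval_one, eval_X, eval_zero, h1, h2, h3,
    jacobi_eval_neg_one]
  ring

lemma integ_Q (n : ℕ) (α β : ℝ) : integ (Q n α β) =
    2 * (F n α β + n * F₁ n α β) + F₁ n α β * (2 - 2 * (-1) ^ n) +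
      12 * F₂ n β * ((-1) ^ n * (n * (n + 3) + 2) - (n + 1) * (n + 2)) := by
  obtain ⟨⟨h1, h2, h3⟩, h4, h5⟩ := jacobi_two_derivative_eval n
  have i1 := integ_derivative_mul (jacobi 2 0 n) (1 - X)
  have i2 := integ_derivative_mul (derivative (jacobi 2 0 n)) (1 - X)
  have e1 : ∀ p : ℝ[X], p * derivative (1 - X : ℝ[X]) = C (-1) * p := fun p => by simp
  rw [e1, integ_C_mul] at i1 i2
  rw [integ_derivative] at i2
  simp only [eval_sub, eval_one, eval_X, h1, integ_jacobi_two, jacobi_two_eval_one,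
    jacobi_eval_neg_one] at i1 i2
  have e : Q n α β = C (F n α β + n * F₁ n α β) * jacobi 2 0 n +
      C (F₁ n α β) * (derivative (jacobi 2 0 n) * (1 - X)) -
      C (36 * F₂ n β) * derivative (jacobi 2 0 n) +
      C (12 * F₂ n β) * (derivative (derivative (jacobi 2 0 n)) * (1 - X)) := by
    rw [Q]; ring
  rw [e, map_add, map_sub, map_add, integ_C_mul, integ_C_mul, integ_C_mul, integ_C_mul,
    integ_derivative, i1, i2, integ_jacobi_two, jacobi_two_eval_one, jacobi_eval_neg_one]
  ring

lemma integ_one_sub_X_mul_Q (n : ℕ) (α β : ℝ) : integ ((1 - X) * Q n α β) =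
    (F n α β + n * F₁ n α β) * (4 / ((n + 1) * (n + 2))) +
      F₁ n α β * (2 * (4 / ((n + 1) * (n + 2))) - 4 * (-1) ^ n) +
      12 * F₂ n β * ((-1) ^ n * (2 * n * (n + 3) + 2) - 2) := by
  obtain ⟨⟨h1, h2, h3⟩, h4, h5⟩ := jacobi_two_derivative_eval n
  have i1 := integ_derivative_mul (jacobi 2 0 n) ((1 - X) ^ 2)
  have i2 := integ_derivative_mul (derivative (jacobi 2 0 n)) ((1 - X) ^ 2)
  have i3 := integ_derivative_mul (jacobi 2 0 n) (1 - X)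
  have e1 : ∀ p : ℝ[X], p * derivative ((1 - X) ^ 2 : ℝ[X]) = C (-2) * ((1 - X) * p) := fun p => by
    simp [derivative_pow, C_ofNat]; ring
  have e2 : (jacobi 2 0 n) * derivative (1 - X : ℝ[X]) = C (-1) * jacobi 2 0 n := by simp
  rw [e1, integ_C_mul] at i1 i2
  rw [e2, integ_C_mul] at i3
  simp only [mul_comm (1 - X : ℝ[X]) (derivative (jacobi 2 0 n))] at i2
  rw [i3] at i2
  simp only [eval_sub, eval_one, eval_X, eval_pow, h1, integ_jacobi_two, jacobi_two_eval_one,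
    jacobi_eval_neg_one, integ_one_sub_X_mul_jacobi_two] at i1 i2 i3
  have e : (1 - X) * Q n α β = C (F n α β + n * F₁ n α β) * ((1 - X) * jacobi 2 0 n) +
      C (F₁ n α β) * (derivative (jacobi 2 0 n) * (1 - X) ^ 2) -
      C (36 * F₂ n β) * (derivative (jacobi 2 0 n) * (1 - X)) +
      C (12 * F₂ n β) * (derivative (derivative (jacobi 2 0 n)) * (1 - X) ^ 2) := by
    rw [Q]; ring
  rw [e, map_add, map_sub, map_add, integ_C_mul, integ_C_mul, integ_C_mul, integ_C_mul, i1, i2, i3,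
    integ_one_sub_X_mul_jacobi_two]
  ring

/-- The contribution of the right end is kept apart, since the step map is to balance it. The
remaining part does not contain `(-1) ^ n`: the corrections cancel these terms of the integral. -/
lemma knotInteg_Q (n : ℕ) (α β αR βR : ℝ) : knotInteg α β αR βR (Q n α β) =
    2 * (F n α β + (n + 1) * F₁ n α β) - 12 * (n + 1) * (n + 2) * F₂ n β +
      2 * αR * (Q n α β).eval 1 + 24 * βR * (derivative (Q n α β)).eval 1 := by
  rw [knotInteg_apply, integ_Q, Q_eval_neg_one, Q_derivative_eval_neg_one]
  simp only [F, F₁, F₂]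
  ring

lemma knotInteg_one_sub_X_mul_Q (n : ℕ) (α β αR βR : ℝ) :
    knotInteg α β αR βR ((1 - X) * Q n α β) =
      4 / ((n + 1) * (n + 2)) * (F n α β + (n + 2) * F₁ n α β) - 24 * F₂ n β -
        24 * βR * (Q n α β).eval 1 := by
  rw [knotInteg_apply, integ_one_sub_X_mul_Q]
  simp only [derivative_mul, derivative_sub, derivative_one, derivative_X, eval_add, eval_sub,
    eval_mul, eval_one, eval_X, eval_zero]
  rw [Q_eval_neg_one, Q_derivative_eval_neg_one]
  simp only [F, F₁, F₂]
  field_simp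
  ring

/-- The step map yields the correction at the right end for which `Q_n` is orthogonal to `1` and
`1 - x`. The minus sign appears because the parameters are those of the next subinterval. -/
lemma knotInteg_Q_step (n : ℕ) (α β : ℝ) (h : (Q n α β).eval 1 ≠ 0) :
    knotInteg α β (-stepα n α β) (stepβ n α β) (Q n α β) = 0 ∧
      knotInteg α β (-stepα n α β) (stepβ n α β) ((1 - X) * Q n α β) = 0 := by
  rw [knotInteg_Q, knotInteg_one_sub_X_mul_Q, Q_derivative_eval_one]
  rw [Q_eval_one] at h ⊢
  have hα : 12 * Γ n α β ^ 2 * (stepα n α β + α) = E n α β * (8 * n ^ 2 + 24 * n + 12 +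
    n * (n + 3) * ((11 * n ^ 2 + 33 * n + 16) * α +
    12 * (4 * n ^ 4 + 24 * n ^ 3 + 34 * n ^ 2 - 6 * n - 8) * β +
    3 * n * (n + 1) * (n + 2) * (n + 3) * (
      -4 * (n + 1) * (n + 2) * (2 * n ^ 2 + 6 * n - 5) * β ^ 2 -
      3 * (n - 1) * n * (n + 1) * (n + 2) * (n + 3) * (n + 4) * α * β ^ 2 +
      2 * (3 * n ^ 2 + 9 * n - 6) * α * β + α ^ 2))) := by
    rw [stepα]; field_simp; ring
  have hβ : 6 * (n + 1) * (n + 2) * Γ n α β * (stepβ n α β - β) = E n α β * G n β := by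
    rw [stepβ]; field_simp; ring
  have hn : ((n : ℝ) + 1) * (n + 2) ≠ 0 := by positivity
  -- orthogonality to `1 - x` involves only the correction by the derivative
  have hβ' : 24 * (Γ n α β * stepβ n α β) =
      4 / ((n + 1) * (n + 2)) * (F n α β + (n + 2) * F₁ n α β) - 24 * F₂ n β := by
    apply mul_left_cancel₀ hn
    field_simp
    have : ((n : ℝ) + 1) * (n + 2) * (24 * (Γ n α β * β)) * 1 + 4 * (E n α β * G n β) =
      4 * (F n α β + (n + 2) * F₁ n α β) - (n + 1) * (n + 2) * (24 * F₂ n β) := by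
      simp only [Γ, E, G, F, F₁, F₂]; ring
    linear_combination 4 * hβ + this
  refine ⟨?_, by linear_combination -hβ'⟩
  apply mul_left_cancel₀ (mul_ne_zero h (by norm_num : (6 : ℝ) ≠ 0))
  -- what orthogonality to `1` amounts to after multiplication by the denominators
  have key : 6 * Γ n α β * (2 * (F n α β + (n + 1) * F₁ n α β) - 12 * (n + 1) * (n + 2) * F₂ n β) +
      12 * Γ n α β ^ 2 * α - E n α β * (8 * n ^ 2 + 24 * n + 12 +
    n * (n + 3) * ((11 * n ^ 2 + 33 * n + 16) * α +
    12 * (4 * n ^ 4 + 24 * n ^ 3 + 34 * n ^ 2 - 6 * n - 8) * β +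
    3 * n * (n + 1) * (n + 2) * (n + 3) * (
      -4 * (n + 1) * (n + 2) * (2 * n ^ 2 + 6 * n - 5) * β ^ 2 -
      3 * (n - 1) * n * (n + 1) * (n + 2) * (n + 3) * (n + 4) * α * β ^ 2 +
      2 * (3 * n ^ 2 + 9 * n - 6) * α * β + α ^ 2))) +
      2 * n * (n + 3) * (F n α β + (n - 1) * F₁ n α β - 6 * (n - 1) * (n + 4) * F₂ n β) *
        (E n α β * G n β + 6 * (n + 1) * (n + 2) * Γ n α β * β) = 0 := by
    simp only [Γ, E, G, F, F₁, F₂]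
    ring
  linear_combination key - hα + 2 * n * (n + 3) *
    (F n α β + (n - 1) * F₁ n α β - 6 * (n - 1) * (n + 4) * F₂ n β) * hβ

lemma Qω_eval_one (n : ℕ) (α β ω : ℝ) :
    (Qω (n + 1) α β ω).eval 1 = -(n + 2) / 2 * Γω (n + 1) ω α β := by
  rw [Qω, eval_add, eval_mul, eval_C, Nat.add_sub_cancel, Q_eval_one, Q_eval_one]
  push_cast
  simp only [Γ, Γω]
  ring

set_option maxHeartbeats 4000000 in
/-- The extended step map plays for `Q_{ω,n}` the role of the step map for `Q_n`. -/
lemma knotInteg_Qω_step (n : ℕ) (α β ω : ℝ) (h : (Qω (n + 1) α β ω).eval 1 ≠ 0) :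
    let a := -stepωα (n + 1 : ℕ) ω α β
    let b := stepωβ (n + 1 : ℕ) ω α β
    knotInteg α β a b (Qω (n + 1) α β ω) = 0 ∧
      knotInteg α β a b ((1 - X) * Qω (n + 1) α β ω) = 0 := by
  have e1 : (1 - X) * Qω (n + 1) α β ω = (1 - X) * Q (n + 1) α β + C ω * ((1 - X) * Q n α β) := by
    rw [Qω, Nat.add_sub_cancel]; ring
  have hΓ : Γω (n + 1) ω α β ≠ 0 := by
    rw [Qω_eval_one] at h
    exact right_ne_zero_of_mul h
  intro a b
  rw [e1, Qω, Nat.add_sub_cancel]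
  simp only [map_add, knotInteg_C_mul, knotInteg_Q, knotInteg_one_sub_X_mul_Q,
    Q_derivative_eval_one, Q_eval_one]
  have hn1 : (n + 1 : ℝ) ≠ 0 := by positivity
  have hn2 : (n + 2 : ℝ) ≠ 0 := by positivity
  have hn3 : (n + 3 : ℝ) ≠ 0 := by positivity
  have hα : 3 * (n + 2 : ℝ) ^ 2 * Γω (n + 1) ω α β ^ 2 * a = -4 * numα (n + 1) ω α β := by
    simp only [a, stepωα]; push_cast; field_simp; ring
  have hβ : 3 * Γω (n + 1) ω α β * (n + 2 : ℝ) ^ 2 * (n + 3) * (n + 1) * b =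
      numβ (n + 1) ω α β := by
    simp only [b, stepωβ]; push_cast; field_simp; ring
  push_cast
  -- the value of `Q_{ω,n+1}` at the right end, which multiplies the corrections
  have hV : Γ (n + 1) α β + ω * Γ n α β = -(n + 2) / 2 * Γω (n + 1) ω α β := by
    simp only [Γ, Γω]; ring
  constructor
  · have key : 3 * (n + 2) * Γω (n + 1) ω α β *
        ((2 * (F (n + 1) α β + (n + 2) * F₁ (n + 1) α β) - 12 * (n + 2) * (n + 3) * F₂ (n + 1) β) +
          ω * (2 * (F n α β + (n + 1) * F₁ n α β) - 12 * (n + 1) * (n + 2) * F₂ n β)) +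
        4 * numα (n + 1) ω α β + 2 * numβ (n + 1) ω α β *
          ((n + 4) * (F (n + 1) α β + n * F₁ (n + 1) α β - 6 * n * (n + 5) * F₂ (n + 1) β) +
            ω * n * (F n α β + (n - 1) * F₁ n α β - 6 * (n - 1) * (n + 4) * F₂ n β)) = 0 := by
      simp only [Γω, numα, numβ, F, F₁, F₂]
      ring
    apply mul_left_cancel₀ (mul_ne_zero (mul_ne_zero (by norm_num : (3 : ℝ) ≠ 0) hn2) hΓ)
    linear_combination key - hα + 2 * ((n + 4) * (F (n + 1) α β + n * F₁ (n + 1) α β -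
      6 * n * (n + 5) * F₂ (n + 1) β) + ω * n * (F n α β + (n - 1) * F₁ n α β -
      6 * (n - 1) * (n + 4) * F₂ n β)) * hβ + 6 * (n + 2) * Γω (n + 1) ω α β * a * hV
  · have key : 4 * (n + 1) * (F (n + 1) α β + (n + 3) * F₁ (n + 1) α β) -
        24 * (n + 1) * (n + 2) * (n + 3) * F₂ (n + 1) β +
        ω * (4 * (n + 3) * (F n α β + (n + 2) * F₁ n α β) -
          24 * (n + 1) * (n + 2) * (n + 3) * F₂ n β) + 4 * numβ (n + 1) ω α β = 0 := by
      simp only [numβ, F, F₁, F₂]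
      ring
    have h1 : 4 / ((n + 1 + 1 : ℝ) * (n + 1 + 2)) * ((n + 2) * (n + 3)) = 4 := by
      field_simp; ring
    have h2 : 4 / ((n + 1 : ℝ) * (n + 2)) * ((n + 1) * (n + 2)) = 4 := by
      field_simp
    apply mul_left_cancel₀ (mul_ne_zero (mul_ne_zero hn1 hn2) hn3)
    apply mul_left_cancel₀ hn2
    linear_combination (n + 2) * key + 4 * (n + 2) * hβ -
      24 * (n + 1) * (n + 2) ^ 2 * (n + 3) * b * hV +
      (n + 1) * (n + 2) * (F (n + 1) α β + (n + 3) * F₁ (n + 1) α β) * h1 +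
      ω * (n + 2) * (n + 3) * (F n α β + (n + 2) * F₁ n α β) * h2

end C1

/-! ### The middle polynomials -/

namespace C1

lemma jacobi_zero_derivative_eval (n : ℕ) :
    let P' := derivative (jacobi 0 0 n)
    let P'' := derivative P'
    (P'.eval (-1) = -(n * (n + 1)) / 2 * (-1) ^ n ∧
      P''.eval (-1) = n * (n + 1) * (n * (n + 1) - 2) / 8 * (-1) ^ n ∧
      (derivative P'').eval (-1) =
        -(n * (n + 1) * (n * (n + 1) - 2) * (n * (n + 1) - 6)) / 48 * (-1) ^ n) ∧
    P'.eval 1 = n * (n + 1) / 2 ∧ P''.eval 1 = n * (n + 1) * (n * (n + 1) - 2) / 8 ∧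
      (derivative P'').eval 1 = n * (n + 1) * (n * (n + 1) - 2) * (n * (n + 1) - 6) / 48 := by
  obtain ⟨⟨h1, h2, h3⟩, h4, h5, h6⟩ := jacobi_derivative_eval 0 n
  rw [jacobi_eval_neg_one] at h1
  rw [jacobi_zero_eval_one] at h4
  push_cast at h1 h2 h3 h4 h5 h6
  have g1 : (derivative (jacobi 0 0 n)).eval (-1) = -(n * (n + 1)) / 2 * (-1) ^ n := by
    linear_combination h1 / 2
  have g2 : (derivative (derivative (jacobi 0 0 n))).eval (-1) =
      n * (n + 1) * (n * (n + 1) - 2) / 8 * (-1) ^ n := by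
    rw [g1] at h2
    linear_combination h2 / 4
  have g3 : (derivative (jacobi 0 0 n)).eval 1 = n * (n + 1) / 2 := by
    linear_combination h4 / 2
  have g4 : (derivative (derivative (jacobi 0 0 n))).eval 1 =
      n * (n + 1) * (n * (n + 1) - 2) / 8 := by
    rw [g3] at h5
    linear_combination h5 / 4
  refine ⟨⟨g1, g2, ?_⟩, g3, g4, ?_⟩
  · rw [g2] at h3
    linear_combination h3 / 6
  · rw [g4] at h6
    linear_combination h6 / 6

/-- The coefficients of `M_n` with respect to `P`, `P'`, `x P'`, `P''`, `x P''`, where `P` is the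
Legendre polynomial of degree `n`. -/
def mcoef (n αL αR βL βR : ℝ) : Fin 5 → ℝ
  | 0 => 1 / 2 * (H₃ n αL βL * H₀ (n + 1) αR βR + H₃ n αR βR * H₀ (n + 1) αL βL) -
      36 * (βL - βR) ^ 2 * n ^ 2 * (n + 1) ^ 2
  | 1 => H₁ n αL βL * H₀ (n + 1) αR βR - H₁ n αR βR * H₀ (n + 1) αL βL +
      12 * (H₂ n βR * H₄ n αL βL - H₂ n βL * H₄ n αR βR)
  | 2 => -H₁ n αL βL * H₀ (n + 1) αR βR - H₁ n αR βR * H₀ (n + 1) αL βL +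
      72 * (βL - βR) ^ 2 * n * (n + 1)
  | 3 => 12 * (H₂ n βL * H₀ (n + 1) αR βR + H₂ n βR * H₀ (n + 1) αL βL) -
      72 * (βL - βR) ^ 2 * n * (n + 1)
  | 4 => 12 * (-H₂ n βL * H₀ (n + 1) αR βR + H₂ n βR * H₀ (n + 1) αL βL) +
      72 * n * (n + 1) * (βL - βR) * (βL + βR - 6 * (n - 1) * n * (n + 1) * (n + 2) * βL * βR)

lemma M_eq (n : ℕ) (αL αR βL βR : ℝ) :
    let m := mcoef n αL αR βL βR
    let P := jacobi 0 0 n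
    M n αL αR βL βR = C (m 0) * P + C (m 1) * derivative P + C (m 2) * (X * derivative P) +
      C (m 3) * derivative (derivative P) + C (m 4) * (X * derivative (derivative P)) := by
  intro m P
  have h12 : (12 : ℝ[X]) = C 12 := (C_ofNat 12).symm
  have h2 : (2 : ℝ[X]) = C 2 := (C_ofNat 2).symm
  have hn : ((1 : ℝ) / 2) * 2 = 1 := by norm_num
  simp only [m, mcoef, M]
  simp only [map_add, map_sub, map_mul, map_pow, map_ofNat, map_one, map_natCast, map_neg]
  ring

lemma M_coeff (n k : ℕ) (αL αR βL βR : ℝ) (hk : n ≤ k) :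
    (M n αL αR βL βR).coeff k = H n αL αR βL βR * (jacobi 0 0 n).coeff k := by
  rw [M_eq]
  simp only [coeff_add, coeff_C_mul, coeff_X_mul_derivative, coeff_derivative,
    jacobi_coeff_eq_zero 0 n (show n < k + 1 by omega),
    jacobi_coeff_eq_zero 0 n (show n < k + 1 + 1 by omega)]
  rcases hk.eq_or_lt with rfl | hk
  · simp only [mcoef, H, H₀, H₁, H₂, H₃]
    ring
  · rw [jacobi_coeff_eq_zero 0 n hk]; ring

lemma natDegree_M_le (n : ℕ) (αL αR βL βR : ℝ) : (M n αL αR βL βR).natDegree ≤ n := by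
  rw [natDegree_le_iff_coeff_eq_zero]
  intro m hm
  rw [M_coeff n m _ _ _ _ hm.le, jacobi_coeff_eq_zero 0 n hm, mul_zero]

lemma jacobiMoment_zero_mul (n : ℕ) {p : ℝ[X]} (hp : p.natDegree ≤ n) :
    integ (jacobi 0 0 n * p) = p.coeff n * jacobiMoment 0 n := by
  have := integ_jacobi_mul_of_le 0 n hp
  rwa [pow_zero, one_mul] at this

set_option maxHeartbeats 4000000 in
/-- `M_n` is orthogonal to all polynomials of smaller degree, and its norm is proportional to
`H (n + 1)`. -/
lemma knotInteg_M_mul (n : ℕ) (αL βL αR βR : ℝ) {p : ℝ[X]} (hp : p.natDegree ≤ n) :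
    knotInteg αL βL αR βR (M n αL αR βL βR * p) =
      p.coeff n * jacobiMoment 0 n * H (n + 1) αL αR βL βR := by
  obtain ⟨⟨h1, h2, h3⟩, h4, h5, h6⟩ := jacobi_zero_derivative_eval n
  have hc : ∀ m, n < m → p.coeff m = 0 := fun m hm => coeff_eq_zero_of_natDegree_lt (by omega)
  have hx : derivative (X * p) = p + X * derivative p := by simp
  have hpd : (derivative p).natDegree ≤ n := (natDegree_derivative_le p).trans (by omega)
  have hxd : (p + X * derivative p).natDegree ≤ n := by
    rw [natDegree_le_iff_coeff_eq_zero]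
    intro m hm
    simp only [coeff_add, coeff_X_mul_derivative, hc m hm]
    ring
  have hxdd : (derivative (p + X * derivative p)).natDegree ≤ n :=
    (natDegree_derivative_le _).trans (by omega)
  -- the integrals of `p` against `P`, `P'`, `x P'`, `P''` and `x P''`, by parts
  have T0 := jacobiMoment_zero_mul n hp
  have T1 : integ (derivative (jacobi 0 0 n) * p) = p.eval 1 - (-1) ^ n * p.eval (-1) := by
    rw [integ_derivative_mul, jacobiMoment_zero_mul n hpd, coeff_derivative, hc _ (by omega),
      jacobi_zero_eval_one, jacobi_eval_neg_one]
    ring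
  have T2 : integ (derivative (jacobi 0 0 n) * (X * p)) = p.eval 1 + (-1) ^ n * p.eval (-1) -
      (n + 1) * (p.coeff n * jacobiMoment 0 n) := by
    rw [integ_derivative_mul, hx, jacobiMoment_zero_mul n hxd, coeff_add, coeff_X_mul_derivative,
      jacobi_zero_eval_one, jacobi_eval_neg_one]
    simp only [eval_mul, eval_X]
    ring
  have T3 : integ (derivative (derivative (jacobi 0 0 n)) * p) =
      n * (n + 1) / 2 * (p.eval 1 + (-1) ^ n * p.eval (-1)) -
        ((derivative p).eval 1 - (-1) ^ n * (derivative p).eval (-1)) := by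
    rw [integ_derivative_mul, integ_derivative_mul, jacobiMoment_zero_mul n
      ((natDegree_derivative_le _).trans (by omega)), coeff_derivative, coeff_derivative,
      hc _ (by omega), jacobi_zero_eval_one, jacobi_eval_neg_one, h1, h4]
    ring
  have T4 : integ (derivative (derivative (jacobi 0 0 n)) * (X * p)) =
      n * (n + 1) / 2 * (p.eval 1 - (-1) ^ n * p.eval (-1)) -
        ((p.eval 1 + (derivative p).eval 1) -
          (-1) ^ n * (p.eval (-1) - (derivative p).eval (-1))) := by
    rw [integ_derivative_mul, hx, integ_derivative_mul, jacobiMoment_zero_mul n hxdd,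
      coeff_derivative, coeff_add, coeff_X_mul_derivative, hc _ (by omega), jacobi_zero_eval_one,
      jacobi_eval_neg_one, h1, h4]
    simp only [eval_add, eval_mul, eval_X]
    ring
  set m := mcoef n αL αR βL βR with hm
  have e : M n αL αR βL βR * p = C (m 0) * (jacobi 0 0 n * p) +
      C (m 1) * (derivative (jacobi 0 0 n) * p) + C (m 2) * (derivative (jacobi 0 0 n) * (X * p)) +
      C (m 3) * (derivative (derivative (jacobi 0 0 n)) * p) +
      C (m 4) * (derivative (derivative (jacobi 0 0 n)) * (X * p)) := by
    rw [M_eq]; ring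
  have ei : integ (M n αL αR βL βR * p) = _ := congrArg integ e
  rw [map_add, map_add, map_add, map_add, integ_C_mul, integ_C_mul, integ_C_mul, integ_C_mul,
    integ_C_mul, T0, T1, T2, T3, T4] at ei
  have v1 : (M n αL αR βL βR).eval 1 =
      m 0 + (m 1 + m 2) * (n * (n + 1) / 2) +
        (m 3 + m 4) * (n * (n + 1) * (n * (n + 1) - 2) / 8) := by
    rw [M_eq]
    simp only [eval_add, eval_mul, eval_C, eval_X, h4, h5, jacobi_zero_eval_one]
    ring
  have v2 : (M n αL αR βL βR).eval (-1) =
      (-1) ^ n * (m 0 - (m 1 - m 2) * (n * (n + 1) / 2) +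
        (m 3 - m 4) * (n * (n + 1) * (n * (n + 1) - 2) / 8)) := by
    rw [M_eq]
    simp only [eval_add, eval_mul, eval_C, eval_X, h1, h2, jacobi_eval_neg_one]
    ring
  have v3 : (derivative (M n αL αR βL βR)).eval 1 =
      (m 0 + m 2) * (n * (n + 1) / 2) +
        (m 1 + m 2 + m 4) * (n * (n + 1) * (n * (n + 1) - 2) / 8) +
        (m 3 + m 4) * (n * (n + 1) * (n * (n + 1) - 2) * (n * (n + 1) - 6) / 48) := by
    rw [M_eq]
    simp only [derivative_add, derivative_mul, derivative_C, derivative_X, eval_add, eval_mul,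
      eval_C, eval_X, eval_zero, eval_one, h4, h5, h6]
    ring
  have v4 : (derivative (M n αL αR βL βR)).eval (-1) =
      (-1) ^ n * (-(m 0 + m 2) * (n * (n + 1) / 2) +
        (m 1 - m 2 + m 4) * (n * (n + 1) * (n * (n + 1) - 2) / 8) -
        (m 3 - m 4) * (n * (n + 1) * (n * (n + 1) - 2) * (n * (n + 1) - 6) / 48)) := by
    rw [M_eq]
    simp only [derivative_add, derivative_mul, derivative_C, derivative_X, eval_add, eval_mul,
      eval_C, eval_X, eval_zero, eval_one, h1, h2, h3]
    ring
  -- the coefficients of `p 1`, `p' 1`, `p (-1)`, `p' (-1)` and of the moment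
  have k0 : m 0 - (n + 1) * m 2 = H (n + 1) αL αR βL βR := by
    simp only [hm, mcoef, H, H₀, H₁, H₂, H₃]
    ring
  have k1 : -m 3 - m 4 + 24 * βR * (m 0 + (m 1 + m 2) * (n * (n + 1) / 2) +
      (m 3 + m 4) * (n * (n + 1) * (n * (n + 1) - 2) / 8)) = 0 := by
    simp only [hm, mcoef, H₀, H₁, H₂, H₃, H₄]
    ring
  have k2 : m 3 - m 4 - 24 * βL * (m 0 - (m 1 - m 2) * (n * (n + 1) / 2) +
        (m 3 - m 4) * (n * (n + 1) * (n * (n + 1) - 2) / 8)) = 0 := by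
    simp only [hm, mcoef, H₀, H₁, H₂, H₃, H₄]
    ring
  have k3 : m 1 + m 2 + (m 3 + m 4) * (n * (n + 1) / 2) - m 4 +
      2 * αR * (m 0 + (m 1 + m 2) * (n * (n + 1) / 2) +
        (m 3 + m 4) * (n * (n + 1) * (n * (n + 1) - 2) / 8)) +
      24 * βR * ((m 0 + m 2) * (n * (n + 1) / 2) +
        (m 1 + m 2 + m 4) * (n * (n + 1) * (n * (n + 1) - 2) / 8) +
        (m 3 + m 4) * (n * (n + 1) * (n * (n + 1) - 2) * (n * (n + 1) - 6) / 48)) = 0 := by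
    simp only [hm, mcoef, H₀, H₁, H₂, H₃, H₄]
    ring
  have k4 : -m 1 + m 2 + (m 3 - m 4) * (n * (n + 1) / 2) + m 4 +
      2 * αL * (m 0 - (m 1 - m 2) * (n * (n + 1) / 2) +
        (m 3 - m 4) * (n * (n + 1) * (n * (n + 1) - 2) / 8)) -
      24 * βL * (-(m 0 + m 2) * (n * (n + 1) / 2) +
        (m 1 - m 2 + m 4) * (n * (n + 1) * (n * (n + 1) - 2) / 8) -
        (m 3 - m 4) * (n * (n + 1) * (n * (n + 1) - 2) * (n * (n + 1) - 6) / 48)) = 0 := by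
    simp only [hm, mcoef, H₀, H₁, H₂, H₃, H₄]
    ring
  rw [knotInteg_apply, ei]
  simp only [derivative_mul, eval_add, eval_mul, v1, v2, v3, v4]
  linear_combination p.coeff n * jacobiMoment 0 n * k0 + (derivative p).eval 1 * k1 +
    (-1) ^ n * (derivative p).eval (-1) * k2 + p.eval 1 * k3 + (-1) ^ n * p.eval (-1) * k4

end C1

/-! ### Gaussian rules of linear functionals -/

lemma derivative_eval_ne_zero {m : ℝ[X]} (hnd : m.roots.Nodup) {x : ℝ} (hx : x ∈ m.roots) :
    (derivative m).eval x ≠ 0 := by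
  intro h
  have hm : m ≠ 0 := fun h => by simp [h] at hx
  have h1 := (one_lt_rootMultiplicity_iff_isRoot hm).2 ⟨isRoot_of_mem_roots hx, h⟩
  rw [← count_roots] at h1
  have := Multiset.nodup_iff_count_le_one.1 hnd x
  omega

lemma eq_mul_divByMonic {m : ℝ[X]} {x : ℝ} (hx : x ∈ m.roots) :
    m = (X - C x) * (m /ₘ (X - C x)) :=
  (mul_divByMonic_eq_iff_isRoot.2 (isRoot_of_mem_roots hx)).symm

lemma divByMonic_eval_self {m : ℝ[X]} {x : ℝ} (hx : x ∈ m.roots) :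
    (m /ₘ (X - C x)).eval x = (derivative m).eval x := by
  conv_rhs => rw [eq_mul_divByMonic hx]
  simp

lemma divByMonic_eval_of_ne {m : ℝ[X]} {x y : ℝ} (hx : x ∈ m.roots) (hy : y ∈ m.roots)
    (h : y ≠ x) : (m /ₘ (X - C x)).eval y = 0 := by
  have h1 : m.eval y = 0 := isRoot_of_mem_roots hy
  rw [eq_mul_divByMonic hx] at h1
  simp only [eval_mul, eval_sub, eval_X, eval_C] at h1
  exact (mul_eq_zero.1 h1).resolve_left (sub_ne_zero.2 h)

/-- Lagrange interpolation at the simple roots of a polynomial. -/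
lemma eq_sum_roots {m r : ℝ[X]} {n : ℕ} (hm : m.natDegree ≤ n) (hcard : Multiset.card m.roots = n)
    (hnd : m.roots.Nodup) (hr : r.degree < n) :
    r = ∑ x ∈ m.roots.toFinset, C (r.eval x / (derivative m).eval x) * (m /ₘ (X - C x)) := by
  have hc : m.roots.toFinset.card = n := by
    rw [Multiset.toFinset_card_of_nodup hnd, hcard]
  refine eq_of_degrees_lt_of_eval_finset_eq m.roots.toFinset (by rwa [hc]) ?_ fun y hy => ?_
  · rw [hc]
    refine mem_degreeLT.1 (Submodule.sum_mem _ fun x hx => mem_degreeLT.2 ?_)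
    rw [Multiset.mem_toFinset] at hx
    rw [← smul_eq_C_mul]
    refine (degree_smul_le _ _).trans_lt ?_
    have hm0 : m ≠ 0 := fun h => by simp [h] at hx
    have h1 := degree_divByMonic_lt m (X - C x) hm0 (by simp)
    exact h1.trans_le (degree_le_of_natDegree_le hm)
  · rw [eval_finsetSum, Finset.sum_eq_single y]
    · rw [Multiset.mem_toFinset] at hy
      rw [eval_mul, eval_C, divByMonic_eval_self hy]
      exact (div_mul_cancel₀ _ (derivative_eval_ne_zero hnd hy)).symm
    · intro x hx hxy
      rw [Multiset.mem_toFinset] at hx hy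
      rw [eval_mul, divByMonic_eval_of_ne hx hy hxy.symm, mul_zero]
    · exact fun h => absurd hy h

/-- A linear functional that annihilates the multiples `m * p`, `deg p < d`, of a polynomial `m`
with simple real roots is an interpolatory quadrature rule on the roots of `m`. -/
lemma functional_eq_sum_roots (Λ : ℝ[X] →ₗ[ℝ] ℝ) {m f : ℝ[X]} {n d : ℕ} (hm : m.natDegree = n)
    (hcard : Multiset.card m.roots = n) (hnd : m.roots.Nodup) (hm0 : m ≠ 0)
    (horth : ∀ p : ℝ[X], p.degree < d → Λ (m * p) = 0) (hf : f.degree < (n + d : ℕ)) :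
    Λ f = (m.roots.map fun x =>
      Λ (m /ₘ (X - C x)) / (derivative m).eval x * f.eval x).sum := by
  have hmd : m.degree = n := by rw [degree_eq_natDegree hm0, hm]
  have hr : (f % m).degree < n := by rw [← hmd]; exact degree_mod_lt f hm0
  have hfm : f = f % m + m * (f / m) := (EuclideanDomain.mod_add_div f m).symm
  have hs : (f / m).degree < d := by
    by_contra! h
    have h1 : (m * (f / m)).degree < (n + d : ℕ) := by
      have : m * (f / m) = f - f % m := by
        linear_combination -hfm
      rw [this]
      refine (degree_sub_le _ _).trans_lt (max_lt hf (hr.trans_le ?_))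
      exact_mod_cast Nat.le_add_right n d
    rw [degree_mul, hmd] at h1
    push_cast at h1
    exact absurd h1 (not_lt.2 (by gcongr))
  have hev : ∀ x ∈ m.roots, (f % m).eval x = f.eval x := by
    intro x hx
    conv_rhs => rw [hfm]
    simp [show m.eval x = 0 from isRoot_of_mem_roots hx]
  have e1 : Λ f = Λ (f % m) := by
    conv_lhs => rw [hfm]
    rw [map_add, horth _ hs, add_zero]
  rw [e1, eq_sum_roots hm.le hcard hnd hr, map_sum]
  have e2 : m.roots = m.roots.toFinset.val := by
    rw [Multiset.toFinset_val, Multiset.dedup_eq_self.2 hnd]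
  conv_rhs => rw [e2]
  change _ = ∑ x ∈ m.roots.toFinset, _
  refine Finset.sum_congr rfl fun x hx => ?_
  rw [Multiset.mem_toFinset] at hx
  rw [← smul_eq_C_mul, map_smul, hev x hx, smul_eq_mul]
  ring

/-- The Christoffel-Darboux argument: if `m` has degree `k + 1`, is orthogonal to all polynomials
of degree less than `k`, and `q` is an orthogonal polynomial of degree `k`, then
`Λ (W * m / (X - x)) * q x` is the same for all roots `x` of `m`. -/
lemma christoffel_darboux (Λ : ℝ[X] →ₗ[ℝ] ℝ) {W m q : ℝ[X]} {k : ℕ} {J : ℝ}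
    (hm : m.natDegree ≤ k + 1) (hq : q.natDegree ≤ k)
    (h1 : ∀ p : ℝ[X], p.degree < k → Λ (W * m * p) = 0)
    (h2 : ∀ p : ℝ[X], p.natDegree ≤ k → Λ (W * q * p) = p.coeff k * J) {x : ℝ}
    (hx : x ∈ m.roots) :
    Λ (W * (m /ₘ (X - C x))) * q.eval x = m.coeff (k + 1) * J := by
  set mx := m /ₘ (X - C x) with hmx
  have hfac : m = (X - C x) * mx := eq_mul_divByMonic hx
  have hmxd : mx.natDegree ≤ k := by
    rw [hmx, natDegree_divByMonic _ (monic_X_sub_C x), natDegree_X_sub_C]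
    omega
  have hco : m.coeff (k + 1) = mx.coeff k := by
    rw [hfac, sub_mul, coeff_sub, coeff_X_mul, coeff_C_mul,
      coeff_eq_zero_of_natDegree_lt (show mx.natDegree < k + 1 by omega)]
    ring
  obtain ⟨s, hs, hqs⟩ := exists_eq_C_add_mul q x k (degree_lt_of_natDegree_le hq (by omega))
  have e : W * q * mx = C (q.eval x) * (W * mx) + W * m * s := by
    conv_lhs => rw [hqs]
    rw [hfac]
    ring
  have h3 := h2 mx hmxd
  rw [e, map_add, h1 s hs, ← smul_eq_C_mul, map_smul, smul_eq_mul] at h3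
  rw [hco, ← h3]
  ring

/-- The Gaussian quadrature rule of a linear functional `Λ`, with weights expressed through the
next orthogonal polynomial `q` for the functional `p ↦ Λ (W * p)`. -/
lemma gauss_rule (Λ : ℝ[X] →ₗ[ℝ] ℝ) {W m q f : ℝ[X]} {k d : ℕ} {J : ℝ}
    (hm : m.natDegree ≤ k + 1) (hcard : Multiset.card m.roots = k + 1) (hnd : m.roots.Nodup)
    (hq : q.natDegree ≤ k) (hW : W.natDegree ≤ d) (hWx : ∀ x ∈ m.roots, W.eval x ≠ 0)
    (horth : ∀ p : ℝ[X], p.degree < d → Λ (m * p) = 0)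
    (h1 : ∀ p : ℝ[X], p.degree < k → Λ (W * m * p) = 0)
    (h2 : ∀ p : ℝ[X], p.natDegree ≤ k → Λ (W * q * p) = p.coeff k * J)
    (hJ : m.coeff (k + 1) * J ≠ 0) (hf : f.degree < (k + 1 + d : ℕ)) :
    (m.roots.map fun x => m.coeff (k + 1) * J /
      ((derivative m).eval x * q.eval x * W.eval x) * f.eval x).sum = Λ f := by
  have hm0 : m ≠ 0 := fun h => by simp [h] at hcard
  have hmd : m.natDegree = k + 1 := le_antisymm hm (hcard ▸ card_roots' m)
  rw [functional_eq_sum_roots Λ hmd hcard hnd hm0 horth hf]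
  refine congrArg Multiset.sum (Multiset.map_congr rfl fun x hx => ?_)
  have hcd := christoffel_darboux Λ hm hq h1 h2 hx
  have hqx : q.eval x ≠ 0 := fun h => hJ (by rw [← hcd, h, mul_zero])
  obtain ⟨u, hu, hWu⟩ := exists_eq_C_add_mul W x d (degree_lt_of_natDegree_le hW (by omega))
  have e : W * (m /ₘ (X - C x)) = C (W.eval x) * (m /ₘ (X - C x)) + m * u := by
    conv_lhs => rw [hWu]
    conv_rhs => rw [eq_mul_divByMonic hx]
    rw [add_mul, mul_assoc, mul_comm u, ← mul_assoc]
    congr 3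
    rw [← eq_mul_divByMonic hx]
  rw [e, map_add, horth u hu, ← smul_eq_C_mul, map_smul, smul_eq_mul, add_zero] at hcd
  rw [← hcd]
  have := hWx x hx
  have := derivative_eval_ne_zero hnd hx
  field_simp

lemma natDegree_one_sub_X_pow_le (a : ℕ) : ((1 - X : ℝ[X]) ^ a).natDegree ≤ a := by
  compute_degree

/-- Orthogonality to all polynomials from orthogonality to `1`, `1 - x` and the multiples of
`(1 - x) ^ 2`. -/
lemma orth_of_one_sub_X_sq (Λ : ℝ[X] →ₗ[ℝ] ℝ) {m : ℝ[X]} {k : ℕ} (h0 : Λ m = 0)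
    (h1 : Λ ((1 - X) * m) = 0) (h2 : ∀ p : ℝ[X], p.degree < k → Λ ((1 - X) ^ 2 * m * p) = 0)
    {p : ℝ[X]} (hp : p.degree < (k + 2 : ℕ)) : Λ (m * p) = 0 := by
  obtain ⟨s, hs, hps⟩ := exists_eq_C_add_mul p 1 (k + 1) hp
  obtain ⟨u, hu, hsu⟩ := exists_eq_C_add_mul s 1 k hs
  have e : m * p = p.eval 1 • m + (-s.eval 1) • ((1 - X) * m) + (1 - X) ^ 2 * m * u := by
    rw [hps, hsu, smul_eq_C_mul, smul_eq_C_mul, C_1]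
    simp
    ring
  rw [e, map_add, map_add, map_smul, map_smul, h0, h1, h2 u hu]
  simp

/-- Orthogonality to all polynomials from orthogonality to `1` and the multiples of `1 - x`. -/
lemma orth_of_one_sub_X (Λ : ℝ[X] →ₗ[ℝ] ℝ) {m : ℝ[X]} {k : ℕ} (h0 : Λ m = 0)
    (h1 : ∀ p : ℝ[X], p.degree < k → Λ ((1 - X) * m * p) = 0)
    {p : ℝ[X]} (hp : p.degree < (k + 1 : ℕ)) : Λ (m * p) = 0 := by
  obtain ⟨s, hs, hps⟩ := exists_eq_C_add_mul p 1 k hp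
  have e : m * p = p.eval 1 • m - (1 - X) * m * s := by
    conv_lhs => rw [hps, C_1]
    rw [smul_eq_C_mul]
    ring
  rw [e, map_sub, map_smul, h0, h1 s hs]
  simp

/-! ### Rules on single subintervals in class 1 -/

lemma coeff_ne_zero_of_card_roots {m : ℝ[X]} {n : ℕ} (hm : m.natDegree ≤ n + 1)
    (hcard : Multiset.card m.roots = n + 1) : m.coeff (n + 1) ≠ 0 := by
  have hm0 : m ≠ 0 := fun h => by simp [h] at hcard
  have hmd : m.natDegree = n + 1 := le_antisymm hm (hcard ▸ card_roots' m)
  rw [← hmd]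
  exact leadingCoeff_ne_zero.2 hm0

lemma eval_one_ne_zero_of_hasRootsIn {m : ℝ[X]} {n : ℕ} (h : HasRootsIn m n (Set.Ico (-1) 1))
    (hm : m ≠ 0) : m.eval 1 ≠ 0 := fun h1 =>
  lt_irrefl _ (h.2.2 1 ((mem_roots hm).2 h1)).2

namespace C1

lemma natDegree_Qω_le (k : ℕ) (α β ω : ℝ) : (Qω (k + 1) α β ω).natDegree ≤ k + 1 :=
  natDegree_add_le_of_degree_le (natDegree_Q_le _ _ _)
    ((natDegree_C_mul_le _ _).trans ((natDegree_Q_le _ _ _).trans (by omega)))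

lemma Qω_coeff (k : ℕ) (α β ω : ℝ) : (Qω (k + 1) α β ω).coeff (k + 1) =
    F (k + 1) α β * (jacobi 2 0 (k + 1)).coeff (k + 1) := by
  rw [Qω, coeff_add, coeff_C_mul, Q_coeff _ _ _ _ le_rfl, Nat.add_sub_cancel,
    Q_coeff _ _ _ _ (by omega : k ≤ k + 1), jacobi_coeff_eq_zero 2 k (by omega)]
  push_cast
  ring

/-- The product of leading coefficient and norm in the weights. -/
lemma F_mul_moment (k : ℕ) (α β : ℝ) :
    F (k + 1) α β * (jacobi 2 0 (k + 1)).coeff (k + 1) * (jacobiMoment 2 k * F (k + 1) α β) =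
      8 * ((k + 1 : ℕ) + 1) * F (k + 1 : ℕ) α β ^ 2 / ((k + 1 : ℕ) * ((k + 1 : ℕ) + 2)) := by
  have h := jacobi_two_leading_mul_moment k
  push_cast
  rw [eq_div_iff (by positivity)]
  rw [eq_div_iff (by positivity)] at h
  linear_combination F (k + 1) α β ^ 2 * h

/-- The nodes and weights from `Q_{ω,n}` integrate polynomials of degree `2 n` exactly, up to the
corrections at the two ends. -/
lemma sum_weightQ_Qω (k : ℕ) (α β ω : ℝ)
    (hr : HasRootsIn (Qω (k + 1) α β ω) (k + 1) (Set.Ico (-1) 1)) {f : ℝ[X]}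
    (hf : f.natDegree ≤ 2 * (k + 1)) :
    ((Qω (k + 1) α β ω).roots.map fun x =>
      weightQ (k + 1) α β (Qω (k + 1) α β ω) x * f.eval x).sum =
    knotInteg α β (-stepωα (k + 1 : ℕ) ω α β) (stepωβ (k + 1 : ℕ) ω α β) f := by
  set m := Qω (k + 1) α β ω with hm
  have hco := coeff_ne_zero_of_card_roots (natDegree_Qω_le k α β ω) hr.1
  have hm0 : m ≠ 0 := fun h => by rw [← hm, h] at hco; simp at hco
  have hF : F (k + 1) α β ≠ 0 := by rw [Qω_coeff] at hco; exact left_ne_zero_of_mul hco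
  obtain ⟨s0, s1⟩ := knotInteg_Qω_step k α β ω (eval_one_ne_zero_of_hasRootsIn hr hm0)
  have h1 : ∀ p : ℝ[X], p.degree < k → knotInteg α β (-stepωα (k + 1 : ℕ) ω α β)
      (stepωβ (k + 1 : ℕ) ω α β) ((1 - X) ^ 2 * m * p) = 0 := by
    intro p hp
    have hpk : p.natDegree ≤ k := natDegree_le_of_degree_le hp.le
    have e : (1 - X) ^ 2 * m * p =
        (1 - X) ^ 2 * Q (k + 1) α β * p + C ω * ((1 - X) ^ 2 * Q k α β * p) := by
      rw [hm, Qω, Nat.add_sub_cancel]; ring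
    rw [e, map_add, knotInteg_C_mul, knotInteg_Q_mul _ _ _ _ _ (by omega),
      knotInteg_Q_mul _ _ _ _ _ hpk, coeff_eq_zero_of_natDegree_lt (by omega),
      coeff_eq_zero_of_degree_lt hp]
    ring
  have hg := gauss_rule (knotInteg α β (-stepωα (k + 1 : ℕ) ω α β) (stepωβ (k + 1 : ℕ) ω α β))
    (W := (1 - X) ^ 2) (m := m) (q := Q k α β) (f := f) (k := k) (d := k + 2)
    (J := jacobiMoment 2 k * F (k + 1) α β) (natDegree_Qω_le k α β ω) hr.1 hr.2.1
    (natDegree_Q_le _ _ _) ((natDegree_one_sub_X_pow_le 2).trans (by omega))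
    (fun x hx => by
      have := (hr.2.2 x hx).2
      simp only [eval_pow, eval_sub, eval_one, eval_X]
      exact pow_ne_zero _ (by linarith))
    (fun p hp => orth_of_one_sub_X_sq _ s0 s1 h1 hp) h1
    (fun p hp => by rw [knotInteg_Q_mul _ _ _ _ _ hp]; ring)
    (by rw [Qω_coeff, F_mul_moment]; push_cast; positivity)
    (degree_lt_of_natDegree_le hf (by omega))
  rw [← hg, Qω_coeff, F_mul_moment]
  refine congrArg Multiset.sum (Multiset.map_congr rfl fun x _ => ?_)
  simp only [weightQ, Nat.add_sub_cancel, eval_pow, eval_sub, eval_one, eval_X, div_div]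

lemma Q_zero (α β : ℝ) : Q 0 α β = 1 := by
  simp [Q, jacobi, F]

/-- The nodes and weights from `Q_n` integrate polynomials of degree `2 n + 2` exactly, up to the
corrections at the two ends, if the norm of `Q_n` vanishes. -/
lemma sum_weightQ_Q (k : ℕ) (α β : ℝ) (hF : F (k + 1) α β = 0)
    (hr : HasRootsIn (Q k α β) k (Set.Ico (-1) 1)) {f : ℝ[X]} (hf : f.natDegree ≤ 2 * (k + 1)) :
    ((Q k α β).roots.map fun x => weightQ k α β (Q k α β) x * f.eval x).sum =
      knotInteg α β (-stepα k α β) (stepβ k α β) f := by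
  set Λ := knotInteg α β (-stepα k α β) (stepβ k α β) with hΛ
  have hm0 : Q k α β ≠ 0 := by
    rcases k with _ | k
    · rw [Q_zero]; exact one_ne_zero
    · exact fun h => coeff_ne_zero_of_card_roots (natDegree_Q_le _ _ _) hr.1 (by rw [h, coeff_zero])
  obtain ⟨s0, s1⟩ := knotInteg_Q_step k α β (eval_one_ne_zero_of_hasRootsIn hr hm0)
  have h1 : ∀ p : ℝ[X], p.degree < (k + 1 : ℕ) → Λ ((1 - X) ^ 2 * Q k α β * p) = 0 := by
    intro p hp
    rw [hΛ, knotInteg_Q_mul _ _ _ _ _ (natDegree_le_of_degree_lt hp), hF, mul_zero]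
  have horth : ∀ p : ℝ[X], p.degree < (k + 3 : ℕ) → Λ (Q k α β * p) = 0 :=
    fun p hp => orth_of_one_sub_X_sq Λ s0 s1 h1 hp
  rcases k with _ | k
  · rw [Q_zero] at horth ⊢
    have := horth f (degree_lt_of_natDegree_le hf (by omega))
    rw [one_mul] at this
    simp [this]
  have hco := coeff_ne_zero_of_card_roots (natDegree_Q_le _ _ _) hr.1
  have hF' : F (k + 1) α β ≠ 0 := by
    rw [Q_coeff _ _ _ _ le_rfl] at hco
    exact_mod_cast left_ne_zero_of_mul hco
  have hcoe : (Q (k + 1) α β).coeff (k + 1) =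
      F (k + 1) α β * (jacobi 2 0 (k + 1)).coeff (k + 1) := by
    rw [Q_coeff _ _ _ _ le_rfl]; push_cast; rfl
  have hg := gauss_rule Λ (W := (1 - X) ^ 2) (m := Q (k + 1) α β) (q := Q k α β) (f := f) (k := k)
    (d := k + 1 + 3) (J := jacobiMoment 2 k * F (k + 1) α β) (natDegree_Q_le _ _ _) hr.1 hr.2.1
    (natDegree_Q_le _ _ _) ((natDegree_one_sub_X_pow_le 2).trans (by omega))
    (fun x hx => by
      have := (hr.2.2 x hx).2
      simp only [eval_pow, eval_sub, eval_one, eval_X]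
      exact pow_ne_zero _ (by linarith))
    horth (fun p hp => h1 p (hp.trans (by exact_mod_cast (by omega : k < k + 1 + 1))))
    (fun p hp => by rw [hΛ, knotInteg_Q_mul _ _ _ _ _ hp]; ring)
    (by rw [hcoe, F_mul_moment]; push_cast; positivity)
    (degree_lt_of_natDegree_le hf (by omega))
  rw [← hg, hcoe, F_mul_moment]
  refine congrArg Multiset.sum (Multiset.map_congr rfl fun x _ => ?_)
  simp only [weightQ, Nat.add_sub_cancel, eval_pow, eval_sub, eval_one, eval_X, div_div]

/-- The analogue of `F_mul_moment` in the middle. -/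
lemma H_mul_moment (k : ℕ) (αL αR βL βR : ℝ) :
    H (k + 1) αL αR βL βR * (jacobi 0 0 (k + 1)).coeff (k + 1) *
      (jacobiMoment 0 k * H (k + 1) αL αR βL βR) =
      2 * H (k + 1 : ℕ) αL αR βL βR ^ 2 / (k + 1 : ℕ) := by
  have h := jacobi_zero_leading_mul_moment k
  push_cast
  rw [eq_div_iff (by positivity)]
  linear_combination H (k + 1) αL αR βL βR ^ 2 * h

lemma natDegree_Mω_le (k : ℕ) (αL αR βL βR ω : ℝ) :
    (Mω (k + 1) αL αR βL βR ω).natDegree ≤ k + 1 :=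
  natDegree_add_le_of_degree_le (natDegree_M_le _ _ _ _ _)
    ((natDegree_C_mul_le _ _).trans ((natDegree_M_le _ _ _ _ _).trans (by omega)))

lemma Mω_coeff (k : ℕ) (αL αR βL βR ω : ℝ) : (Mω (k + 1) αL αR βL βR ω).coeff (k + 1) =
    H (k + 1) αL αR βL βR * (jacobi 0 0 (k + 1)).coeff (k + 1) := by
  rw [Mω, coeff_add, coeff_C_mul, M_coeff _ _ _ _ _ _ le_rfl, Nat.add_sub_cancel,
    M_coeff _ _ _ _ _ _ (by omega : k ≤ k + 1), jacobi_coeff_eq_zero 0 k (by omega)]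
  push_cast
  ring

lemma Mω_zero (n : ℕ) (αL αR βL βR : ℝ) : Mω n αL αR βL βR 0 = M n αL αR βL βR := by
  simp [Mω]

/-- The nodes and weights from a polynomial `M_{ω,n}` that is orthogonal to all polynomials of
degree less than `d`. -/
lemma sum_weightM (k d : ℕ) (αL αR βL βR ω : ℝ) {I : Set ℝ}
    (hr : HasRootsIn (Mω (k + 1) αL αR βL βR ω) (k + 1) I)
    (horth : ∀ p : ℝ[X], p.degree < d →
      knotInteg αL βL αR βR (Mω (k + 1) αL αR βL βR ω * p) = 0) {f : ℝ[X]} (hkd : k ≤ d)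
    (hf : f.degree < (k + 1 + d : ℕ)) :
    ((Mω (k + 1) αL αR βL βR ω).roots.map fun x =>
      weightM (k + 1) αL αR βL βR (Mω (k + 1) αL αR βL βR ω) x * f.eval x).sum =
    knotInteg αL βL αR βR f := by
  set m := Mω (k + 1) αL αR βL βR ω with hm
  have hco := coeff_ne_zero_of_card_roots (natDegree_Mω_le k αL αR βL βR ω) hr.1
  have hH : H (k + 1) αL αR βL βR ≠ 0 := by rw [Mω_coeff] at hco; exact left_ne_zero_of_mul hco
  have hg := gauss_rule (knotInteg αL βL αR βR)
    (W := 1) (m := m) (q := M k αL αR βL βR) (f := f) (k := k) (d := d)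
    (J := jacobiMoment 0 k * H (k + 1) αL αR βL βR) (natDegree_Mω_le k αL αR βL βR ω) hr.1 hr.2.1
    (natDegree_M_le _ _ _ _ _) (by simp) (by simp) horth
    (fun p hp => by
      rw [one_mul]; exact horth p (hp.trans_le (by exact_mod_cast hkd)))
    (fun p hp => by rw [one_mul, knotInteg_M_mul _ _ _ _ _ hp]; ring)
    (by rw [Mω_coeff, H_mul_moment]; push_cast; positivity) hf
  rw [← hg, Mω_coeff, H_mul_moment]
  refine congrArg Multiset.sum (Multiset.map_congr rfl fun x _ => ?_)
  simp only [weightM, Nat.add_sub_cancel, eval_one, div_div, mul_one, mul_assoc]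

/-- The rule of a single middle subinterval. With one node more than on the other subintervals,
every `ω` is possible. -/
lemma sum_weightM_Mω (k : ℕ) (αL αR βL βR ω : ℝ) {I : Set ℝ}
    (hr : HasRootsIn (Mω (k + 1) αL αR βL βR ω) (k + 1) I) {f : ℝ[X]} (hf : f.natDegree ≤ 2 * k) :
    ((Mω (k + 1) αL αR βL βR ω).roots.map fun x =>
      weightM (k + 1) αL αR βL βR (Mω (k + 1) αL αR βL βR ω) x * f.eval x).sum =
    knotInteg αL βL αR βR f := by
  refine sum_weightM k k αL αR βL βR ω hr (fun p hp => ?_) le_rfl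
    (degree_lt_of_natDegree_le hf (by omega))
  have hpk : p.natDegree ≤ k := natDegree_le_of_degree_le hp.le
  have e : Mω (k + 1) αL αR βL βR ω * p =
      M (k + 1) αL αR βL βR * p + C ω * (M k αL αR βL βR * p) := by
    rw [Mω, Nat.add_sub_cancel]; ring
  rw [e, map_add, knotInteg_C_mul, knotInteg_M_mul _ _ _ _ _ (by omega),
    knotInteg_M_mul _ _ _ _ _ hpk, coeff_eq_zero_of_natDegree_lt (by omega),
    coeff_eq_zero_of_degree_lt hp]
  ring

/-- The rule from `M_n` is exact for the degree `2 n` if the norm of `M_n` vanishes. -/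
lemma sum_weightM_M (k : ℕ) (αL αR βL βR : ℝ) {I : Set ℝ} (hH : H (k + 2) αL αR βL βR = 0)
    (hr : HasRootsIn (M (k + 1) αL αR βL βR) (k + 1) I) {f : ℝ[X]}
    (hf : f.natDegree ≤ 2 * (k + 1)) :
    ((M (k + 1) αL αR βL βR).roots.map fun x =>
      weightM (k + 1) αL αR βL βR (M (k + 1) αL αR βL βR) x * f.eval x).sum =
    knotInteg αL βL αR βR f := by
  rw [← Mω_zero] at hr ⊢
  refine sum_weightM k (k + 2) αL αR βL βR 0 hr (fun p hp => ?_) (by omega)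
    (degree_lt_of_natDegree_le hf (by omega))
  rw [Mω_zero, knotInteg_M_mul _ _ _ _ _ (natDegree_le_of_degree_lt hp)]
  have : ((k + 1 : ℕ) : ℝ) + 1 = k + 2 := by push_cast; ring
  rw [this, hH, mul_zero]

/-- Each of the two equations at the knot between the middle subintervals says that the norm of a
polynomial `M_n` vanishes. -/
lemma middle_eq (n αL αR βL βR : ℝ) :
    mA n αL βL * βR ^ 2 + mB n αL βL * βR + mC n αL βL + mD n αL βL * αR =
      3 * H (n + 1) αL αR βL βR := by
  simp only [mA, mB, mC, mD, H, H₀]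
  ring

/-- The quadratic equation for `ω` says that `F n` vanishes at the parameters of the second
subinterval of the pair, that is, that the norm of `Q_{n-1}` vanishes there. -/
lemma IsOmega.F_eq_zero {n lam α β ω : ℝ} (h : IsOmega n lam α β ω) (hn : 0 < n) (hl : lam ≠ 0)
    (hΓ : Γω n ω α β ≠ 0) :
    F n (stepωα n ω α β / lam) (stepωβ n ω α β / lam ^ 2) = 0 := by
  have h1 := ω_quadratic n lam α β ω
  rw [show _ = (0 : ℝ) from h] at h1
  have e : 3 * (n + 1) ^ 2 * lam ^ 4 * Γω n ω α β ^ 2 *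
      F n (stepωα n ω α β / lam) (stepωβ n ω α β / lam ^ 2) = 0 := by
    rw [h1]
    simp only [F, stepωα, stepωβ]
    field_simp
    ring
  refine (mul_eq_zero.1 e).resolve_left ?_
  positivity

end C1

/-! ### Rules on single subintervals in class 0 -/

namespace C0

lemma jacobi_one_derivative_eval (n : ℕ) :
    (derivative (jacobi 1 0 n)).eval (-1) = -(n * (n + 2)) / 2 * (-1) ^ n ∧
      (derivative (jacobi 1 0 n)).eval 1 = n * (n + 2) * (n + 1) / 4 := by
  obtain ⟨⟨h1, -⟩, h4, -⟩ := jacobi_derivative_eval 1 n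
  rw [jacobi_eval_neg_one] at h1
  rw [jacobi_one_eval_one] at h4
  push_cast at h1 h4
  exact ⟨by linear_combination h1 / 2, by linear_combination h4 / 4⟩

lemma Q_coeff (n m : ℕ) (α : ℝ) (hm : n ≤ m) :
    (Q n α).coeff m = F n α * (jacobi 1 0 n).coeff m := by
  have e : Q n α = C (F n α + α * n) * jacobi 1 0 n + C α * derivative (jacobi 1 0 n) -
      C α * (X * derivative (jacobi 1 0 n)) := by
    rw [Q]; ring
  rw [e]
  simp only [coeff_add, coeff_sub, coeff_C_mul, coeff_X_mul_derivative, coeff_derivative,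
    C1.jacobi_coeff_eq_zero 1 n (show n < m + 1 by omega)]
  rcases hm.eq_or_lt with rfl | hm
  · ring
  · rw [C1.jacobi_coeff_eq_zero 1 n hm]; ring

lemma natDegree_Q_le (n : ℕ) (α : ℝ) : (Q n α).natDegree ≤ n := by
  rw [natDegree_le_iff_coeff_eq_zero]
  intro m hm
  rw [Q_coeff n m α hm.le, C1.jacobi_coeff_eq_zero 1 n hm, mul_zero]

lemma Q_eval_neg_one (n : ℕ) (α : ℝ) : (Q n α).eval (-1) = (-1) ^ n := by
  simp only [Q, eval_add, eval_sub, eval_mul, eval_C, eval_one, eval_X,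
    (jacobi_one_derivative_eval n).1, jacobi_eval_neg_one, F]
  ring

lemma Q_eval_one (n : ℕ) (α : ℝ) : (Q n α).eval 1 = (n + 1) * (1 + n * (n + 2) * α) := by
  simp only [Q, eval_add, eval_sub, eval_mul, eval_C, eval_one, eval_X, jacobi_one_eval_one, F]
  ring

/-- `Q_n` is orthogonal to all polynomials of smaller degree for the functional
`p ↦ knotInteg α 0 αR 0 ((1 - x) * p)`, which does not depend on `αR`. Its norm is proportional to
`F (n + 1)`. -/
lemma knotInteg_Q_mul (n : ℕ) (α αR : ℝ) {p : ℝ[X]} (hp : p.natDegree ≤ n) :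
    knotInteg α 0 αR 0 ((1 - X) * Q n α * p) = p.coeff n * jacobiMoment 1 n * F (n + 1) α := by
  have T0 := integ_jacobi_mul_of_le 1 n hp
  have hc : p.coeff (n + 1) = 0 := coeff_eq_zero_of_natDegree_lt (by omega)
  have T1 : integ (derivative (jacobi 1 0 n) * ((1 - X) ^ 2 * p)) =
        -4 * (-1) ^ n * p.eval (-1) + (n + 2) * (p.coeff n * jacobiMoment 1 n) := by
    have e : jacobi 1 0 n * derivative ((1 - X) ^ 2 * p) =
        (1 - X) ^ 1 * jacobi 1 0 n * (C (-2) * p + derivative p - X * derivative p) := by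
      simp [derivative_mul, derivative_pow, C_ofNat]
      ring
    have hd : (C (-2) * p + derivative p - X * derivative p).natDegree ≤ n := by
      rw [natDegree_le_iff_coeff_eq_zero]
      intro m hm
      simp only [coeff_add, coeff_sub, coeff_C_mul, coeff_X_mul_derivative, coeff_derivative]
      rw [coeff_eq_zero_of_natDegree_lt (show p.natDegree < m by omega),
        coeff_eq_zero_of_natDegree_lt (show p.natDegree < m + 1 by omega)]
      ring
    rw [integ_derivative_mul, e, integ_jacobi_mul_of_le 1 n hd]
    simp only [coeff_add, coeff_sub, coeff_C_mul, coeff_X_mul_derivative, coeff_derivative, hc,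
      eval_mul, eval_pow, eval_sub, eval_one, eval_X, jacobi_eval_neg_one]
    ring
  have e : (1 - X) * Q n α * p = C (F n α + α * n) * ((1 - X) ^ 1 * jacobi 1 0 n * p) +
      C α * (derivative (jacobi 1 0 n) * ((1 - X) ^ 2 * p)) := by
    rw [Q]; ring
  have ei : integ ((1 - X) * Q n α * p) = _ := congrArg integ e
  rw [map_add, integ_C_mul, integ_C_mul, T0, T1] at ei
  rw [knotInteg_apply, ei]
  simp only [eval_sub, eval_mul, eval_one, eval_X, Q_eval_neg_one, F]
  ring

lemma knotInteg_Q (n : ℕ) (α αR : ℝ) : knotInteg α 0 αR 0 (Q n α) =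
    2 / (n + 1) * (1 + α * (n + 1) ^ 2) + 2 * αR * (n + 1) * (1 + n * (n + 2) * α) := by
  have i1 := integ_derivative_mul (jacobi 1 0 n) (1 - X)
  have e1 : jacobi 1 0 n * derivative (1 - X : ℝ[X]) = C (-1) * jacobi 1 0 n := by simp
  rw [e1, integ_C_mul] at i1
  simp only [eval_sub, eval_one, eval_X, integ_jacobi_one, jacobi_eval_neg_one] at i1
  have e : Q n α = C (F n α + α * n) * jacobi 1 0 n +
      C α * (derivative (jacobi 1 0 n) * (1 - X)) := by
    rw [Q]; ring
  have ei : integ (Q n α) = _ := congrArg integ e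
  rw [map_add, integ_C_mul, integ_C_mul, i1, integ_jacobi_one] at ei
  rw [knotInteg_apply, ei, Q_eval_neg_one, Q_eval_one, F]
  field_simp
  ring

/-- The step map yields the correction at the right end for which `Q_n` is orthogonal to `1`. -/
lemma knotInteg_Q_step (n : ℕ) (α : ℝ) (h : (Q n α).eval 1 ≠ 0) :
    knotInteg α 0 (-step n α) 0 (Q n α) = 0 := by
  rw [knotInteg_Q]
  rw [Q_eval_one] at h
  have h1 := right_ne_zero_of_mul h
  rw [step]
  generalize 1 + (n : ℝ) * (n + 2) * α = E at h1 ⊢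
  field_simp
  ring

lemma Qω_eval_one (n : ℕ) (α ω : ℝ) : (Qω (n + 1) α ω).eval 1 = Γω (n + 1) ω α := by
  rw [Qω, eval_add, eval_mul, eval_C, Nat.add_sub_cancel, Q_eval_one, Q_eval_one]
  push_cast
  simp only [Γω]
  ring

lemma knotInteg_Qω_step (n : ℕ) (α ω : ℝ) (h : (Qω (n + 1) α ω).eval 1 ≠ 0) :
    knotInteg α 0 (-stepω (n + 1 : ℕ) ω α) 0 (Qω (n + 1) α ω) = 0 := by
  rw [Qω_eval_one] at h
  have h2 : 2 * ((n + 2 : ℝ) * (1 + (n + 1) * (n + 3) * α) + ω * ((n + 1) * (1 + n * (n + 2) * α)))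
      * stepω (n + 1 : ℕ) ω α = 2 * ((n + 1) * (1 + (n + 2) ^ 2 * α) +
        ω * (n + 2) * (1 + (n + 1) ^ 2 * α)) / ((n + 1) * (n + 2)) := by
    have e : (n + 2 : ℝ) * (1 + (n + 1) * (n + 3) * α) + ω * ((n + 1) * (1 + n * (n + 2) * α)) =
        Γω (n + 1) ω α := by
      rw [Γω]; ring
    rw [e, stepω]
    push_cast
    have : (n + 1 + 1 : ℝ) ≠ 0 := by positivity
    have : (n + 2 : ℝ) ≠ 0 := by positivity
    field_simp
    ring
  rw [Qω, Nat.add_sub_cancel, map_add, knotInteg_C_mul, knotInteg_Q, knotInteg_Q]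
  push_cast
  have h3 : 2 / (n + 1 + 1 : ℝ) * (1 + α * (n + 1 + 1) ^ 2) +
      ω * (2 / (n + 1) * (1 + α * (n + 1) ^ 2)) = 2 * ((n + 1) * (1 + (n + 2) ^ 2 * α) +
        ω * (n + 2) * (1 + (n + 1) ^ 2 * α)) / ((n + 1) * (n + 2)) := by
    have : (n + 1 + 1 : ℝ) ≠ 0 := by positivity
    have : (n + 2 : ℝ) ≠ 0 := by positivity
    field_simp
    ring
  push_cast at h2
  linear_combination h3 - h2

lemma natDegree_Qω_le (k : ℕ) (α ω : ℝ) : (Qω (k + 1) α ω).natDegree ≤ k + 1 :=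
  natDegree_add_le_of_degree_le (natDegree_Q_le _ _)
    ((natDegree_C_mul_le _ _).trans ((natDegree_Q_le _ _).trans (by omega)))

lemma Qω_coeff (k : ℕ) (α ω : ℝ) : (Qω (k + 1) α ω).coeff (k + 1) =
    F (k + 1) α * (jacobi 1 0 (k + 1)).coeff (k + 1) := by
  rw [Qω, coeff_add, coeff_C_mul, Q_coeff _ _ _ le_rfl, Nat.add_sub_cancel,
    Q_coeff _ _ _ (by omega : k ≤ k + 1), C1.jacobi_coeff_eq_zero 1 k (by omega)]
  push_cast
  ring

/-- The product of leading coefficient and norm in the weights. -/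
lemma F_mul_moment (k : ℕ) (α : ℝ) :
    F (k + 1) α * (jacobi 1 0 (k + 1)).coeff (k + 1) * (jacobiMoment 1 k * F (k + 1) α) =
      2 * (2 * (k + 1 : ℕ) + 1) * F (k + 1 : ℕ) α ^ 2 / ((k + 1 : ℕ) * ((k + 1 : ℕ) + 1)) := by
  have h := jacobi_one_leading_mul_moment k
  push_cast
  rw [eq_div_iff (by positivity)]
  rw [eq_div_iff (by positivity)] at h
  linear_combination F (k + 1) α ^ 2 * h

lemma knotInteg_Qω_mul (k : ℕ) (α αR ω : ℝ) {p : ℝ[X]} (hp : p.degree < k) :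
    knotInteg α 0 αR 0 ((1 - X) * Qω (k + 1) α ω * p) = 0 := by
  have hpk : p.natDegree ≤ k := natDegree_le_of_degree_le hp.le
  have e : (1 - X) * Qω (k + 1) α ω * p =
      (1 - X) * Q (k + 1) α * p + C ω * ((1 - X) * Q k α * p) := by
    rw [Qω, Nat.add_sub_cancel]; ring
  rw [e, map_add, knotInteg_C_mul, knotInteg_Q_mul _ _ _ (by omega),
    knotInteg_Q_mul _ _ _ hpk, coeff_eq_zero_of_natDegree_lt (by omega),
    coeff_eq_zero_of_degree_lt hp]
  ring

/-- `Q_{ω,n}` is orthogonal to all polynomials of smaller degree for the corrected integral. -/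
lemma knotInteg_Qω_orth (k : ℕ) (α ω : ℝ) (h : (Qω (k + 1) α ω).eval 1 ≠ 0) {p : ℝ[X]}
    (hp : p.degree < (k + 1 : ℕ)) :
    knotInteg α 0 (-stepω (k + 1 : ℕ) ω α) 0 (Qω (k + 1) α ω * p) = 0 :=
  orth_of_one_sub_X _ (knotInteg_Qω_step k α ω h) (fun _ hp => knotInteg_Qω_mul k α _ ω hp) hp

/-- The nodes and weights from `Q_{ω,n}` integrate polynomials of degree `2 n - 1` exactly, up to
the corrections at the two ends. -/
lemma sum_weightQ_Qω (k : ℕ) (α ω : ℝ)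
    (hr : HasRootsIn (Qω (k + 1) α ω) (k + 1) (Set.Ico (-1) 1)) {f : ℝ[X]}
    (hf : f.natDegree ≤ 2 * k + 1) :
    ((Qω (k + 1) α ω).roots.map fun x =>
      weightQ (k + 1) α (Qω (k + 1) α ω) x * f.eval x).sum =
    knotInteg α 0 (-stepω (k + 1 : ℕ) ω α) 0 f := by
  have hco := coeff_ne_zero_of_card_roots (natDegree_Qω_le k α ω) hr.1
  have hm0 : Qω (k + 1) α ω ≠ 0 := fun h => by rw [h] at hco; simp at hco
  have hF : F (k + 1) α ≠ 0 := by rw [Qω_coeff] at hco; exact left_ne_zero_of_mul hco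
  have hg := gauss_rule (knotInteg α 0 (-stepω (k + 1 : ℕ) ω α) 0)
    (W := 1 - X) (m := Qω (k + 1) α ω) (q := Q k α) (f := f) (k := k) (d := k + 1)
    (J := jacobiMoment 1 k * F (k + 1) α) (natDegree_Qω_le k α ω) hr.1 hr.2.1
    (natDegree_Q_le _ _)
    (by have := natDegree_one_sub_X_pow_le 1; rw [pow_one] at this; omega)
    (fun x hx => by
      have := (hr.2.2 x hx).2
      simp only [eval_sub, eval_one, eval_X]
      linarith)
    (fun p hp => knotInteg_Qω_orth k α ω (eval_one_ne_zero_of_hasRootsIn hr hm0) hp)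
    (fun p hp => knotInteg_Qω_mul k α _ ω hp)
    (fun p hp => by rw [knotInteg_Q_mul _ _ _ hp]; ring)
    (by rw [Qω_coeff, F_mul_moment]; push_cast; positivity)
    (degree_lt_of_natDegree_le hf (by omega))
  rw [← hg, Qω_coeff, F_mul_moment]
  refine congrArg Multiset.sum (Multiset.map_congr rfl fun x _ => ?_)
  simp only [weightQ, Nat.add_sub_cancel, eval_sub, eval_one, eval_X, div_div, mul_assoc]

lemma Q_zero (α : ℝ) : Q 0 α = 1 := by
  simp [Q, jacobi, F]

/-- If the norm of `Q_n` vanishes, then `Q_n` is orthogonal to all polynomials of degree at most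
`n + 1`. -/
lemma knotInteg_Q_orth (k : ℕ) (α : ℝ) (hF : F (k + 1) α = 0) (h : (Q k α).eval 1 ≠ 0) {p : ℝ[X]}
    (hp : p.degree < (k + 2 : ℕ)) : knotInteg α 0 (-step k α) 0 (Q k α * p) = 0 :=
  orth_of_one_sub_X _ (knotInteg_Q_step k α h) (fun p hp => by
    rw [knotInteg_Q_mul _ _ _ (natDegree_le_of_degree_lt hp), hF, mul_zero]) hp

/-- The nodes and weights from `Q_n` integrate polynomials of degree `2 n + 1` exactly, up to the
corrections at the two ends, if the norm of `Q_n` vanishes. -/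
lemma sum_weightQ_Q (k : ℕ) (α : ℝ) (hF : F (k + 1) α = 0)
    (hr : HasRootsIn (Q k α) k (Set.Ico (-1) 1)) {f : ℝ[X]} (hf : f.natDegree ≤ 2 * k + 1) :
    ((Q k α).roots.map fun x => weightQ k α (Q k α) x * f.eval x).sum =
      knotInteg α 0 (-step k α) 0 f := by
  have hm0 : Q k α ≠ 0 := by
    rcases k with _ | k
    · rw [Q_zero]; exact one_ne_zero
    · exact fun h => coeff_ne_zero_of_card_roots (natDegree_Q_le _ _) hr.1 (by rw [h, coeff_zero])
  have horth := fun p hp =>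
    knotInteg_Q_orth k α hF (eval_one_ne_zero_of_hasRootsIn hr hm0) (p := p) hp
  rcases k with _ | k
  · rw [Q_zero] at horth ⊢
    have := horth f (degree_lt_of_natDegree_le hf (by omega))
    rw [one_mul] at this
    simp at this ⊢
    exact this.symm
  have hco := coeff_ne_zero_of_card_roots (natDegree_Q_le _ _) hr.1
  have hF' : F (k + 1) α ≠ 0 := by
    rw [Q_coeff _ _ _ le_rfl] at hco
    exact_mod_cast left_ne_zero_of_mul hco
  have hcoe : (Q (k + 1) α).coeff (k + 1) =
      F (k + 1) α * (jacobi 1 0 (k + 1)).coeff (k + 1) := by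
    rw [Q_coeff _ _ _ le_rfl]; push_cast; rfl
  have hg := gauss_rule (knotInteg α 0 (-step (k + 1 : ℕ) α) 0) (W := 1 - X) (m := Q (k + 1) α)
    (q := Q k α) (f := f) (k := k) (d := k + 1 + 2) (J := jacobiMoment 1 k * F (k + 1) α)
    (natDegree_Q_le _ _) hr.1 hr.2.1 (natDegree_Q_le _ _)
    (by have := natDegree_one_sub_X_pow_le 1; rw [pow_one] at this; omega)
    (fun x hx => by
      have := (hr.2.2 x hx).2
      simp only [eval_sub, eval_one, eval_X]
      linarith)
    horth (fun p hp => by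
      rw [knotInteg_Q_mul _ _ _
        (natDegree_le_of_degree_le (hp.le.trans (by exact_mod_cast Nat.le_succ k))), hF, mul_zero])
    (fun p hp => by rw [knotInteg_Q_mul _ _ _ hp]; ring)
    (by rw [hcoe, F_mul_moment]; push_cast; positivity)
    (degree_lt_of_natDegree_le hf (by omega))
  rw [← hg, hcoe, F_mul_moment]
  refine congrArg Multiset.sum (Multiset.map_congr rfl fun x _ => ?_)
  simp only [weightQ, Nat.add_sub_cancel, eval_sub, eval_one, eval_X, div_div, mul_assoc]

lemma H_eq (n αL αR : ℝ) : H n αL αR = C1.H n αL αR 0 0 := by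
  simp only [H, C1.H, C1.H₀]
  ring

/-- The middle polynomials of class 0 are those of class 1 without corrections by derivatives. -/
lemma M_eq (n : ℕ) (αL αR : ℝ) : M n αL αR = C1.M n αL αR 0 0 := by
  have h1 : H n αL αR + n * H₁ n αL αR = 1 / 2 * (C1.H₃ n αL 0 * C1.H₀ (n + 1) αR 0 +
      C1.H₃ n αR 0 * C1.H₀ (n + 1) αL 0) := by
    simp only [H, H₁, C1.H₃, C1.H₀, C1.H₂]; ring
  have h2 : αL * H₂ n αR = C1.H₁ n αL 0 * C1.H₀ (n + 1) αR 0 := by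
    simp only [H₂, C1.H₁, C1.H₀]; ring
  have h3 : αR * H₂ n αL = C1.H₁ n αR 0 * C1.H₀ (n + 1) αL 0 := by
    simp only [H₂, C1.H₁, C1.H₀]; ring
  rw [M, C1.M, h1, h2, h3]
  simp [C1.H₂]

lemma natDegree_M_le (n : ℕ) (αL αR : ℝ) : (M n αL αR).natDegree ≤ n := by
  rw [M_eq]; exact C1.natDegree_M_le _ _ _ _ _

lemma knotInteg_M_orth (n : ℕ) (αL αR : ℝ) {p : ℝ[X]} (hp : p.degree < n) :
    knotInteg αL 0 αR 0 (M n αL αR * p) = 0 := by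
  rw [M_eq, C1.knotInteg_M_mul _ _ _ _ _ (natDegree_le_of_degree_le hp.le),
    coeff_eq_zero_of_degree_lt hp]
  ring

lemma sum_weightM (k : ℕ) (αL αR : ℝ) {I : Set ℝ} (hr : HasRootsIn (M (k + 1) αL αR) (k + 1) I)
    {f : ℝ[X]} (hf : f.natDegree ≤ 2 * k + 1) :
    ((M (k + 1) αL αR).roots.map fun x => weightM (k + 1 : ℕ) αL αR x * f.eval x).sum =
    knotInteg αL 0 αR 0 f := by
  have hw : ∀ x, weightM (k + 1) αL αR x = C1.weightM (k + 1) αL αR 0 0 (M (k + 1) αL αR) x := by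
    intro x
    rw [weightM, C1.weightM, H_eq, M_eq, M_eq]
  simp only [hw]
  have hM : M (k + 1) αL αR = C1.Mω (k + 1) αL αR 0 0 0 := by rw [M_eq, C1.Mω_zero]
  have horth := fun p hp => knotInteg_M_orth (k + 1) αL αR (p := p) hp
  rw [hM] at hr horth ⊢
  exact C1.sum_weightM k (k + 1) αL αR 0 0 0 hr horth (by omega)
    (degree_lt_of_natDegree_le hf (by omega))

/-- The value of `ω` is such that, whatever `α` and the lengths are, division by the stretching
factor yields the parameter `-1 / (n * (n + 1))` on the second subinterval, the zero of `F n`. -/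
lemma omega_spec {n lam α : ℝ} (hn : 1 ≤ n) (hl : 0 < lam) (hα : 0 ≤ α) :
    0 < Γω n (omega n lam α) α ∧ stepω n (omega n lam α) α = -lam / (n * (n + 1)) := by
  have hn1 : 0 ≤ (n - 1) * (n + 1) := by nlinarith
  have hD : 0 < (n + 1) * (1 + n ^ 2 * α) + lam * n * (1 + (n - 1) * (n + 1) * α) := by positivity
  have hω : omega n lam α * ((n + 1) * (1 + n ^ 2 * α) + lam * n * (1 + (n - 1) * (n + 1) * α)) =
      -(n * (1 + (n + 1) ^ 2 * α) + lam * (n + 1) * (1 + n * (n + 2) * α)) :=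
    div_mul_cancel₀ _ hD.ne'
  have h1 : Γω n (omega n lam α) α *
      ((n + 1) * (1 + n ^ 2 * α) + lam * n * (1 + (n - 1) * (n + 1) * α)) =
      (2 * n + 1) * (1 + n * (n + 1) * α) ^ 2 := by
    rw [Γω]
    linear_combination n * (1 + (n - 1) * (n + 1) * α) * hω
  have hΓ : 0 < Γω n (omega n lam α) α := by
    refine pos_of_mul_pos_left ?_ hD.le
    rw [h1]
    positivity
  refine ⟨hΓ, ?_⟩
  have h2 : n * (1 + (n + 1) ^ 2 * α) + omega n lam α * (n + 1) * (1 + n ^ 2 * α) =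
      -lam * Γω n (omega n lam α) α := by
    rw [Γω]
    linear_combination hω
  rw [stepω, h2]
  field_simp

/-- The step map sends the parameter of the second subinterval of a pair to its opposite. -/
lemma step_spec {n : ℝ} (hn : 1 ≤ n) : step (n - 1) (-1 / (n * (n + 1))) = 1 / (n * (n + 1)) := by
  have h0 : n ≠ 0 := by positivity
  have h1 : n + 1 ≠ 0 := by positivity
  have e : 1 + (n - 1) * (n - 1 + 2) * (-1 / (n * (n + 1))) = 1 / n := by
    field_simp
    ring
  rw [step, e]
  field_simp
  rw [sub_add_cancel]
  field_simp
  ring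

/-- The parameters are nonnegative at the start of each pair of subintervals, and do not depend on
the lengths in the middle of a pair. -/
lemma param_nonneg {N : ℕ} (hN : 1 ≤ N) {L : ℕ → ℝ} {k : ℕ} (hL : ∀ i ≤ 2 * k, 0 < L i) :
    0 ≤ param N L k ∧ (0 < L (2 * k + 1) → param₂ N L k = -1 / (N * (N + 1))) := by
  have hN' : (1 : ℝ) ≤ N := by exact_mod_cast hN
  have h2 : ∀ k, (∀ i ≤ 2 * k + 1, 0 < L i) → 0 ≤ param N L k →
      param₂ N L k = -1 / (N * (N + 1)) := by
    intro k hL hk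
    have hl : 0 < stretch L (2 * k) := div_pos (hL _ le_rfl) (hL _ (by omega))
    rw [param₂, pairω, (omega_spec hN' hl hk).2]
    field_simp
  have h1 : 0 ≤ param N L k := by
    induction k with
    | zero => exact le_rfl
    | succ k ih =>
      have hk := ih fun i hi => hL i (by omega)
      have e : param N L (k + 1) = step ((N : ℝ) - 1) (param₂ N L k) / stretch L (2 * k + 1) := rfl
      rw [e, h2 k (fun i hi => hL i (by omega)) hk, step_spec hN']
      have hl : 0 < stretch L (2 * k + 1) := div_pos (hL _ (by omega)) (hL _ (by omega))
      positivity
  refine ⟨h1, fun h => h2 k (fun i hi => ?_) h1⟩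
  rcases hi.eq_or_lt with rfl | hi
  · exact h
  · exact hL i (by omega)

end C0

/-! ### Positive functionals and the roots of orthogonal polynomials -/

lemma pos_or_neg_of_continuousOn {g : ℝ → ℝ} {a b : ℝ} (hg : ContinuousOn g (Set.Ioo a b))
    (h0 : ∀ x ∈ Set.Ioo a b, g x ≠ 0) :
    (∀ x ∈ Set.Ioo a b, 0 < g x) ∨ ∀ x ∈ Set.Ioo a b, g x < 0 := by
  by_contra! h
  obtain ⟨⟨x, hx, hx0⟩, y, hy, hy0⟩ := h
  obtain ⟨z, hz, hz0⟩ := isPreconnected_Ioo.intermediate_value hx hy hg ⟨hx0, hy0⟩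
  exact h0 z hz hz0

/-- A function that is continuous and nonzero outside of a finite set `Z` has the signs of a
polynomial with roots in `Z`, of degree at most the number of points of `Z` in the interval. -/
lemma exists_sign_polynomial {h : ℝ → ℝ} {a : ℝ} (Z : Finset ℝ) (b : ℝ)
    (hc : ContinuousOn h (Set.Ioo a b \ Z)) (h0 : ∀ x ∈ Set.Ioo a b \ Z, h x ≠ 0) :
    ∃ p : ℝ[X], p.natDegree ≤ (Z.filter (· ∈ Set.Ioo a b)).card ∧
      (∀ x ∈ Set.Ioo a b \ Z, 0 < p.eval x * h x) ∧ ∀ x ∉ Z, p.eval x ≠ 0 := by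
  induction hn : (Z.filter (· ∈ Set.Ioo a b)).card using Nat.strong_induction_on generalizing b with
  | _ n ih =>
  rcases (Z.filter (· ∈ Set.Ioo a b)).eq_empty_or_nonempty with hE | hE
  · have hd : Set.Ioo a b \ (Z : Set ℝ) = Set.Ioo a b := by
      ext x
      simp only [Set.mem_sdiff, Finset.mem_coe, and_iff_left_iff_imp]
      exact fun hx hxZ => Finset.notMem_empty x (hE ▸ Finset.mem_filter.2 ⟨hxZ, hx⟩)
    rw [hd] at hc h0 ⊢
    rcases pos_or_neg_of_continuousOn hc h0 with h1 | h1
    · exact ⟨1, by simp, by simpa using h1, by simp⟩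
    · exact ⟨-1, by simp, by simpa using h1, by simp⟩
  · set z := (Z.filter (· ∈ Set.Ioo a b)).max' hE with hz
    have hzm := Finset.max'_mem _ hE
    rw [← hz, Finset.mem_filter] at hzm
    obtain ⟨hzZ, haz, hzb⟩ := hzm
    have hsub : Set.Ioo a z ⊆ Set.Ioo a b := Set.Ioo_subset_Ioo_right hzb.le
    have hlt : (Z.filter (· ∈ Set.Ioo a z)).card < n := by
      rw [← hn]
      refine Finset.card_lt_card ((Finset.ssubset_iff_of_subset fun x hx => ?_).2
        ⟨z, Finset.mem_filter.2 ⟨hzZ, haz, hzb⟩, fun h => lt_irrefl z (Finset.mem_filter.1 h).2.2⟩)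
      exact Finset.mem_filter.2 ⟨(Finset.mem_filter.1 hx).1, hsub (Finset.mem_filter.1 hx).2⟩
    obtain ⟨p, hp1, hp2, hp3⟩ := ih _ hlt z (hc.mono (Set.sdiff_subset_sdiff_left hsub))
      (fun x hx => h0 x ⟨hsub hx.1, hx.2⟩) rfl
    have hright : ∀ x ∈ Set.Ioo z b, x ∈ Set.Ioo a b \ (Z : Set ℝ) := fun x hx =>
      ⟨⟨haz.trans hx.1, hx.2⟩, fun hxZ => not_le.2 hx.1
        (Finset.le_max' _ x (Finset.mem_filter.2 ⟨hxZ, haz.trans hx.1, hx.2⟩))⟩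
    have hcase : ∀ x ∈ Set.Ioo a b \ (Z : Set ℝ), x ∈ Set.Ioo a z \ (Z : Set ℝ) ∨
        x ∈ Set.Ioo z b := by
      intro x hx
      rcases lt_trichotomy x z with h | h | h
      · exact Or.inl ⟨⟨hx.1.1, h⟩, hx.2⟩
      · exact absurd (h ▸ hzZ) hx.2
      · exact Or.inr ⟨h, hx.1.2⟩
    rcases pos_or_neg_of_continuousOn (g := fun x => p.eval x * h x)
      (p.continuous.continuousOn.mul (hc.mono hright))
      (fun x hx => mul_ne_zero (hp3 x (hright x hx).2) (h0 x (hright x hx))) with h1 | h1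
    · refine ⟨p, by omega, fun x hx => ?_, hp3⟩
      rcases hcase x hx with hx | hx
      · exact hp2 x hx
      · exact h1 x hx
    · refine ⟨(C z - X) * p, ?_, fun x hx => ?_, fun x hx => ?_⟩
      · refine natDegree_mul_le.trans ?_
        have : (C z - X : ℝ[X]).natDegree ≤ 1 := by compute_degree
        omega
      · simp only [eval_mul, eval_sub, eval_C, eval_X, mul_assoc]
        rcases hcase x hx with hx | hx
        · exact mul_pos (by linarith [hx.1.2]) (hp2 x hx)
        · exact mul_pos_of_neg_of_neg (by linarith [hx.1]) (h1 x hx)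
      · simp only [eval_mul, eval_sub, eval_C, eval_X]
        exact mul_ne_zero (fun h => hx (by rw [← sub_eq_zero.1 h]; exact hzZ)) (hp3 x hx)

lemma HasRootsIn.mono {p : ℝ[X]} {n : ℕ} {I J : Set ℝ} (h : HasRootsIn p n I) (hIJ : I ⊆ J) :
    HasRootsIn p n J := ⟨h.1, h.2.1, fun x hx => hIJ (h.2.2 x hx)⟩

/-- An orthogonal polynomial for a positive functional has simple roots, all in `(-1, 1)`. -/
lemma hasRootsIn_of_orthogonal (Λ : ℝ[X] →ₗ[ℝ] ℝ) {m : ℝ[X]} {n : ℕ} (hm : m.natDegree ≤ n)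
    (hm0 : m ≠ 0) (horth : ∀ p : ℝ[X], p.degree < n → Λ (m * p) = 0)
    (hpos : ∀ p : ℝ[X], p ≠ 0 → p.natDegree ≤ 2 * n → (∀ x ∈ Set.Icc (-1 : ℝ) 1, 0 ≤ p.eval x) →
      0 < Λ p) : HasRootsIn m n (Set.Ioo (-1) 1) := by
  classical
  set Z := m.roots.toFinset with hZ
  have hmem : ∀ x, x ∈ Z ↔ m.eval x = 0 := fun x => by
    rw [hZ, Multiset.mem_toFinset, mem_roots hm0, IsRoot.def]
  obtain ⟨p, hp1, hp2, hp3⟩ := exists_sign_polynomial (h := fun x => m.eval x) (a := -1) Z 1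
    m.continuous.continuousOn (fun x hx h => hx.2 ((hmem x).2 h))
  have hcard : n ≤ (Z.filter (· ∈ Set.Ioo (-1 : ℝ) 1)).card := by
    by_contra! hlt
    have hp0 : p ≠ 0 := by
      obtain ⟨x, hx⟩ := Z.exists_notMem
      exact fun h => hp3 x hx (by rw [h, eval_zero])
    have h1 : ∀ x ∈ Set.Ioo (-1 : ℝ) 1, 0 ≤ (m * p).eval x := by
      intro x hx
      rw [eval_mul, mul_comm]
      by_cases hxZ : x ∈ Z
      · rw [(hmem x).1 hxZ, mul_zero]
      · exact (hp2 x ⟨hx, hxZ⟩).le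
    have h2 : ∀ x ∈ Set.Icc (-1 : ℝ) 1, 0 ≤ (m * p).eval x := by
      rw [← closure_Ioo (by norm_num : (-1 : ℝ) ≠ 1)]
      exact fun x hx => closure_minimal h1 (isClosed_le continuous_const (m * p).continuous) hx
    exact (hpos (m * p) (mul_ne_zero hm0 hp0) (natDegree_mul_le.trans (by omega)) h2).ne'
      (horth p (degree_lt_of_natDegree_le hp1 hlt))
  have h1 := Finset.card_filter_le Z (· ∈ Set.Ioo (-1 : ℝ) 1)
  have h2 : Z.card ≤ Multiset.card m.roots := Multiset.toFinset_card_le _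
  have h3 : Multiset.card m.roots ≤ m.natDegree := card_roots' m
  refine ⟨by omega, Multiset.toFinset_card_eq_card_iff_nodup.1 (by rw [← hZ]; omega),
    fun x hx => ?_⟩
  have h4 : Z.filter (· ∈ Set.Ioo (-1 : ℝ) 1) = Z :=
    Finset.eq_of_subset_of_card_le (Finset.filter_subset _ _) (by omega)
  have hx' : x ∈ Z := Multiset.mem_toFinset.2 hx
  rw [← h4] at hx'
  exact (Finset.mem_filter.1 hx').2

/-- Nonnegative polynomials of bounded degree are bounded at `1` by a multiple of their integral:
the value at `1` is an integral against a multiple of `P_d^{(1, 0)}`. -/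
lemma exists_eval_one_le (d : ℕ) : ∃ K > 0, ∀ p : ℝ[X], p.natDegree ≤ d →
    (∀ x ∈ Set.Icc (-1 : ℝ) 1, 0 ≤ p.eval x) → p.eval 1 ≤ K * integ p := by
  obtain ⟨B, hB⟩ := isCompact_Icc.exists_bound_of_continuousOn (s := Set.Icc (-1 : ℝ) 1)
    (f := fun x => (jacobi 1 0 d).eval x) (jacobi 1 0 d).continuous.continuousOn
  have hB0 : 0 ≤ B := (norm_nonneg _).trans (hB 1 ⟨by norm_num, le_rfl⟩)
  refine ⟨(B + 1) * ((d + 1) / 2), by positivity, fun p hp h => ?_⟩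
  have h1 := integ_jacobi_succ_mul 0 d hp
  rw [pow_zero, one_mul, zero_add, integ_jacobi_one] at h1
  have h2 : 0 ≤ integ ((C (B + 1) - jacobi 1 0 d) * p) := by
    refine intervalIntegral.integral_nonneg (by norm_num) fun x hx => ?_
    have := hB x hx
    rw [Real.norm_eq_abs, abs_le] at this
    rw [eval_mul, eval_sub, eval_C]
    exact mul_nonneg (by linarith) (h x hx)
  rw [sub_mul, map_sub, integ_C_mul, h1, mul_div_assoc', sub_nonneg,
    div_le_iff₀ (by positivity)] at h2
  linarith

lemma integ_comp_neg_X (p : ℝ[X]) : integ (p.comp (-X)) = integ p := by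
  simp only [integ_apply, eval_comp, eval_neg, eval_X]
  rw [intervalIntegral.integral_comp_neg (fun x => p.eval x), neg_neg]

lemma exists_eval_ends_le (d : ℕ) : ∃ K > 0, ∀ p : ℝ[X], p.natDegree ≤ d →
    (∀ x ∈ Set.Icc (-1 : ℝ) 1, 0 ≤ p.eval x) → p.eval 1 ≤ K * integ p ∧
      p.eval (-1) ≤ K * integ p := by
  obtain ⟨K, hK, h⟩ := exists_eval_one_le d
  refine ⟨K, hK, fun p hp hp0 => ⟨h p hp hp0, ?_⟩⟩
  have := h (p.comp (-X)) (by rw [natDegree_comp]; simpa using hp) (fun x hx => by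
    rw [eval_comp, eval_neg, eval_X]
    exact hp0 _ ⟨by linarith [hx.2], by linarith [hx.1]⟩)
  rwa [integ_comp_neg_X, eval_comp, eval_neg, eval_X] at this

namespace C0

lemma knotInteg_pos {a b : ℝ} (ha : 0 ≤ a) (hb : 0 ≤ b) {p : ℝ[X]} (hp : p ≠ 0)
    (h : ∀ x ∈ Set.Icc (-1 : ℝ) 1, 0 ≤ p.eval x) : 0 < knotInteg a 0 b 0 p := by
  have h1 := integ_pos hp h
  have h2 := h 1 ⟨by norm_num, le_rfl⟩
  have h3 := h (-1) ⟨le_rfl, by norm_num⟩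
  rw [knotInteg_apply]
  have : 0 ≤ 2 * a * p.eval (-1) + 2 * b * p.eval 1 := by positivity
  linarith

lemma M_ne_zero {n : ℕ} {a b : ℝ} (h : H n a b ≠ 0) : M n a b ≠ 0 := by
  intro h0
  have := C1.M_coeff n n a b 0 0 le_rfl
  rw [← M_eq, h0, coeff_zero, ← H_eq] at this
  exact (mul_ne_zero h (jacobi_coeff_pos 0 0 n).ne') this.symm

lemma hasRootsIn_M {n : ℕ} {a b : ℝ} (ha : 0 ≤ a) (hb : 0 ≤ b) (hn : 1 ≤ n) :
    HasRootsIn (M n a b) n (Set.Ioo (-1) 1) := by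
  have hn' : (1 : ℝ) ≤ n := by exact_mod_cast hn
  refine hasRootsIn_of_orthogonal (knotInteg a 0 b 0) (natDegree_M_le _ _ _) (M_ne_zero ?_)
    (fun p hp => knotInteg_M_orth n a b hp) (fun p hp _ h => knotInteg_pos ha hb hp h)
  have : 0 ≤ (n - 1 : ℝ) := by linarith
  rw [H]
  positivity

/-- The roots of `Q_{ω,N}` are those of an orthogonal polynomial for a positive functional. The
functional for `Q_{N-1}` has negative parameters at both ends and need not be positive; but the norm
of `Q_{N-1}` vanishes, so there is room for the factor `1 - x ^ 2`, which removes the corrections.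
-/
lemma sideOK {N : ℕ} (hN : 1 ≤ N) {L : ℕ → ℝ} {m : ℕ} (hL : ∀ i ≤ 2 * m, 0 < L i) :
    SideOK N m L := by
  obtain ⟨n, rfl⟩ : ∃ n, N = n + 1 := ⟨N - 1, by omega⟩
  intro k hk
  obtain ⟨h1, h2⟩ := param_nonneg hN (L := L) (k := k) fun i hi => hL i (by omega)
  replace h2 := h2 (hL _ (by omega))
  have hl : 0 < stretch L (2 * k) := div_pos (hL _ (by omega)) (hL _ (by omega))
  obtain ⟨g1, g2⟩ := omega_spec (n := (n + 1 : ℕ)) (by simp) hl h1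
  constructor
  · have hne : (poly₁ (n + 1) L k).eval 1 ≠ 0 := by
      rw [poly₁, Qω_eval_one, pairω]
      have := g1.ne'
      push_cast at this ⊢
      exact this
    refine HasRootsIn.mono (hasRootsIn_of_orthogonal
      (knotInteg (param (n + 1) L k) 0 (-stepω (n + 1 : ℕ) (pairω (n + 1) L k)
        (param (n + 1) L k)) 0) (natDegree_Qω_le _ _ _) (fun h => hne (by rw [h, eval_zero]))
      (fun p hp => knotInteg_Qω_orth n _ _ hne hp)
      (fun p hp _ h => knotInteg_pos h1 ?_ hp h)) Set.Ioo_subset_Ico_self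
    rw [pairω, g2, neg_div, neg_neg]
    positivity
  · have hev : (poly₂ (n + 1) L k).eval 1 ≠ 0 := by
      rw [poly₂, Q_eval_one, Nat.add_sub_cancel, h2]
      have e : 1 + (n : ℝ) * (n + 2) * (-1 / ((n + 1 : ℕ) * ((n + 1 : ℕ) + 1))) = 1 / (n + 1) := by
        have : (n + 1 + 1 : ℝ) ≠ 0 := by positivity
        push_cast
        field_simp
        ring
      rw [e]
      positivity
    have hF : F (n + 1) (param₂ (n + 1) L k) = 0 := by
      rw [F, h2]
      have : (n + 1 + 1 : ℝ) ≠ 0 := by positivity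
      push_cast
      field_simp
      ring
    have hs : -step n (param₂ (n + 1) L k) = param₂ (n + 1) L k := by
      have := step_spec (n := (n + 1 : ℕ)) (by simp)
      rw [h2]
      push_cast at this ⊢
      rw [add_sub_cancel_right] at this
      rw [this]
      ring
    have horth := fun p hp => knotInteg_Q_orth n (param₂ (n + 1) L k) hF hev (p := p) hp
    refine HasRootsIn.mono (hasRootsIn_of_orthogonal
      (integ ∘ₗ LinearMap.mulLeft ℝ (1 - X ^ 2 : ℝ[X])) (natDegree_Q_le _ _)
      (fun h => hev (by rw [show poly₂ (n + 1) L k = 0 from h, eval_zero])) (fun p hp => ?_)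
      (fun p hp _ h => ?_))
      Set.Ioo_subset_Ico_self
    · have h3 := horth ((1 - X ^ 2) * p) ?_
      · rw [knotInteg_apply] at h3
        simp only [LinearMap.comp_apply, LinearMap.mulLeft_apply]
        rw [mul_left_comm]
        simp at h3
        exact h3
      · rw [Nat.add_sub_cancel] at hp
        have hx : (1 - X ^ 2 : ℝ[X]).degree ≤ 2 := by compute_degree
        rcases eq_or_ne p 0 with rfl | hp0
        · rw [mul_zero, degree_zero]; exact WithBot.bot_lt_coe _
        · rw [degree_eq_natDegree hp0] at hp
          have h4 : p.natDegree < n := by exact_mod_cast hp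
          refine degree_lt_of_natDegree_le (n := n + 1) ?_ (by omega)
          have h5 : (1 - X ^ 2 : ℝ[X]).natDegree ≤ 2 := natDegree_le_of_degree_le hx
          exact natDegree_mul_le.trans (by omega)
    · simp only [LinearMap.comp_apply, LinearMap.mulLeft_apply]
      refine integ_pos (mul_ne_zero (fun h => ?_) hp) fun x hx => ?_
      · simpa using congrArg (eval 0) h
      · rw [eval_mul]
        refine mul_nonneg ?_ (h x hx)
        simp only [eval_sub, eval_one, eval_pow, eval_X]
        nlinarith [hx.1, hx.2]

/-- The functional remains positive for small negative parameters at one end, so that `M_n` keeps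
its simple roots. The bound for these parameters does not depend on the parameter at the other end.
-/
lemma exists_hasRootsIn_M {n : ℕ} (hn : 1 ≤ n) : ∃ ε > 0, ∀ a ≥ 0, ∀ b : ℝ, |b| < ε →
    HasRootsIn (M n a b) n (Set.Icc (-1) 1) ∧ HasRootsIn (M n b a) n (Set.Icc (-1) 1) := by
  obtain ⟨K, hK, hKp⟩ := exists_eval_ends_le (2 * n)
  have hn' : (1 : ℝ) ≤ n := by exact_mod_cast hn
  refine ⟨min (1 / (2 * K)) (1 / n ^ 2), by positivity, fun a ha b hb => ?_⟩
  have hb1 : |b| * (2 * K) < 1 := by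
    have := hb.trans_le (min_le_left _ _)
    rwa [lt_div_iff₀ (by positivity)] at this
  have hb2 : |b| * n ^ 2 < 1 := by
    have := hb.trans_le (min_le_right _ _)
    rwa [lt_div_iff₀ (by positivity)] at this
  have hH : H n a b ≠ 0 := by
    have h1 : -1 < b * n ^ 2 := by nlinarith [neg_abs_le b]
    have h2 : 0 ≤ (n - 1 : ℝ) * (n + 1) := by nlinarith
    have h3 : 0 < (1 + b * n ^ 2) * (1 + (n - 1) * (n + 1) * a) + a := by
      have : 0 < 1 + b * n ^ 2 := by linarith
      positivity
    have h4 : H n a b = (1 + b * n ^ 2) * (1 + (n - 1) * (n + 1) * a) + a := by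
      rw [H]; ring
    rw [h4]
    exact h3.ne'
  have hpos : ∀ p : ℝ[X], p ≠ 0 → p.natDegree ≤ 2 * n →
      (∀ x ∈ Set.Icc (-1 : ℝ) 1, 0 ≤ p.eval x) →
      0 < knotInteg a 0 b 0 p ∧ 0 < knotInteg b 0 a 0 p := by
    intro p hp hd h
    have h1 := integ_pos hp h
    have h2 := h 1 ⟨by norm_num, le_rfl⟩
    have h3 := h (-1) ⟨le_rfl, by norm_num⟩
    obtain ⟨k1, k2⟩ := hKp p hd h
    have key : ∀ v : ℝ, 0 ≤ v → v ≤ K * integ p → -integ p < 2 * b * v := by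
      intro v hv hvK
      have e1 : -(|b| * v) ≤ b * v := by nlinarith [neg_abs_le b]
      have e2 : |b| * v ≤ |b| * (K * integ p) := by gcongr
      nlinarith
    rw [knotInteg_apply, knotInteg_apply]
    have j1 := key _ h2 k1
    have j2 := key _ h3 k2
    have j3 : 0 ≤ 2 * a * p.eval (-1) := by positivity
    have j4 : 0 ≤ 2 * a * p.eval 1 := by positivity
    constructor <;> linarith
  have hH' : H n b a ≠ 0 := by
    have : H n b a = H n a b := by rw [H, H]; ring
    rwa [this]
  exact ⟨(hasRootsIn_of_orthogonal (knotInteg a 0 b 0) (natDegree_M_le _ _ _) (M_ne_zero hH)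
      (fun p hp => knotInteg_M_orth n a b hp)
      (fun p hp hd h => (hpos p hp hd h).1)).mono Set.Ioo_subset_Icc_self,
    (hasRootsIn_of_orthogonal (knotInteg b 0 a 0) (natDegree_M_le _ _ _) (M_ne_zero hH')
      (fun p hp => knotInteg_M_orth n b a hp)
      (fun p hp hd h => (hpos p hp hd h).2)).mono Set.Ioo_subset_Icc_self⟩

end C0

/-! ### The Peano kernel of a rule -/

lemma exists_derivative_eq (p : ℝ[X]) :
    ∃ P : ℝ[X], derivative P = p ∧ P.natDegree ≤ p.natDegree + 1 := by
  refine ⟨∑ i ∈ Finset.range (p.natDegree + 1), C (p.coeff i / (i + 1)) * X ^ (i + 1), ?_, ?_⟩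
  · conv_rhs => rw [p.as_sum_range_C_mul_X_pow]
    rw [derivative_sum]
    refine Finset.sum_congr rfl fun i _ => ?_
    rw [derivative_C_mul_X_pow]
    push_cast
    rw [div_mul_cancel₀ _ (by positivity)]
  · refine natDegree_sum_le_of_forall_le _ _ fun i hi => (natDegree_C_mul_X_pow_le _ _).trans ?_
    rw [Finset.mem_range] at hi
    omega

lemma integral_integral_swap_of_continuous {f : ℝ → ℝ → ℝ} (hf : Continuous (Function.uncurry f))
    {a b c d : ℝ} (hab : a ≤ b) (hcd : c ≤ d) :
    ∫ x in a..b, ∫ y in c..d, f x y = ∫ y in c..d, ∫ x in a..b, f x y := by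
  simp only [intervalIntegral.integral_of_le hab, intervalIntegral.integral_of_le hcd]
  refine MeasureTheory.integral_integral_swap ?_
  rw [MeasureTheory.Measure.prod_restrict]
  exact (hf.continuousOn.integrableOn_compact (isCompact_Icc.prod isCompact_Icc)).mono_set
    (Set.prod_mono Set.Ioc_subset_Icc_self Set.Ioc_subset_Icc_self)

lemma integral_mul_sub (p P : ℝ[X]) (hP : derivative (derivative P) = p) (x a b : ℝ) :
    ∫ s in a..b, p.eval s * (x - s) =
      (derivative P).eval b * (x - b) + P.eval b -
        ((derivative P).eval a * (x - a) + P.eval a) := by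
  rw [intervalIntegral.integral_eq_sub_of_hasDerivAt
    (f := fun s => (derivative P).eval s * (x - s) + P.eval s) (fun s _ => ?_)
    (Continuous.intervalIntegrable (by fun_prop) _ _)]
  refine (((derivative P).hasDerivAt s).mul ((hasDerivAt_id s).const_sub x)).add
    (P.hasDerivAt s) |>.congr_deriv ?_
  rw [hP]
  simp

/-- The splines `x ↦ ∫ p(s) (x - s)₊ ds`, with the integral over one subinterval. They are
in class `C^1`, so the continuity class has to be at most `1`. -/
lemma exists_test_spline {S D c j : ℕ} {t : ℕ → ℝ} (ht : StrictMonoOn t (Set.Iic S)) (hj : j < S)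
    (hc : c ≤ 1) {p : ℝ[X]} (hp : p.natDegree + 2 ≤ D) :
    ∃ f ∈ splineSpace S D c t, ∀ x ∈ Set.Icc (t 0) (t S),
      f x = ∫ s in t j..t (j + 1), p.eval s * max (x - s) 0 := by
  obtain ⟨P', hP', hd'⟩ := exists_derivative_eq p
  obtain ⟨P, rfl, hd⟩ := exists_derivative_eq P'
  have hmono : ∀ {a b : ℕ}, a ≤ b → b ≤ S → t a ≤ t b := fun h hb =>
    ht.monotoneOn (Set.mem_Iic.2 (h.trans hb)) (Set.mem_Iic.2 hb) h
  have key : ∀ x a b : ℝ, ∫ s in a..b, p.eval s * (x - s) = _ := integral_mul_sub p P hP'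
  classical
  refine ⟨fun x => if x ∈ Set.Icc (t 0) (t S) then
      ∫ s in t j..t (j + 1), p.eval s * max (x - s) 0 else 0, ⟨fun x hx => if_neg hx, fun i =>
      if i < j then 0 else if i = j then
        P - C (P.eval (t j)) - C ((derivative P).eval (t j)) * (X - C (t j))
      else C (P.eval (t (j + 1)) - P.eval (t j)) +
        C ((derivative P).eval (t (j + 1))) * (X - C (t (j + 1))) -
        C ((derivative P).eval (t j)) * (X - C (t j)), fun i hi => ⟨?_, fun x hx => ?_⟩, ?_⟩,
      fun x hx => if_pos hx⟩
  · beta_reduce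
    have h1 : ∀ u v : ℝ, (C u * (X - C v)).natDegree ≤ D := fun u v =>
      (natDegree_C_mul_le _ _).trans (by rw [natDegree_X_sub_C]; omega)
    have h2 : ∀ u : ℝ, (C u).natDegree ≤ D := fun u => by rw [natDegree_C]; omega
    split_ifs
    · simp
    · exact (natDegree_sub_le_of_le (natDegree_sub_le_of_le (m := D) (by omega) (h2 _))
        (h1 _ _)).trans (by rw [max_self, max_self])
    · exact (natDegree_sub_le_of_le (natDegree_add_le_of_degree_le (h2 _) (h1 _ _)) (h1 _ _)).trans
        (by simp)
  · have hxS : x ∈ Set.Icc (t 0) (t S) :=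
      ⟨(hmono (Nat.zero_le i) hi.le).trans hx.1, hx.2.trans (hmono hi le_rfl)⟩
    have hjj : t j ≤ t (j + 1) := hmono (Nat.le_succ j) hj
    beta_reduce
    rw [if_pos hxS]
    -- on the left and on the right of `x`, respectively, `max` is resolved
    have zero : ∀ u v : ℝ, u ≤ v → x ≤ u → ∫ s in u..v, p.eval s * max (x - s) 0 = 0 := by
      intro u v huv hxu
      rw [intervalIntegral.integral_congr (g := fun _ => (0 : ℝ)), intervalIntegral.integral_zero]
      intro s hs
      rw [Set.uIcc_of_le huv] at hs
      beta_reduce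
      rw [max_eq_right (by linarith [hs.1]), mul_zero]
    have full : ∀ u v : ℝ, u ≤ v → v ≤ x → ∫ s in u..v, p.eval s * max (x - s) 0 =
        ∫ s in u..v, p.eval s * (x - s) := by
      intro u v huv hxv
      refine intervalIntegral.integral_congr fun s hs => ?_
      rw [Set.uIcc_of_le huv] at hs
      rw [max_eq_left (by linarith [hs.2])]
    rcases lt_trichotomy i j with h | rfl | h
    · rw [if_pos h, eval_zero]
      exact zero _ _ hjj (hx.2.trans (hmono h hj.le))
    · rw [if_neg (lt_irrefl _), if_pos rfl, ← intervalIntegral.integral_add_adjacent_intervals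
        (b := x) (Continuous.intervalIntegrable (by fun_prop) _ _)
        (Continuous.intervalIntegrable (by fun_prop) _ _), full _ _ hx.1 le_rfl,
        zero _ _ hx.2 le_rfl, key]
      simp only [eval_sub, eval_mul, eval_C, eval_X]
      ring
    · rw [if_neg (by omega), if_neg (by omega), full _ _ hjj ((hmono h hi.le).trans hx.1), key]
      simp only [eval_sub, eval_add, eval_mul, eval_C, eval_X]
      ring
  · intro i hi k hk
    obtain rfl | rfl : k = 0 ∨ k = 1 := by omega
    all_goals
      rcases lt_trichotomy i j with h | rfl | h
      · rcases (show i + 1 < j ∨ i + 1 = j by omega) with h' | rfl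
        · simp [h, h']
        · simp
      · simp
      · simp [show ¬ i < j by omega, show i ≠ j by omega, show ¬ i + 1 < j by omega,
          show i + 1 ≠ j by omega]

/-- The second Peano kernel of a quadrature rule on an interval with right end `b`: the error of the
rule for the function `x ↦ max (x - s) 0`. -/
def peano (b : ℝ) (R : Multiset (ℝ × ℝ)) (s : ℝ) : ℝ :=
  (b - s) ^ 2 / 2 - (R.map fun q => q.2 * max (q.1 - s) 0).sum

lemma continuous_sum_mul_max (R : Multiset (ℝ × ℝ)) :
    Continuous fun s : ℝ => (R.map fun q => q.2 * max (q.1 - s) 0).sum := by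
  induction R using Multiset.induction with
  | empty => simpa using continuous_const
  | cons q R ih =>
    simp only [Multiset.map_cons, Multiset.sum_cons]
    exact Continuous.add (by fun_prop) ih

lemma continuous_peano (b : ℝ) (R : Multiset (ℝ × ℝ)) : Continuous (peano b R) :=
  Continuous.sub (by fun_prop) (continuous_sum_mul_max R)

lemma integral_mul_sum (R : Multiset (ℝ × ℝ)) {g : ℝ → ℝ} (hg : Continuous g) (a b : ℝ) :
    ∫ s in a..b, g s * (R.map fun q => q.2 * max (q.1 - s) 0).sum =
      (R.map fun q => q.2 * ∫ s in a..b, g s * max (q.1 - s) 0).sum := by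
  induction R using Multiset.induction with
  | empty => simp
  | cons q R ih =>
    have h1 : Continuous fun s => g s * (R.map fun q => q.2 * max (q.1 - s) 0).sum :=
      hg.mul (continuous_sum_mul_max R)
    have h2 : Continuous fun s => g s * (q.2 * max (q.1 - s) 0) := by fun_prop
    simp only [Multiset.map_cons, Multiset.sum_cons, mul_add]
    rw [intervalIntegral.integral_add (h2.intervalIntegrable _ _) (h1.intervalIntegrable _ _), ih,
      ← intervalIntegral.integral_const_mul]
    congr 1
    refine intervalIntegral.integral_congr fun s _ => ?_
    ring

lemma integral_max_sub {a b s : ℝ} (h : s ∈ Set.Icc a b) :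
    ∫ x in a..b, max (x - s) 0 = (b - s) ^ 2 / 2 := by
  have h1 : ∫ x in a..s, max (x - s) 0 = 0 := by
    rw [intervalIntegral.integral_congr (g := fun _ => (0 : ℝ)), intervalIntegral.integral_zero]
    intro x hx
    rw [Set.uIcc_of_le h.1] at hx
    exact max_eq_right (by linarith [hx.2])
  have h2 : ∫ x in s..b, max (x - s) 0 = ∫ x in s..b, (x - s) := by
    refine intervalIntegral.integral_congr fun x hx => ?_
    rw [Set.uIcc_of_le h.2] at hx
    exact max_eq_left (by linarith [hx.1])
  rw [← intervalIntegral.integral_add_adjacent_intervals (b := s)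
    (Continuous.intervalIntegrable (by fun_prop) _ _)
    (Continuous.intervalIntegrable (by fun_prop) _ _), h1, h2]
  simp
  ring

/-- On every subinterval, the kernel of an exact rule is orthogonal to the polynomials of degree at
most `D - 2`: the integral is the error of the rule for a test spline. -/
lemma IsExact.integral_mul_peano {S D c j : ℕ} {t : ℕ → ℝ} {R : Multiset (ℝ × ℝ)}
    (ht : StrictMonoOn t (Set.Iic S)) (hR : IsExact S D c t R) (hc : c ≤ 1) (hj : j < S) {p : ℝ[X]}
    (hp : p.natDegree + 2 ≤ D) : ∫ s in t j..t (j + 1), p.eval s * peano (t S) R s = 0 := by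
  obtain ⟨f, hf, hfx⟩ := exists_test_spline ht hj hc hp
  have hmono : ∀ {a b : ℕ}, a ≤ b → b ≤ S → t a ≤ t b := fun h hb =>
    ht.monotoneOn (Set.mem_Iic.2 (h.trans hb)) (Set.mem_Iic.2 hb) h
  have h0S : t 0 ≤ t S := hmono (Nat.zero_le _) le_rfl
  have hjj : t j ≤ t (j + 1) := hmono (Nat.le_succ j) hj
  have h1 := hR.2 f hf
  have h2 : ∫ x in t 0..t S, f x = ∫ s in t j..t (j + 1), p.eval s * ((t S - s) ^ 2 / 2) := by
    rw [intervalIntegral.integral_congr (g := fun x =>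
      ∫ s in t j..t (j + 1), p.eval s * max (x - s) 0)
      (fun x hx => hfx x (by rwa [Set.uIcc_of_le h0S] at hx)),
      integral_integral_swap_of_continuous (by fun_prop) h0S hjj]
    refine intervalIntegral.integral_congr fun s hs => ?_
    rw [Set.uIcc_of_le hjj] at hs
    simp only [intervalIntegral.integral_const_mul]
    rw [integral_max_sub ⟨(hmono (Nat.zero_le _) hj.le).trans hs.1, hs.2.trans (hmono hj le_rfl)⟩]
  have h3 : (R.map fun q => q.2 * f q.1).sum = ∫ s in t j..t (j + 1), p.eval s *
      (R.map fun q => q.2 * max (q.1 - s) 0).sum := by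
    rw [integral_mul_sum R p.continuous]
    refine congrArg _ (Multiset.map_congr rfl fun q hq => ?_)
    rw [hfx _ (hR.1 q hq)]
  have h4 : (fun s => p.eval s * peano (t S) R s) = fun s => p.eval s * ((t S - s) ^ 2 / 2) -
      p.eval s * (R.map fun q => q.2 * max (q.1 - s) 0).sum := by
    funext s
    rw [peano, mul_sub]
  have h5 : Continuous fun s => p.eval s * (R.map fun q => q.2 * max (q.1 - s) 0).sum :=
    p.continuous.mul (continuous_sum_mul_max R)
  rw [h4, intervalIntegral.integral_sub (Continuous.intervalIntegrable (by fun_prop) _ _)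
    (h5.intervalIntegrable _ _), ← h2, ← h3, h1, sub_self]

/-! ### A lower bound for the number of nodes -/

/-- An exact rule is exact for polynomials. They have to be cut off outside of the interval, where
the members of the spline space vanish. -/
lemma IsExact.sum_weights {S D c : ℕ} {t : ℕ → ℝ} {R : Multiset (ℝ × ℝ)} (hR : IsExact S D c t R)
    (h : t 0 ≤ t S) (ht : ∀ i < S, t 0 ≤ t i ∧ t (i + 1) ≤ t S) {p : ℝ[X]} (hp : p.natDegree ≤ D) :
    (R.map fun q => q.2 * p.eval q.1).sum = ∫ x in t 0..t S, p.eval x := by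
  classical
  have := hR.2 (fun x => if x ∈ Set.Icc (t 0) (t S) then p.eval x else 0)
    ⟨fun x hx => if_neg hx, fun _ => p, fun i hi => ⟨hp, fun x hx => if_pos
      ⟨(ht i hi).1.trans hx.1, hx.2.trans (ht i hi).2⟩⟩, fun _ _ _ _ => rfl⟩
  rw [intervalIntegral.integral_congr (g := fun x => p.eval x) fun x hx => if_pos
    (by rwa [Set.uIcc_of_le h] at hx)] at this
  rw [← this]
  exact congrArg _ (Multiset.map_congr rfl fun q hq => by rw [if_pos (hR.1 q hq)])

/-- Between two consecutive nodes, the Peano kernel is a quadratic polynomial; between the end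
points of the interval and the nearest nodes it has no zeros. The assumptions say that the rule is
exact for `1` and `x`. -/
lemma exists_peano_zeros {a b : ℝ} (hab : a < b) {R : Multiset (ℝ × ℝ)}
    (h0 : (R.map fun q => q.2).sum = b - a)
    (h1 : (R.map fun q => q.2 * q.1).sum = (b ^ 2 - a ^ 2) / 2) :
    ∃ Z : Finset ℝ, Z.card + 2 ≤ 2 * (R.map Prod.fst).toFinset.card ∧
      ∀ s, s ∈ Z ↔ s ∈ Set.Ioo a b ∧ peano b R s = 0 := by
  classical
  set V := (R.map Prod.fst).toFinset with hV
  have hmem : ∀ q ∈ R, q.1 ∈ V := fun q hq =>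
    Multiset.mem_toFinset.2 (Multiset.mem_map_of_mem _ hq)
  have hne : V.Nonempty := by
    rw [Finset.nonempty_iff_ne_empty]
    intro h
    rw [hV, Multiset.toFinset_eq_empty, Multiset.map_eq_zero] at h
    rw [h] at h0
    simp at h0
    linarith
  -- the quadratic polynomial that describes the kernel right of the node `x`
  let u : ℝ → ℝ[X] := fun x => C (1 / 2) * (C b - X) ^ 2 -
    ((R.filter fun q : ℝ × ℝ => x < q.1).map fun q => C q.2 * (C q.1 - X)).sum
  have hu : ∀ x, (u x).natDegree ≤ 2 ∧ u x ≠ 0 := by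
    intro x
    have h2 : ((R.filter fun q : ℝ × ℝ => x < q.1).map fun q : ℝ × ℝ =>
        (C q.2 * (C q.1 - X) : ℝ[X])).sum.natDegree ≤ 1 := by
      induction R.filter fun q : ℝ × ℝ => x < q.1 using Multiset.induction with
      | empty => simp
      | cons q Q ih =>
        rw [Multiset.map_cons, Multiset.sum_cons]
        refine natDegree_add_le_of_degree_le ?_ ih
        compute_degree
    have h3 : (C (1 / 2) * (C b - X) ^ 2 : ℝ[X]).natDegree ≤ 2 := by compute_degree
    refine ⟨(natDegree_sub_le_of_le h3 h2).trans (by norm_num), fun h => ?_⟩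
    have h4 : (C (1 / 2) * (C b - X) ^ 2 : ℝ[X]).coeff 2 = 1 / 2 := by
      rw [sub_sq, ← C_pow, ← C_ofNat, mul_add, mul_sub, coeff_add, coeff_sub]
      simp only [← mul_assoc, ← C_mul, coeff_C_mul, coeff_C, coeff_X, coeff_X_pow]
      simp
    have h5 := congrArg (fun p => coeff p 2) h
    simp only [u, coeff_sub, coeff_zero] at h5
    rw [h4, coeff_eq_zero_of_natDegree_lt (by omega)] at h5
    norm_num at h5
  have hev : ∀ x s, (∀ q ∈ R, x < q.1 ↔ s < q.1) → peano b R s = (u x).eval s := by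
    intro x s hxs
    simp only [u, eval_sub, eval_mul, eval_C, eval_pow, eval_X, peano]
    rw [← coe_evalRingHom, map_multiset_sum, Multiset.map_map]
    simp only [Function.comp_def, coe_evalRingHom, eval_mul, eval_sub, eval_C, eval_X]
    rw [Multiset.filter_congr hxs]
    have : (R.map fun q => q.2 * max (q.1 - s) 0).sum =
        ((R.filter fun q => s < q.1).map fun q => q.2 * (q.1 - s)).sum := by
      clear h0 h1 hV hmem hne V hu hxs u
      induction R using Multiset.induction with
      | empty => simp
      | cons q R ih =>
        rw [Multiset.map_cons, Multiset.sum_cons, ih]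
        by_cases h : s < q.1
        · rw [Multiset.filter_cons_of_pos (p := fun q : ℝ × ℝ => s < q.1) _ h, Multiset.map_cons,
            Multiset.sum_cons, max_eq_left (by linarith)]
        · rw [Multiset.filter_cons_of_neg (p := fun q : ℝ × ℝ => s < q.1) _ h,
            max_eq_right (by linarith), mul_zero, zero_add]
    rw [this]
    ring
  have key : ∀ s ∈ Set.Ioo a b, peano b R s = 0 →
      s ∈ (V.erase (V.max' hne)).biUnion fun x => (u x).roots.toFinset := by
    intro s hs hs0
    -- distinguish by the last node `x ≤ s`; if it is the last node of all, or if there is none,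
    -- then the kernel is `(b - s) ^ 2 / 2` or `(s - a) ^ 2 / 2`
    by_cases hE : (V.filter (· ≤ s)).Nonempty
    · set x := (V.filter (· ≤ s)).max' hE with hx
      have hxm := Finset.mem_filter.1 (Finset.max'_mem _ hE)
      rw [← hx] at hxm
      have hxs : ∀ q ∈ R, x < q.1 ↔ s < q.1 := by
        refine fun q hq => ⟨fun h => ?_, fun h => hxm.2.trans_lt h⟩
        by_contra! h'
        exact not_le.2 h (Finset.le_max' _ _ (Finset.mem_filter.2 ⟨hmem q hq, h'⟩))
      rw [hev x s hxs] at hs0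
      refine Finset.mem_biUnion.2 ⟨x, Finset.mem_erase.2 ⟨fun h => ?_, hxm.1⟩,
        Multiset.mem_toFinset.2 ((mem_roots (hu x).2).2 hs0)⟩
      rw [← hev x s hxs, peano, Multiset.map_congr (g := fun _ => (0 : ℝ)) rfl] at hs0
      · simp at hs0
        linarith [hs.2]
      · intro q hq
        rw [max_eq_right, mul_zero]
        have := Finset.le_max' V q.1 (hmem q hq)
        rw [← h] at this
        linarith [hxm.2]
    · exfalso
      rw [Finset.not_nonempty_iff_eq_empty, Finset.filter_eq_empty_iff] at hE
      rw [peano, Multiset.map_congr (g := fun q => q.2 * q.1 - s * q.2) rfl,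
        Multiset.sum_map_sub, h1, Multiset.sum_map_mul_left, h0] at hs0
      · have : (s - a) ^ 2 = 0 := by linarith
        have := pow_eq_zero_iff (two_ne_zero) |>.1 this
        linarith [hs.1]
      · intro q hq
        rw [max_eq_left (by linarith [not_le.1 (hE (hmem q hq))])]
        ring
  refine ⟨((V.erase (V.max' hne)).biUnion fun x => (u x).roots.toFinset).filter
    fun s => s ∈ Set.Ioo a b ∧ peano b R s = 0, ?_, fun s => ?_⟩
  · have h3 := Finset.card_filter_le ((V.erase (V.max' hne)).biUnion fun x => (u x).roots.toFinset)
      fun s => s ∈ Set.Ioo a b ∧ peano b R s = 0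
    have h4 := Finset.card_biUnion_le_card_mul (V.erase (V.max' hne))
      (fun x => (u x).roots.toFinset) 2 fun x _ =>
        (Multiset.toFinset_card_le _).trans ((card_roots' _).trans (hu x).1)
    rw [Finset.card_erase_of_mem (Finset.max'_mem _ _)] at h4
    have h5 := hne.card_pos
    omega
  · rw [Finset.mem_filter, and_iff_right_iff_imp]
    exact fun h => key s h.1 h.2

/-- A continuous function on an interval with finitely many zeros that is orthogonal to the
polynomials of degree less than `d` has at least `d` zeros. -/
lemma le_card_zeros {h : ℝ → ℝ} (hc : Continuous h) {a b : ℝ} (hab : a < b) {d : ℕ} {Z : Finset ℝ}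
    (hZ : ∀ s ∈ Set.Ioo a b, s ∈ Z ↔ h s = 0)
    (horth : ∀ p : ℝ[X], p.natDegree < d → ∫ s in a..b, p.eval s * h s = 0) :
    d ≤ (Z.filter (· ∈ Set.Ioo a b)).card := by
  by_contra! hlt
  obtain ⟨p, hp, hpos, -⟩ := exists_sign_polynomial (a := a) Z b hc.continuousOn
    (fun x hx h0 => hx.2 ((hZ x hx.1).2 h0))
  have h1 : ∀ x ∈ Set.Ioo a b, 0 ≤ p.eval x * h x := by
    intro x hx
    by_cases hxZ : x ∈ Z
    · rw [(hZ x hx).1 hxZ, mul_zero]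
    · exact (hpos x ⟨hx, hxZ⟩).le
  have h2 : ∀ x ∈ Set.Icc a b, 0 ≤ p.eval x * h x := by
    rw [← closure_Ioo hab.ne]
    exact fun x hx => closure_minimal h1 (isClosed_le continuous_const (p.continuous.mul hc)) hx
  obtain ⟨x, hx⟩ := ((Set.Ioo_infinite hab).sdiff Z.finite_toSet).nonempty
  exact (intervalIntegral.integral_pos hab (p.continuous.mul hc).continuousOn
    (fun x hx => h2 x ⟨hx.1.le, hx.2⟩) ⟨x, Set.Ioo_subset_Icc_self hx.1, hpos x hx⟩).ne'
    (horth p (hp.trans_lt hlt))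

lemma sum_card_filter_Ioc_le {S : ℕ} {t : ℕ → ℝ} (ht : StrictMonoOn t (Set.Iic S)) (Z : Finset ℝ) :
    ∑ j ∈ Finset.range S, (Z.filter (· ∈ Set.Ioc (t j) (t (j + 1)))).card ≤ Z.card := by
  classical
  rw [← Finset.card_biUnion]
  · exact Finset.card_le_card (Finset.biUnion_subset.2 fun j _ => Finset.filter_subset _ _)
  · have key : ∀ i < S, ∀ j < S, i < j → Disjoint (Z.filter (· ∈ Set.Ioc (t i) (t (i + 1))))
        (Z.filter (· ∈ Set.Ioc (t j) (t (j + 1)))) := by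
      intro i hi j hj hij
      refine Finset.disjoint_left.2 fun x hx hx' => ?_
      have h1 := (Finset.mem_filter.1 hx).2.2
      have h2 := (Finset.mem_filter.1 hx').2.1
      exact absurd (ht.monotoneOn (Set.mem_Iic.2 (show i + 1 ≤ S by omega)) (Set.mem_Iic.2 hj.le)
        (show i + 1 ≤ j by omega)) (not_le.2 (h2.trans_le h1))
    intro i hi j hj hij
    rw [Finset.coe_range, Set.mem_Iio] at hi hj
    rcases lt_or_gt_of_ne hij with h | h
    · exact key i hi j hj h
    · exact (key j hj i hi h).symm

lemma IsExact.exists_zeros {S D c : ℕ} {t : ℕ → ℝ} {R : Multiset (ℝ × ℝ)} (hS : 1 ≤ S)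
    (hD : 1 ≤ D) (ht : StrictMonoOn t (Set.Iic S)) (hR : IsExact S D c t R) :
    ∃ Z : Finset ℝ, Z.card + 2 ≤ 2 * (R.map Prod.fst).toFinset.card ∧
      ∀ s, s ∈ Z ↔ s ∈ Set.Ioo (t 0) (t S) ∧ peano (t S) R s = 0 := by
  have hmono : ∀ {a b : ℕ}, a ≤ b → b ≤ S → t a ≤ t b := fun h hb =>
    ht.monotoneOn (Set.mem_Iic.2 (h.trans hb)) (Set.mem_Iic.2 hb) h
  have h0S : t 0 < t S := ht (Set.mem_Iic.2 (Nat.zero_le _)) (Set.mem_Iic.2 le_rfl) (by omega)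
  have key := fun (p : ℝ[X]) (hp : p.natDegree ≤ D) => hR.sum_weights h0S.le
    (fun i hi => ⟨hmono (Nat.zero_le i) hi.le, hmono hi le_rfl⟩) hp
  refine exists_peano_zeros h0S ?_ ?_
  · simpa using key 1 (by simp)
  · simpa using key X (by simpa using hD)

lemma IsExact.le_card_filter_Ioo {S D c d j : ℕ} {t : ℕ → ℝ} {R : Multiset (ℝ × ℝ)}
    (ht : StrictMonoOn t (Set.Iic S)) (hc : c ≤ 1) (hR : IsExact S D c t R) {Z : Finset ℝ}
    (hZ : ∀ s, s ∈ Z ↔ s ∈ Set.Ioo (t 0) (t S) ∧ peano (t S) R s = 0) (hj : j < S)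
    (hd : d + 1 ≤ D) : d ≤ (Z.filter (· ∈ Set.Ioo (t j) (t (j + 1)))).card := by
  have hmono : ∀ {a b : ℕ}, a ≤ b → b ≤ S → t a ≤ t b := fun h hb =>
    ht.monotoneOn (Set.mem_Iic.2 (h.trans hb)) (Set.mem_Iic.2 hb) h
  refine le_card_zeros (continuous_peano _ R) (ht (Set.mem_Iic.2 hj.le) (Set.mem_Iic.2 hj)
    (Nat.lt_succ_self j)) (fun s hs => ?_)
    fun p hp => hR.integral_mul_peano ht hc hj (by omega)
  rw [hZ, and_iff_right]
  exact ⟨(hmono (Nat.zero_le j) hj.le).trans_lt hs.1, hs.2.trans_le (hmono hj le_rfl)⟩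

/-- For `c = 0`, the function `x ↦ max (x - t j) 0` is a spline, and the value of the kernel at the
knot is the error of the rule for it. -/
lemma IsExact.peano_knot {S D j : ℕ} {t : ℕ → ℝ} {R : Multiset (ℝ × ℝ)}
    (ht : StrictMonoOn t (Set.Iic S)) (hR : IsExact S D 0 t R) (hD : 1 ≤ D) (hj : j ≤ S) :
    peano (t S) R (t j) = 0 := by
  classical
  have hmono : ∀ {a b : ℕ}, a ≤ b → b ≤ S → t a ≤ t b := fun h hb =>
    ht.monotoneOn (Set.mem_Iic.2 (h.trans hb)) (Set.mem_Iic.2 hb) h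
  have h1 := hR.2 (fun x => if x ∈ Set.Icc (t 0) (t S) then max (x - t j) 0 else 0)
    ⟨fun x hx => if_neg hx, fun i => if i < j then 0 else X - C (t j), ?_, ?_⟩
  · rw [intervalIntegral.integral_congr (g := fun x => max (x - t j) 0) fun x hx => if_pos
      (by rwa [Set.uIcc_of_le (hmono (Nat.zero_le S) le_rfl)] at hx),
      integral_max_sub ⟨hmono (Nat.zero_le j) hj, hmono hj le_rfl⟩] at h1
    rw [peano, ← h1, sub_eq_zero]
    exact congrArg _ (Multiset.map_congr rfl fun q hq => by rw [if_pos (hR.1 q hq)])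
  · refine fun i hi => ⟨?_, fun x hx => ?_⟩
    · beta_reduce
      split_ifs
      · simp
      · rwa [natDegree_X_sub_C]
    · beta_reduce
      rw [if_pos ⟨(hmono (Nat.zero_le i) hi.le).trans hx.1, hx.2.trans (hmono hi le_rfl)⟩]
      split_ifs with h
      · rw [eval_zero, max_eq_right (by linarith [hx.2, hmono h hj])]
      · rw [eval_sub, eval_X, eval_C,
          max_eq_left (by linarith [hx.1, hmono (not_lt.1 h) hi.le])]
  · intro i hi k hk
    obtain rfl : k = 0 := by omega
    rcases lt_trichotomy (i + 1) j with h | rfl | h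
    · simp [h, show i < j by omega]
    · simp
    · simp [show ¬ i < j by omega, show ¬ i + 1 < j by omega]

/-- The number of nodes of a rule that is exact for continuous splines. The kernel has `d` zeros
inside each subinterval, and vanishes at the `S - 1` inner knots. -/
lemma IsExact.le_two_mul_card_zero {S d : ℕ} {t : ℕ → ℝ} {R : Multiset (ℝ × ℝ)} (hS : 1 ≤ S)
    (ht : StrictMonoOn t (Set.Iic S)) (hR : IsExact S (d + 1) 0 t R) :
    (d + 1) * S + 1 ≤ 2 * (R.map Prod.fst).toFinset.card := by
  classical
  obtain ⟨Z, hZc, hZ⟩ := hR.exists_zeros hS (by omega) ht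
  have h1 : ∀ j ∈ Finset.range S, (d + 1 - if j + 1 = S then 1 else 0) ≤
      (Z.filter (· ∈ Set.Ioc (t j) (t (j + 1)))).card := by
    intro j hj
    rw [Finset.mem_range] at hj
    have h2 := hR.le_card_filter_Ioo (d := d) ht zero_le_one hZ hj le_rfl
    have hsub : Z.filter (· ∈ Set.Ioo (t j) (t (j + 1))) ⊆
        Z.filter (· ∈ Set.Ioc (t j) (t (j + 1))) := fun x hx =>
      Finset.mem_filter.2 ⟨(Finset.mem_filter.1 hx).1,
        Set.Ioo_subset_Ioc_self (Finset.mem_filter.1 hx).2⟩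
    split_ifs with h
    · exact h2.trans (Finset.card_le_card hsub)
    · refine h2.trans_lt (Finset.card_lt_card ((Finset.ssubset_iff_of_subset hsub).2
        ⟨t (j + 1), Finset.mem_filter.2 ⟨(hZ _).2 ⟨⟨?_, ?_⟩, ?_⟩, ?_, le_rfl⟩,
          fun h => lt_irrefl _ (Finset.mem_filter.1 h).2.2⟩))
      · exact ht (Set.mem_Iic.2 (Nat.zero_le _)) (Set.mem_Iic.2 hj) (by omega)
      · exact ht (Set.mem_Iic.2 hj) (Set.mem_Iic.2 le_rfl) (by omega)
      · exact hR.peano_knot ht (by omega) hj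
      · exact ht (Set.mem_Iic.2 hj.le) (Set.mem_Iic.2 hj) (by omega)
  have h3 := (Finset.sum_le_sum h1).trans (sum_card_filter_Ioc_le ht Z)
  obtain ⟨s, rfl⟩ : ∃ s, S = s + 1 := ⟨S - 1, by omega⟩
  rw [Finset.sum_range_succ, if_pos rfl, Finset.sum_congr rfl (g := fun _ => d + 1),
    Finset.sum_const, Finset.card_range, smul_eq_mul] at h3
  · have : (d + 1) * (s + 1) = s * (d + 1) + (d + 1) := by ring
    omega
  · intro j hj
    rw [Finset.mem_range] at hj
    rw [if_neg (by omega), Nat.sub_zero]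

/-- The number of nodes of a rule that is exact for continuously differentiable splines. The kernel
has `d` zeros inside each subinterval. -/
lemma IsExact.le_two_mul_card_one {S d : ℕ} {t : ℕ → ℝ} {R : Multiset (ℝ × ℝ)} (hS : 1 ≤ S)
    (ht : StrictMonoOn t (Set.Iic S)) (hR : IsExact S (d + 1) 1 t R) :
    d * S + 2 ≤ 2 * (R.map Prod.fst).toFinset.card := by
  classical
  obtain ⟨Z, hZc, hZ⟩ := hR.exists_zeros hS (by omega) ht
  have h1 : ∀ j ∈ Finset.range S, d ≤ (Z.filter (· ∈ Set.Ioc (t j) (t (j + 1)))).card :=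
    fun j hj => (hR.le_card_filter_Ioo (d := d) ht le_rfl hZ (Finset.mem_range.1 hj) le_rfl).trans
      (Finset.card_le_card fun x hx => Finset.mem_filter.2 ⟨(Finset.mem_filter.1 hx).1,
        Set.Ioo_subset_Ioc_self (Finset.mem_filter.1 hx).2⟩)
  have h3 := (Finset.sum_le_sum h1).trans (sum_card_filter_Ioc_le ht Z)
  rw [Finset.sum_const, Finset.card_range, smul_eq_mul, mul_comm] at h3
  omega

/-! ### The dimension of the spline space -/

lemma exists_mem_Icc_knots {S : ℕ} {t : ℕ → ℝ} (hS : 1 ≤ S) {x : ℝ}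
    (hx : x ∈ Set.Icc (t 0) (t S)) : ∃ i < S, x ∈ Set.Icc (t i) (t (i + 1)) := by
  induction S, hS using Nat.le_induction with
  | base => exact ⟨0, by omega, hx⟩
  | succ n hn ih =>
    rcases le_total x (t n) with h | h
    · obtain ⟨i, hi, hxi⟩ := ih ⟨hx.1, h⟩
      exact ⟨i, by omega, hxi⟩
    · exact ⟨n, by omega, h, hx.2⟩

lemma pow_dvd_of_derivative_eval {p : ℝ[X]} {a : ℝ} {c : ℕ}
    (h : ∀ k ≤ c, (derivative^[k] p).eval a = 0) : (X - C a) ^ (c + 1) ∣ p := by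
  rcases eq_or_ne p 0 with rfl | hp
  · exact dvd_zero _
  · exact (le_rootMultiplicity_iff hp).1
      (lt_rootMultiplicity_of_isRoot_iterate_derivative hp fun k hk => h k hk)

lemma derivative_eval_pow_mul {a : ℝ} {c k : ℕ} (hk : k ≤ c) (q : ℝ[X]) :
    (derivative^[k] ((X - C a) ^ (c + 1) * q)).eval a = 0 := by
  obtain ⟨r, hr⟩ := Polynomial.pow_sub_dvd_iterate_derivative_of_pow_dvd k
    (Dvd.intro q rfl : (X - C a) ^ (c + 1) ∣ (X - C a) ^ (c + 1) * q)
  rw [hr, eval_mul, eval_pow, eval_sub, eval_X, eval_C, sub_self, zero_pow (by omega), zero_mul]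

lemma eq_zero_of_eval_Icc {p : ℝ[X]} {a b : ℝ} (hab : a < b)
    (h : ∀ x ∈ Set.Icc a b, p.eval x = 0) : p = 0 :=
  eq_zero_of_infinite_isRoot p ((Set.Icc_infinite hab).mono fun x hx => h x hx)

/-- The pieces of a spline in the truncated power basis: the jump of the pieces at the knot
`t (i + 1)` is `(x - t (i + 1)) ^ (c + 1) * q i`. -/
def piece (c s : ℕ) (t : ℕ → ℝ) (p : ℝ[X]) (q : Fin s → ℝ[X]) (m : ℕ) : ℝ[X] :=
  p + ∑ i : Fin s, if (i : ℕ) < m then (X - C (t (i + 1))) ^ (c + 1) * q i else 0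

lemma piece_zero (c s : ℕ) (t : ℕ → ℝ) (p : ℝ[X]) (q : Fin s → ℝ[X]) : piece c s t p q 0 = p := by
  simp [piece]

lemma piece_succ (c : ℕ) {s : ℕ} (t : ℕ → ℝ) (p : ℝ[X]) (q : Fin s → ℝ[X]) {m : ℕ} (hm : m < s) :
    piece c s t p q (m + 1) = piece c s t p q m + (X - C (t (m + 1))) ^ (c + 1) * q ⟨m, hm⟩ := by
  rw [piece, piece, add_assoc, add_right_inj, ← sub_eq_iff_eq_add', ← Finset.sum_sub_distrib,
    Finset.sum_eq_single (⟨m, hm⟩ : Fin s)]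
  · simp
  · intro i _ hi
    have : (i : ℕ) ≠ m := fun h => hi (Fin.ext h)
    rcases lt_or_gt_of_ne this with h | h
    · rw [if_pos (by omega), if_pos h, sub_self]
    · rw [if_neg (by omega), if_neg (by omega), sub_self]
  · simp

/-- The truncated power basis: splines are parametrized by the first piece and by the jumps of the
pieces at the inner knots. -/
def truncatedPower (D c s : ℕ) (t : ℕ → ℝ) :
    (degreeLT ℝ (D + 1) × (Fin s → degreeLT ℝ (D - c))) →ₗ[ℝ] (ℝ → ℝ) where
  toFun u x := (Set.Icc (t 0) (t (s + 1))).indicator (fun x => (u.1 : ℝ[X]).eval x +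
    ∑ i : Fin s, if t (i + 1) < x then (x - t (i + 1)) ^ (c + 1) * (u.2 i : ℝ[X]).eval x else 0) x
  map_add' u v := by
    funext x
    by_cases h : x ∈ Set.Icc (t 0) (t (s + 1))
    · simp only [Pi.add_apply, Set.indicator_of_mem h]
      simp only [Prod.fst_add, Prod.snd_add, Submodule.coe_add, Pi.add_apply, eval_add, mul_add]
      rw [add_add_add_comm, ← Finset.sum_add_distrib]
      congr 1
      refine Finset.sum_congr rfl fun i _ => ?_
      split_ifs <;> simp
    · simp only [Pi.add_apply, Set.indicator_of_notMem h, add_zero]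
  map_smul' a u := by
    funext x
    by_cases h : x ∈ Set.Icc (t 0) (t (s + 1))
    · simp only [Pi.smul_apply, Set.indicator_of_mem h, RingHom.id_apply]
      simp only [Prod.smul_fst, Prod.smul_snd, Submodule.coe_smul, Pi.smul_apply, eval_smul,
        smul_eq_mul, mul_add, Finset.mul_sum]
      congr 1
      refine Finset.sum_congr rfl fun i _ => ?_
      split_ifs
      · ring
      · simp
    · simp only [Pi.smul_apply, Set.indicator_of_notMem h, smul_zero]

lemma truncatedPower_of_notMem {D c s : ℕ} {t : ℕ → ℝ}
    (u : degreeLT ℝ (D + 1) × (Fin s → degreeLT ℝ (D - c))) {x : ℝ}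
    (hx : x ∉ Set.Icc (t 0) (t (s + 1))) : truncatedPower D c s t u x = 0 := by
  simp only [truncatedPower, LinearMap.coe_mk, AddHom.coe_mk, Set.indicator_of_notMem hx]

lemma truncatedPower_eq {D c s m : ℕ} {t : ℕ → ℝ} (ht : StrictMonoOn t (Set.Iic (s + 1)))
    (u : degreeLT ℝ (D + 1) × (Fin s → degreeLT ℝ (D - c))) (hm : m < s + 1) {x : ℝ}
    (hx : x ∈ Set.Icc (t m) (t (m + 1))) :
    truncatedPower D c s t u x = (piece c s t u.1 (fun i => u.2 i) m).eval x := by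
  have hmono : ∀ {a b : ℕ}, a ≤ b → b ≤ s + 1 → t a ≤ t b := fun h hb =>
    ht.monotoneOn (Set.mem_Iic.2 (h.trans hb)) (Set.mem_Iic.2 hb) h
  have hx' : x ∈ Set.Icc (t 0) (t (s + 1)) :=
    ⟨(hmono (Nat.zero_le m) hm.le).trans hx.1, hx.2.trans (hmono hm le_rfl)⟩
  simp only [truncatedPower, LinearMap.coe_mk, AddHom.coe_mk, Set.indicator_of_mem hx', piece,
    eval_add, eval_finsetSum]
  congr 1
  refine Finset.sum_congr rfl fun i _ => ?_
  by_cases h : (i : ℕ) < m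
  · rw [if_pos h, eval_mul, eval_pow, eval_sub, eval_X, eval_C]
    have h1 : t (i + 1) ≤ x := (hmono h hm.le).trans hx.1
    rcases h1.lt_or_eq with h2 | h2
    · rw [if_pos h2]
    · rw [if_neg (by rw [h2]; exact lt_irrefl _), h2, sub_self, zero_pow (by omega), zero_mul]
  · have h1 : x ≤ t (i + 1) := hx.2.trans (hmono (by omega) (by omega))
    rw [if_neg h, if_neg (not_lt.2 h1), eval_zero]

lemma natDegree_le_of_mem_degreeLT {n : ℕ} {p : ℝ[X]} (hp : p ∈ degreeLT ℝ n) :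
    p.natDegree ≤ n - 1 := by
  rcases eq_or_ne p 0 with rfl | h
  · simp
  · rw [mem_degreeLT, degree_eq_natDegree h] at hp
    have : p.natDegree < n := by exact_mod_cast hp
    omega

lemma truncatedPower_mem {D c s : ℕ} {t : ℕ → ℝ} (ht : StrictMonoOn t (Set.Iic (s + 1)))
    (hc : c ≤ D) (u : degreeLT ℝ (D + 1) × (Fin s → degreeLT ℝ (D - c))) :
    truncatedPower D c s t u ∈ splineSpace (s + 1) D c t := by
  refine ⟨fun x hx => truncatedPower_of_notMem u hx, piece c s t u.1 (fun i => u.2 i),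
    fun i hi => ⟨?_, fun x hx => truncatedPower_eq ht u hi hx⟩, fun i hi k hk => ?_⟩
  · refine natDegree_add_le_of_degree_le (natDegree_le_of_mem_degreeLT u.1.2)
      (natDegree_sum_le_of_forall_le _ _ fun j _ => ?_)
    beta_reduce
    split_ifs
    · rcases eq_or_ne (u.2 j : ℝ[X]) 0 with h | h
      · rw [h, mul_zero, natDegree_zero]
        exact Nat.zero_le _
      · have h1 := (u.2 j).2
        rw [mem_degreeLT, degree_eq_natDegree h] at h1
        have h2 : (u.2 j : ℝ[X]).natDegree < D - c := by exact_mod_cast h1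
        refine natDegree_mul_le.trans ?_
        rw [natDegree_pow, natDegree_X_sub_C]
        omega
    · simp
  · rw [piece_succ c t _ _ (show i < s by omega), iterate_map_add, eval_add,
      derivative_eval_pow_mul hk, add_zero]

lemma truncatedPower_injective {D c s : ℕ} {t : ℕ → ℝ} (ht : StrictMonoOn t (Set.Iic (s + 1))) :
    Function.Injective (truncatedPower D c s t) := by
  rw [← LinearMap.ker_eq_bot, LinearMap.ker_eq_bot']
  intro u hu
  have h1 : ∀ m < s + 1, piece c s t u.1 (fun i => u.2 i) m = 0 := fun m hm =>
    eq_zero_of_eval_Icc (ht (Set.mem_Iic.2 hm.le) (Set.mem_Iic.2 hm) (Nat.lt_succ_self m))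
      fun x hx => by rw [← truncatedPower_eq ht u hm hx, hu, Pi.zero_apply]
  have h2 := h1 0 (by omega)
  rw [piece_zero] at h2
  refine Prod.ext (Subtype.ext h2) (funext fun i => Subtype.ext ?_)
  have h3 := h1 (i + 1) (by omega)
  rw [piece_succ c t _ _ i.2, h1 i (by omega), zero_add] at h3
  exact (mul_eq_zero.1 h3).resolve_left (pow_ne_zero _ (X_sub_C_ne_zero _))

lemma exists_truncatedPower_eq {D c s : ℕ} {t : ℕ → ℝ} (ht : StrictMonoOn t (Set.Iic (s + 1)))
    {f : ℝ → ℝ} (hf : f ∈ splineSpace (s + 1) D c t) :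
    ∃ u, truncatedPower D c s t u = f := by
  obtain ⟨hf0, p, hp, hk⟩ := hf
  -- the jump at an inner knot has a zero of order `c + 1` there
  have hq : ∀ i : Fin s, ∃ q ∈ degreeLT ℝ (D - c),
      p (i + 1) = p i + (X - C (t (i + 1))) ^ (c + 1) * q := by
    intro i
    obtain ⟨q, hq⟩ := pow_dvd_of_derivative_eval (p := p (i + 1) - p i) (a := t (i + 1)) (c := c)
      fun k hkc => by
        rw [iterate_map_sub, eval_sub, hk i (by omega) k hkc, sub_self]
    refine ⟨q, ?_, by rw [← hq]; ring⟩
    rcases eq_or_ne q 0 with rfl | h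
    · exact zero_mem _
    · have h1 : (p (i + 1) - p i).natDegree ≤ D :=
        (natDegree_sub_le_of_le (hp _ (by omega)).1 (hp _ (by omega)).1).trans (max_self D).le
      rw [hq, natDegree_mul (pow_ne_zero _ (X_sub_C_ne_zero _)) h, natDegree_pow,
        natDegree_X_sub_C] at h1
      rw [mem_degreeLT, degree_eq_natDegree h]
      exact_mod_cast (show q.natDegree < D - c by omega)
  choose q hqd hq using hq
  have h0 : p 0 ∈ degreeLT ℝ (D + 1) :=
    mem_degreeLT.2 (degree_lt_of_natDegree_le (hp 0 (by omega)).1 (Nat.lt_succ_self D))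
  refine ⟨(⟨p 0, h0⟩, fun i => ⟨q i, hqd i⟩), ?_⟩
  have h1 : ∀ m < s + 1, piece c s t (p 0) q m = p m := by
    intro m
    induction m with
    | zero => exact fun _ => piece_zero _ _ _ _ _
    | succ m ih =>
      intro hm
      rw [piece_succ c t _ _ (show m < s by omega), ih (by omega), ← hq ⟨m, by omega⟩]
  funext x
  by_cases hx : x ∈ Set.Icc (t 0) (t (s + 1))
  · obtain ⟨m, hm, hxm⟩ := exists_mem_Icc_knots (by omega) hx
    rw [truncatedPower_eq ht _ hm hxm, (hp m hm).2 x hxm, ← h1 m hm]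
  · rw [hf0 x hx]
    exact truncatedPower_of_notMem _ hx

lemma finrank_degreeLT (n : ℕ) : Module.finrank ℝ (degreeLT ℝ n) = n := by
  rw [(degreeLTEquiv ℝ n).finrank_eq, Module.finrank_fin_fun]

lemma finrank_splineSpace {S D c : ℕ} {t : ℕ → ℝ} (hS : 1 ≤ S) (ht : StrictMonoOn t (Set.Iic S))
    (hc : c ≤ D) : Module.finrank ℝ (splineSpace S D c t) = D + 1 + (S - 1) * (D - c) := by
  obtain ⟨s, rfl⟩ : ∃ s, S = s + 1 := ⟨S - 1, by omega⟩
  have e : LinearMap.range (truncatedPower D c s t) = splineSpace (s + 1) D c t := by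
    ext f
    exact ⟨fun ⟨u, hu⟩ => hu ▸ truncatedPower_mem ht hc u, fun hf => exists_truncatedPower_eq ht hf⟩
  have h1 : ∀ n, Module.Finite ℝ (degreeLT ℝ n) := fun n =>
    Module.Finite.equiv (degreeLTEquiv ℝ n).symm
  rw [← e, LinearMap.finrank_range_of_inj (truncatedPower_injective ht), Module.finrank_prod,
    Module.finrank_pi_fintype]
  simp [finrank_degreeLT]

/-! ### Minimality -/

/-- The lower bound counts different nodes, so a rule with no more pairs than this bound requires
has different nodes. -/
lemma IsExact.isMinimal {S D c m : ℕ} {t : ℕ → ℝ} {R : Multiset (ℝ × ℝ)} (hR : IsExact S D c t R)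
    (hlow : ∀ R', IsExact S D c t R' → m ≤ 2 * (R'.map Prod.fst).toFinset.card)
    (hcard : 2 * Multiset.card R ≤ m + 1) : IsMinimal S D c t R := by
  refine ⟨hR, Multiset.toFinset_card_eq_card_iff_nodup.1 (le_antisymm ?_ ?_), fun R' hR' => ?_⟩
  · exact Multiset.toFinset_card_le _
  · rw [Multiset.card_map]
    have := hlow R hR
    omega
  · have h1 := hlow R' hR'
    have h2 := Multiset.toFinset_card_le (R'.map Prod.fst)
    rw [Multiset.card_map] at h2
    omega

lemma IsExact.isMinimal_zero {S N : ℕ} (hS : 1 ≤ S) (hN : 1 ≤ N) {t : ℕ → ℝ}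
    (ht : StrictMonoOn t (Set.Iic S)) {R : Multiset (ℝ × ℝ)} (hR : IsExact S (2 * N - 1) 0 t R)
    (hcard : 2 * Multiset.card R ≤ (2 * N - 1) * S + 2) : IsMinimal S (2 * N - 1) 0 t R := by
  refine hR.isMinimal (m := (2 * N - 1) * S + 1) (fun R' hR' => ?_) hcard
  obtain ⟨d, hd⟩ : ∃ d, 2 * N - 1 = d + 1 := ⟨2 * N - 2, by omega⟩
  rw [hd] at hR' ⊢
  exact hR'.le_two_mul_card_zero hS ht

lemma IsExact.isMinimal_one {S N : ℕ} (hS : 1 ≤ S) (hN : 1 ≤ N) {t : ℕ → ℝ}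
    (ht : StrictMonoOn t (Set.Iic S)) {R : Multiset (ℝ × ℝ)} (hR : IsExact S (2 * N) 1 t R)
    (hcard : 2 * Multiset.card R ≤ (2 * N - 1) * S + 3) : IsMinimal S (2 * N) 1 t R := by
  refine hR.isMinimal (m := (2 * N - 1) * S + 2) (fun R' hR' => ?_) hcard
  obtain ⟨d, hd⟩ : ∃ d, 2 * N = d + 1 := ⟨2 * N - 1, by omega⟩
  rw [hd] at hR' ⊢
  exact hR'.le_two_mul_card_one hS ht

lemma finrank_splineSpace_zero {S N : ℕ} (hS : 1 ≤ S) {t : ℕ → ℝ}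
    (ht : StrictMonoOn t (Set.Iic S)) :
    Module.finrank ℝ (splineSpace S (2 * N - 1) 0 t) = (2 * N - 1) * S + 1 := by
  rw [finrank_splineSpace hS ht (Nat.zero_le _)]
  obtain ⟨s, rfl⟩ : ∃ s, S = s + 1 := ⟨S - 1, by omega⟩
  rw [Nat.add_sub_cancel, Nat.sub_zero]
  ring

lemma finrank_splineSpace_one {S N : ℕ} (hS : 1 ≤ S) (hN : 1 ≤ N) {t : ℕ → ℝ}
    (ht : StrictMonoOn t (Set.Iic S)) :
    Module.finrank ℝ (splineSpace S (2 * N) 1 t) = (2 * N - 1) * S + 2 := by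
  rw [finrank_splineSpace hS ht (by omega)]
  obtain ⟨s, rfl⟩ : ∃ s, S = s + 1 := ⟨S - 1, by omega⟩
  rw [Nat.add_sub_cancel, mul_add, mul_one, mul_comm s]
  omega

/-! ### Passing the knots -/

/-- The affine map that takes `-1` to `a` and `1` to `b`. -/
def aff (a b : ℝ) : ℝ[X] := C a + C ((b - a) / 2) * (1 + X)

lemma aff_eval (a b x : ℝ) : (aff a b).eval x = a + (b - a) / 2 * (1 + x) := by
  simp [aff]

lemma aff_derivative (a b : ℝ) : derivative (aff a b) = C ((b - a) / 2) := by
  simp [aff]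

lemma natDegree_comp_aff_le (P : ℝ[X]) (a b : ℝ) : (P.comp (aff a b)).natDegree ≤ P.natDegree := by
  have : (aff a b).natDegree ≤ 1 := by unfold aff; compute_degree
  exact natDegree_comp_le.trans (by nlinarith)

lemma integ_comp_aff (P : ℝ[X]) (a b : ℝ) :
    (b - a) / 2 * integ (P.comp (aff a b)) = ∫ x in a..b, P.eval x := by
  obtain ⟨P, rfl, -⟩ := exists_derivative_eq P
  rw [← integ_C_mul, ← aff_derivative, ← derivative_comp, integ_derivative, eval_comp, eval_comp,
    aff_eval, aff_eval, intervalIntegral.integral_eq_sub_of_hasDerivAt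
      (fun x _ => P.hasDerivAt x) (P.derivative.continuous.intervalIntegrable _ _)]
  congr 2 <;> ring

/-- The point functional that a parameter pair `(α, β)` stands for, at a knot `x`; `L` is the length
of the subinterval on the inner side of the knot, and `σ` is the sign of the direction. -/
def jet (σ L α β x : ℝ) (P : ℝ[X]) : ℝ :=
  L * α * P.eval x - 6 * σ * β * L ^ 2 * (derivative P).eval x

/-- The corrected integral in the coordinates of the spline. For `σ = -1` the subinterval is
traversed from right to left, that is, `b < a`. -/
lemma mul_knotInteg_comp_aff {σ L a b : ℝ} (hσ : σ * σ = 1) (hL : L = σ * (b - a))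
    (αL βL αR βR : ℝ) (P : ℝ[X]) :
    L / 2 * knotInteg αL βL αR βR (P.comp (aff a b)) = σ * (∫ x in a..b, P.eval x) +
      jet σ L αL βL a P - jet σ L (-αR) βR b P := by
  have hab : b - a = σ * L := by rw [hL, ← mul_assoc, hσ, one_mul]
  have ha : a + (b - a) / 2 * (1 + -1) = a := by ring
  have hb : a + (b - a) / 2 * (1 + 1) = b := by ring
  rw [← integ_comp_aff, knotInteg_apply, derivative_comp]
  simp only [eval_mul, eval_comp, aff_eval, aff_derivative, eval_C, ha, hb, jet]
  rw [hab]
  linear_combination (-(L / 2) * integ (P.comp (aff a b))) * hσ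

/-- Passing a knot changes the parameters by the stretching factor. -/
lemma jet_stretch {σ L L' α β x : ℝ} (hL : L ≠ 0) (P : ℝ[X]) :
    jet σ L (L' / L * α) ((L' / L) ^ 2 * β) x P = jet σ L' α β x P := by
  simp only [jet]
  field_simp

lemma jet_congr {σ L α β x : ℝ} {P Q : ℝ[X]} (h : P.eval x = Q.eval x)
    (h' : β = 0 ∨ (derivative P).eval x = (derivative Q).eval x) :
    jet σ L α β x P = jet σ L α β x Q := by
  rw [jet, jet, h]
  rcases h' with rfl | h'
  · simp
  · rw [h']

/-- The contribution of one subinterval, with the correction at its end `b` expressed by the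
parameters `α'`, `β'` and by the polynomial `P'` of the next subinterval. -/
lemma mul_sum_interval {σ L L' a b α β a' b' α' β' s : ℝ} {P P' : ℝ[X]} (hσ : σ * σ = 1)
    (hL : L = σ * (b - a)) (hL0 : L ≠ 0) (hs : s = knotInteg α β (-a') b' (P.comp (aff a b)))
    (ha : a' = L' / L * α') (hb : b' = (L' / L) ^ 2 * β') (h0 : P.eval b = P'.eval b)
    (h1 : β' = 0 ∨ (derivative P).eval b = (derivative P').eval b) :
    L / 2 * s = σ * (∫ x in a..b, P.eval x) + jet σ L α β a P - jet σ L' α' β' b P' := by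
  rw [hs, mul_knotInteg_comp_aff hσ hL, neg_neg, ha, hb, jet_stretch hL0, jet_congr h0 h1]

lemma jet_zero (σ L x : ℝ) (P : ℝ[X]) : jet σ L 0 0 x P = 0 := by simp [jet]

/-- The sum of weighted function values. -/
def quadSum (f : ℝ → ℝ) : Multiset (ℝ × ℝ) →+ ℝ where
  toFun R := (R.map fun q => q.2 * f q.1).sum
  map_zero' := by simp
  map_add' := by simp

lemma quadSum_apply (f : ℝ → ℝ) (R : Multiset (ℝ × ℝ)) :
    quadSum f R = (R.map fun q => q.2 * f q.1).sum := rfl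

lemma place_node_mem {t : ℕ → ℝ} {i : ℕ} (h : t i ≤ t (i + 1)) {x : ℝ}
    (hx : x ∈ Set.Icc (-1 : ℝ) 1) : t i + (1 + x) / 2 * len t i ∈ Set.Icc (t i) (t (i + 1)) := by
  have h1 : 0 ≤ len t i := sub_nonneg.2 h
  have h2 : t (i + 1) = t i + len t i := by rw [len]; ring
  constructor
  · nlinarith [hx.1]
  · rw [h2]
    nlinarith [hx.2]

lemma quadSum_place {f : ℝ → ℝ} {t : ℕ → ℝ} {i n : ℕ} {q : ℝ[X]} (w : ℝ → ℝ) {I : Set ℝ}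
    (hI : I ⊆ Set.Icc (-1) 1) (hq : HasRootsIn q n I) (h : t i ≤ t (i + 1)) {P : ℝ[X]}
    (hf : ∀ x ∈ Set.Icc (t i) (t (i + 1)), f x = P.eval x) :
    quadSum f (place t i q w) =
      len t i / 2 * (q.roots.map fun x => w x * (P.comp (aff (t i) (t (i + 1)))).eval x).sum := by
  rw [quadSum_apply, place, Multiset.map_map, ← Multiset.sum_map_mul_left]
  refine congrArg _ (Multiset.map_congr rfl fun x hx => ?_)
  rw [Function.comp_apply, hf _ (place_node_mem h (hI (hq.2.2 x hx))), eval_comp, aff_eval, len]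
  ring_nf

lemma quadSum_placeRefl {f : ℝ → ℝ} {t : ℕ → ℝ} {i n : ℕ} {q : ℝ[X]} (w : ℝ → ℝ) {I : Set ℝ}
    (hI : I ⊆ Set.Icc (-1) 1) (hq : HasRootsIn q n I) (h : t i ≤ t (i + 1)) {P : ℝ[X]}
    (hf : ∀ x ∈ Set.Icc (t i) (t (i + 1)), f x = P.eval x) :
    quadSum f (placeRefl t i q w) =
      len t i / 2 * (q.roots.map fun x => w x * (P.comp (aff (t (i + 1)) (t i))).eval x).sum := by
  rw [quadSum_apply, placeRefl, Multiset.map_map, ← Multiset.sum_map_mul_left]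
  refine congrArg _ (Multiset.map_congr rfl fun x hx => ?_)
  have hx' := hI (hq.2.2 x hx)
  rw [Function.comp_apply, hf _ (place_node_mem h ⟨by linarith [hx'.2], by linarith [hx'.1]⟩),
    eval_comp, aff_eval, len]
  ring_nf

/-- The rules on `m` pairs of subintervals reproduce the integral up to the correction at the knot
after the last pair. The knots `T`, the lengths `L` and the pieces `P` are enumerated from the outer
end, with `σ = 1` on the left side and `σ = -1` on the right side. -/
lemma C1.sum_side {N m : ℕ} {T L : ℕ → ℝ} {σ : ℝ} {ω : ℕ → ℝ} {P : ℕ → ℝ[X]} (hN : 1 ≤ N)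
    (hσ : σ * σ = 1) (hL : ∀ i ≤ 2 * m, L i = σ * (T (i + 1) - T i)) (hpos : ∀ i ≤ 2 * m, 0 < L i)
    (hok : SideOK N m L ω) (hP : ∀ i < 2 * m, (P i).natDegree ≤ 2 * N)
    (h0 : ∀ i < 2 * m, (P i).eval (T (i + 1)) = (P (i + 1)).eval (T (i + 1)))
    (h1 : ∀ i < 2 * m,
      (derivative (P i)).eval (T (i + 1)) = (derivative (P (i + 1))).eval (T (i + 1))) :
    ∑ k ∈ Finset.range m,
      (L (2 * k) / 2 * ((poly₁ N L ω k).roots.map fun x =>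
          weightQ N (param N L ω k).1 (param N L ω k).2 (poly₁ N L ω k) x *
            ((P (2 * k)).comp (aff (T (2 * k)) (T (2 * k + 1)))).eval x).sum +
        L (2 * k + 1) / 2 * ((poly₂ N L ω k).roots.map fun x =>
          weightQ (N - 1) (param₂ N L ω k).1 (param₂ N L ω k).2 (poly₂ N L ω k) x *
            ((P (2 * k + 1)).comp (aff (T (2 * k + 1)) (T (2 * k + 2)))).eval x).sum) =
      ∑ i ∈ Finset.range (2 * m), σ * (∫ x in T i..T (i + 1), (P i).eval x) -
        jet σ (L (2 * m)) (param N L ω m).1 (param N L ω m).2 (T (2 * m)) (P (2 * m)) := by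
  induction m with
  | zero => simp [param, jet_zero]
  | succ m ih =>
    rw [Finset.sum_range_succ, ih (fun i hi => hL i (by omega)) (fun i hi => hpos i (by omega))
      (fun k hk => hok k (by omega)) (fun i hi => hP i (by omega)) (fun i hi => h0 i (by omega))
      (fun i hi => h1 i (by omega))]
    obtain ⟨k, rfl⟩ : ∃ k, N = k + 1 := ⟨N - 1, by omega⟩
    obtain ⟨hω, hr₁, hr₂⟩ := hok m (by omega)
    have l0 := hpos (2 * m) (by omega)
    have l1 := hpos (2 * m + 1) (by omega)
    have l2 := hpos (2 * m + 2) (by omega)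
    have hl : C0.stretch L (2 * m) ≠ 0 := (div_pos l1 l0).ne'
    have hl' : C0.stretch L (2 * m + 1) ≠ 0 := (div_pos l2 l1).ne'
    have hne : poly₁ (k + 1) L ω m ≠ 0 := fun h => by
      have := hr₁.1
      rw [h] at this
      simp at this
    have hΓ : Γω (k + 1 : ℕ) (ω m) (param (k + 1) L ω m).1 (param (k + 1) L ω m).2 ≠ 0 := by
      have := eval_one_ne_zero_of_hasRootsIn hr₁ hne
      rw [poly₁, Qω_eval_one] at this
      push_cast
      exact right_ne_zero_of_mul this
    have hF : F ((k : ℝ) + 1) (param₂ (k + 1) L ω m).1 (param₂ (k + 1) L ω m).2 = 0 := by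
      have := hω.F_eq_zero (by positivity) hl hΓ
      push_cast at this
      simpa [param₂, next₂] using this
    -- the two subintervals of the pair; the corrections at their common knot cancel
    have s₁ := sum_weightQ_Qω k _ _ _ hr₁
      ((natDegree_comp_aff_le (P (2 * m)) (T (2 * m)) (T (2 * m + 1))).trans (hP _ (by omega)))
    have s₂ := sum_weightQ_Q k _ _ hF hr₂
      ((natDegree_comp_aff_le (P (2 * m + 1)) (T (2 * m + 1)) (T (2 * m + 2))).trans
        (hP _ (by omega)))
    have t₁ := mul_sum_interval (L' := L (2 * m + 1)) (α' := (param₂ (k + 1) L ω m).1)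
      (β' := (param₂ (k + 1) L ω m).2) hσ (hL (2 * m) (by omega)) l0.ne' s₁
      (mul_div_cancel₀ _ hl).symm (mul_div_cancel₀ _ (pow_ne_zero 2 hl)).symm
      (h0 (2 * m) (by omega)) (Or.inr (h1 (2 * m) (by omega)))
    have hk : ((k + 1 : ℕ) : ℝ) - 1 = k := by push_cast; ring
    have t₂ := mul_sum_interval (L' := L (2 * m + 2)) (α' := (param (k + 1) L ω (m + 1)).1)
      (β' := (param (k + 1) L ω (m + 1)).2) hσ (hL (2 * m + 1) (by omega)) l1.ne' s₂
      (by rw [param, hk]; exact (mul_div_cancel₀ _ hl').symm)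
      (by rw [param, hk]; exact (mul_div_cancel₀ _ (pow_ne_zero 2 hl')).symm)
      (h0 (2 * m + 1) (by omega)) (Or.inr (h1 (2 * m + 1) (by omega)))
    rw [show 2 * (m + 1) = 2 * m + 1 + 1 by ring, Finset.sum_range_succ, Finset.sum_range_succ]
    simp only [poly₁, poly₂, Nat.add_sub_cancel] at t₁ t₂ ⊢
    linear_combination t₁ + t₂

/-- The analogue of `C1.sum_side`, with values only. -/
lemma C0.sum_side {N m : ℕ} {T L : ℕ → ℝ} {σ : ℝ} {P : ℕ → ℝ[X]} (hN : 1 ≤ N)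
    (hσ : σ * σ = 1) (hL : ∀ i ≤ 2 * m, L i = σ * (T (i + 1) - T i)) (hpos : ∀ i ≤ 2 * m, 0 < L i)
    (hP : ∀ i < 2 * m, (P i).natDegree ≤ 2 * N - 1)
    (h0 : ∀ i < 2 * m, (P i).eval (T (i + 1)) = (P (i + 1)).eval (T (i + 1))) :
    ∑ k ∈ Finset.range m,
      (L (2 * k) / 2 * ((poly₁ N L k).roots.map fun x =>
          weightQ N (param N L k) (poly₁ N L k) x *
            ((P (2 * k)).comp (aff (T (2 * k)) (T (2 * k + 1)))).eval x).sum +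
        L (2 * k + 1) / 2 * ((poly₂ N L k).roots.map fun x =>
          weightQ (N - 1) (param₂ N L k) (poly₂ N L k) x *
            ((P (2 * k + 1)).comp (aff (T (2 * k + 1)) (T (2 * k + 2)))).eval x).sum) =
      ∑ i ∈ Finset.range (2 * m), σ * (∫ x in T i..T (i + 1), (P i).eval x) -
        jet σ (L (2 * m)) (param N L m) 0 (T (2 * m)) (P (2 * m)) := by
  induction m with
  | zero => simp [param, jet_zero]
  | succ m ih =>
    rw [Finset.sum_range_succ, ih (fun i hi => hL i (by omega)) (fun i hi => hpos i (by omega))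
      (fun i hi => hP i (by omega)) (fun i hi => h0 i (by omega))]
    obtain ⟨hr₁, hr₂⟩ := sideOK hN hpos m (Nat.lt_succ_self m)
    have l0 := hpos (2 * m) (by omega)
    have l1 := hpos (2 * m + 1) (by omega)
    have l2 := hpos (2 * m + 2) (by omega)
    have hF : F N (param₂ N L m) = 0 := by
      rw [F, (param_nonneg hN fun i hi => hpos i (by omega)).2 l1]
      have hN' : (N : ℝ) ≠ 0 := by positivity
      field_simp
      ring
    obtain ⟨k, rfl⟩ : ∃ k, N = k + 1 := ⟨N - 1, by omega⟩
    push_cast at hF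
    have hl : C0.stretch L (2 * m) ≠ 0 := (div_pos l1 l0).ne'
    have hl' : C0.stretch L (2 * m + 1) ≠ 0 := (div_pos l2 l1).ne'
    -- the two subintervals of the pair; the corrections at their common knot cancel
    have s₁ := sum_weightQ_Qω k _ _ hr₁
      ((natDegree_comp_aff_le (P (2 * m)) (T (2 * m)) (T (2 * m + 1))).trans (hP _ (by omega)))
    have s₂ := sum_weightQ_Q k _ hF hr₂
      ((natDegree_comp_aff_le (P (2 * m + 1)) (T (2 * m + 1)) (T (2 * m + 2))).trans
        (hP _ (by omega)))
    have t₁ := mul_sum_interval (L' := L (2 * m + 1)) (α' := param₂ (k + 1) L m)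
      (β' := 0) hσ (hL (2 * m) (by omega)) l0.ne' s₁
      (mul_div_cancel₀ _ hl).symm (mul_zero _).symm
      (h0 (2 * m) (by omega)) (Or.inl rfl)
    have hk : ((k + 1 : ℕ) : ℝ) - 1 = k := by push_cast; ring
    have t₂ := mul_sum_interval (L' := L (2 * m + 2)) (α' := param (k + 1) L (m + 1))
      (β' := 0) hσ (hL (2 * m + 1) (by omega)) l1.ne' s₂
      (by rw [param, hk]; exact (mul_div_cancel₀ _ hl').symm) (mul_zero _).symm
      (h0 (2 * m + 1) (by omega)) (Or.inl rfl)
    rw [show 2 * (m + 1) = 2 * m + 1 + 1 by ring, Finset.sum_range_succ, Finset.sum_range_succ]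
    simp only [poly₁, poly₂, Nat.add_sub_cancel] at t₁ t₂ ⊢
    linear_combination t₁ + t₂

/-! ### Rules left and right of the middle -/

/-- The polynomials `p i` are the pieces of the spline `f`. -/
def IsPieces (S D c : ℕ) (t : ℕ → ℝ) (f : ℝ → ℝ) (p : ℕ → ℝ[X]) : Prop :=
  (∀ i < S, (p i).natDegree ≤ D ∧ ∀ x ∈ Set.Icc (t i) (t (i + 1)), f x = (p i).eval x) ∧
    ∀ i, i + 1 < S → ∀ k ≤ c,
      (derivative^[k] (p i)).eval (t (i + 1)) = (derivative^[k] (p (i + 1))).eval (t (i + 1))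

lemma knot_mono {S : ℕ} {t : ℕ → ℝ} (ht : StrictMonoOn t (Set.Iic S)) {a b : ℕ} (h : a ≤ b)
    (hb : b ≤ S) : t a ≤ t b :=
  ht.monotoneOn (Set.mem_Iic.2 (h.trans hb)) (Set.mem_Iic.2 hb) h

lemma len_pos {S : ℕ} {t : ℕ → ℝ} (ht : StrictMonoOn t (Set.Iic S)) {i : ℕ} (hi : i < S) :
    0 < len t i :=
  sub_pos.2 (ht (Set.mem_Iic.2 hi.le) (Set.mem_Iic.2 hi) (Nat.lt_succ_self i))

section Pieces

variable {S D c : ℕ} {t : ℕ → ℝ} {f : ℝ → ℝ} {p : ℕ → ℝ[X]}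

lemma IsPieces.eval_eq (h : IsPieces S D c t f p) {i : ℕ} (hi : i + 1 < S) :
    (p i).eval (t (i + 1)) = (p (i + 1)).eval (t (i + 1)) := h.2 i hi 0 (Nat.zero_le c)

lemma IsPieces.derivative_eval_eq (h : IsPieces S D c t f p) (hc : 1 ≤ c) {i : ℕ} (hi : i + 1 < S) :
    (derivative (p i)).eval (t (i + 1)) = (derivative (p (i + 1))).eval (t (i + 1)) :=
  h.2 i hi 1 hc

lemma IsPieces.integral_eq (ht : StrictMonoOn t (Set.Iic S)) (h : IsPieces S D c t f p) :
    ∫ x in t 0..t S, f x = ∑ i ∈ Finset.range S, ∫ x in t i..t (i + 1), (p i).eval x := by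
  have hE : ∀ i < S, Set.EqOn f (fun x => (p i).eval x) (Set.uIcc (t i) (t (i + 1))) := by
    intro i hi
    rw [Set.uIcc_of_le (knot_mono ht (Nat.le_succ i) hi)]
    exact (h.1 i hi).2
  rw [← intervalIntegral.sum_integral_adjacent_intervals (a := t) (n := S) fun i hi =>
    (((p i).continuous.intervalIntegrable (t i) (t (i + 1))).congr
      ((hE i hi).symm.mono Set.uIoc_subset_uIcc))]
  exact Finset.sum_congr rfl fun i hi =>
    intervalIntegral.integral_congr (hE i (Finset.mem_range.1 hi))

lemma lenR_eq (t : ℕ → ℝ) {i : ℕ} (hi : i < S) :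
    C0.lenR S t i = -1 * (t (S - (i + 1)) - t (S - i)) := by
  rw [C0.lenR, len, show S - 1 - i + 1 = S - i by omega, show S - (i + 1) = S - 1 - i by omega]
  ring

lemma IsPieces.eval_eq_reflect (h : IsPieces S D c t f p) {i : ℕ} (hi : i + 1 < S) :
    (p (S - 1 - i)).eval (t (S - (i + 1))) = (p (S - 1 - (i + 1))).eval (t (S - (i + 1))) := by
  have := h.eval_eq (i := S - 1 - (i + 1)) (by omega)
  rw [show S - 1 - (i + 1) + 1 = S - 1 - i by omega] at this
  rw [show S - (i + 1) = S - 1 - i by omega, this]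

lemma IsPieces.derivative_eval_eq_reflect (h : IsPieces S D c t f p) (hc : 1 ≤ c) {i : ℕ}
    (hi : i + 1 < S) : (derivative (p (S - 1 - i))).eval (t (S - (i + 1))) =
      (derivative (p (S - 1 - (i + 1)))).eval (t (S - (i + 1))) := by
  have := h.derivative_eval_eq hc (i := S - 1 - (i + 1)) (by omega)
  rw [show S - 1 - (i + 1) + 1 = S - 1 - i by omega] at this
  rw [show S - (i + 1) = S - 1 - i by omega, this]

lemma isExact_of_pieces {R : Multiset (ℝ × ℝ)} (hR : ∀ q ∈ R, q.1 ∈ Set.Icc (t 0) (t S))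
    (h : ∀ f p, IsPieces S D c t f p → quadSum f R = ∫ x in t 0..t S, f x) :
    IsExact S D c t R :=
  ⟨hR, fun f ⟨_, p, hp⟩ => h f p hp⟩

end Pieces

lemma sum_range_reflect_pairs (g : ℕ → ℝ) {S r : ℕ} (h : 2 * r < S) :
    ∑ i ∈ Finset.range (2 * r), g (S - 1 - i) = ∑ i ∈ Finset.Ico (S - 2 * r) S, g i := by
  rw [Finset.range_eq_Ico, Finset.sum_Ico_reflect g 0 (by omega : 2 * r ≤ S - 1 + 1),
    show S - 1 + 1 = S by omega, Nat.sub_zero]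

namespace C1

variable {N S : ℕ} {t : ℕ → ℝ} {f : ℝ → ℝ} {p : ℕ → ℝ[X]} {ω : ℕ → ℝ}

lemma quadSum_leftRule {l : ℕ} (hN : 1 ≤ N) (ht : StrictMonoOn t (Set.Iic S)) (hl : 2 * l < S)
    (hok : SideOK N l (C0.lenL t) ω) (hp : IsPieces S (2 * N) 1 t f p) :
    quadSum f (leftRule N l t ω) =
      ∑ i ∈ Finset.range (2 * l), (∫ x in t i..t (i + 1), (p i).eval x) -
      jet 1 (len t (2 * l)) (param N (C0.lenL t) ω l).1 (param N (C0.lenL t) ω l).2 (t (2 * l))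
        (p (2 * l)) := by
  have h := sum_side (T := t) (σ := 1) (P := p) hN (one_mul 1)
    (fun i _ => (one_mul _).symm) (fun i hi => len_pos ht (by omega)) hok
    (fun i hi => (hp.1 i (by omega)).1) (fun i hi => hp.eval_eq (by omega))
    (fun i hi => hp.derivative_eval_eq le_rfl (by omega))
  simp only [one_mul] at h
  rw [leftRule, map_sum]
  refine Eq.trans (Finset.sum_congr rfl fun k hk => ?_) h
  rw [Finset.mem_range] at hk
  rw [map_add, quadSum_place _ Set.Ico_subset_Icc_self (hok k hk).2.1
    (knot_mono ht (Nat.le_succ _) (by omega)) (hp.1 (2 * k) (by omega)).2,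
    quadSum_place _ Set.Ico_subset_Icc_self (hok k hk).2.2
    (knot_mono ht (Nat.le_succ _) (by omega)) (hp.1 (2 * k + 1) (by omega)).2]
  rfl

lemma quadSum_rightRule {r : ℕ} (hN : 1 ≤ N) (ht : StrictMonoOn t (Set.Iic S)) (hr : 2 * r < S)
    (hok : SideOK N r (C0.lenR S t) ω) (hp : IsPieces S (2 * N) 1 t f p) :
    quadSum f (rightRule N r S t ω) =
      ∑ i ∈ Finset.Ico (S - 2 * r) S, (∫ x in t i..t (i + 1), (p i).eval x) -
      jet (-1) (len t (S - 1 - 2 * r)) (param N (C0.lenR S t) ω r).1 (param N (C0.lenR S t) ω r).2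
        (t (S - 2 * r)) (p (S - 1 - 2 * r)) := by
  have hs : ∀ i < S, S - 1 - i + 1 = S - i := fun i hi => by omega
  have h := sum_side (T := fun i => t (S - i)) (L := C0.lenR S t) (σ := -1)
    (P := fun i => p (S - 1 - i)) hN (by norm_num)
    (fun i hi => lenR_eq t (by omega))
    (fun i hi => len_pos (i := S - 1 - i) ht (by omega)) hok
    (fun i hi => (hp.1 (S - 1 - i) (by omega)).1) (fun i hi => hp.eval_eq_reflect (by omega))
    (fun i hi => hp.derivative_eval_eq_reflect le_rfl (by omega))
  rw [rightRule, map_sum]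
  have e : ∑ i ∈ Finset.range (2 * r),
      (-1 * ∫ x in t (S - i)..t (S - (i + 1)), (p (S - 1 - i)).eval x) =
      ∑ i ∈ Finset.Ico (S - 2 * r) S, ∫ x in t i..t (i + 1), (p i).eval x := by
    rw [← sum_range_reflect_pairs (fun i => ∫ x in t i..t (i + 1), (p i).eval x) hr]
    refine Finset.sum_congr rfl fun i hi => ?_
    rw [Finset.mem_range] at hi
    rw [neg_one_mul, ← intervalIntegral.integral_symm, hs i (by omega),
      show S - (i + 1) = S - 1 - i by omega]
  rw [e] at h
  refine Eq.trans (Finset.sum_congr rfl fun k hk => ?_) h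
  rw [Finset.mem_range] at hk
  rw [map_add, quadSum_placeRefl _ Set.Ico_subset_Icc_self (hok k hk).2.1
    (knot_mono ht (Nat.le_succ _) (by omega)) (hp.1 (S - 1 - 2 * k) (by omega)).2,
    quadSum_placeRefl _ Set.Ico_subset_Icc_self (hok k hk).2.2
    (knot_mono ht (Nat.le_succ _) (by omega)) (hp.1 (S - 1 - (2 * k + 1)) (by omega)).2,
    hs _ (by omega), hs _ (by omega), show S - 1 - (2 * k + 1) = S - (2 * k + 2) by omega,
    show S - 1 - 2 * k = S - (2 * k + 1) by omega, show C0.lenR S t (2 * k) =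
      len t (S - (2 * k + 1)) from congrArg (len t) (by omega),
    show C0.lenR S t (2 * k + 1) = len t (S - (2 * k + 2)) from congrArg (len t) (by omega)]

end C1

namespace C0

variable {N S : ℕ} {t : ℕ → ℝ} {f : ℝ → ℝ} {p : ℕ → ℝ[X]}

lemma quadSum_leftRule {l : ℕ} (hN : 1 ≤ N) (ht : StrictMonoOn t (Set.Iic S)) (hl : 2 * l < S)
    (hp : IsPieces S (2 * N - 1) 0 t f p) :
    quadSum f (leftRule N l t) = ∑ i ∈ Finset.range (2 * l), (∫ x in t i..t (i + 1), (p i).eval x) -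
      jet 1 (len t (2 * l)) (param N (lenL t) l) 0 (t (2 * l))
        (p (2 * l)) := by
  have hok : SideOK N l (lenL t) := sideOK hN fun i hi => len_pos ht (by omega)
  have h := sum_side (m := l) (T := t) (L := lenL t) (σ := 1) (P := p) hN (one_mul 1)
    (fun i _ => (one_mul _).symm) (fun i hi => len_pos ht (by omega))
    (fun i hi => (hp.1 i (by omega)).1) (fun i hi => hp.eval_eq (by omega))
  simp only [one_mul] at h
  rw [leftRule, map_sum]
  refine Eq.trans (Finset.sum_congr rfl fun k hk => ?_) h
  rw [Finset.mem_range] at hk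
  rw [map_add, quadSum_place _ Set.Ico_subset_Icc_self (hok k hk).1
    (knot_mono ht (Nat.le_succ _) (by omega)) (hp.1 (2 * k) (by omega)).2,
    quadSum_place _ Set.Ico_subset_Icc_self (hok k hk).2
    (knot_mono ht (Nat.le_succ _) (by omega)) (hp.1 (2 * k + 1) (by omega)).2]
  rfl

lemma quadSum_rightRule {r : ℕ} (hN : 1 ≤ N) (ht : StrictMonoOn t (Set.Iic S)) (hr : 2 * r < S)
    (hp : IsPieces S (2 * N - 1) 0 t f p) :
    quadSum f (rightRule N r S t) =
      ∑ i ∈ Finset.Ico (S - 2 * r) S, (∫ x in t i..t (i + 1), (p i).eval x) -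
      jet (-1) (len t (S - 1 - 2 * r)) (param N (lenR S t) r) 0
        (t (S - 2 * r)) (p (S - 1 - 2 * r)) := by
  have hs : ∀ i < S, S - 1 - i + 1 = S - i := fun i hi => by omega
  have hok : SideOK N r (lenR S t) := sideOK hN fun i hi =>
    len_pos (i := S - 1 - i) ht (by omega)
  have h := sum_side (m := r) (T := fun i => t (S - i)) (L := lenR S t) (σ := -1)
    (P := fun i => p (S - 1 - i)) hN (by norm_num)
    (fun i hi => lenR_eq t (by omega))
    (fun i hi => len_pos (i := S - 1 - i) ht (by omega))
    (fun i hi => (hp.1 (S - 1 - i) (by omega)).1) (fun i hi => hp.eval_eq_reflect (by omega))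
  rw [rightRule, map_sum]
  have e : ∑ i ∈ Finset.range (2 * r),
      (-1 * ∫ x in t (S - i)..t (S - (i + 1)), (p (S - 1 - i)).eval x) =
      ∑ i ∈ Finset.Ico (S - 2 * r) S, ∫ x in t i..t (i + 1), (p i).eval x := by
    rw [← sum_range_reflect_pairs (fun i => ∫ x in t i..t (i + 1), (p i).eval x) hr]
    refine Finset.sum_congr rfl fun i hi => ?_
    rw [Finset.mem_range] at hi
    rw [neg_one_mul, ← intervalIntegral.integral_symm, hs i (by omega),
      show S - (i + 1) = S - 1 - i by omega]
  rw [e] at h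
  refine Eq.trans (Finset.sum_congr rfl fun k hk => ?_) h
  rw [Finset.mem_range] at hk
  rw [map_add, quadSum_placeRefl _ Set.Ico_subset_Icc_self (hok k hk).1
    (knot_mono ht (Nat.le_succ _) (by omega)) (hp.1 (S - 1 - 2 * k) (by omega)).2,
    quadSum_placeRefl _ Set.Ico_subset_Icc_self (hok k hk).2
    (knot_mono ht (Nat.le_succ _) (by omega)) (hp.1 (S - 1 - (2 * k + 1)) (by omega)).2,
    hs _ (by omega), hs _ (by omega), show S - 1 - (2 * k + 1) = S - (2 * k + 2) by omega,
    show S - 1 - 2 * k = S - (2 * k + 1) by omega, show lenR S t (2 * k) =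
      len t (S - (2 * k + 1)) from congrArg (len t) (by omega),
    show lenR S t (2 * k + 1) = len t (S - (2 * k + 2)) from congrArg (len t) (by omega)]

end C0

/-! ### Exactness -/

lemma card_place {t : ℕ → ℝ} {i n : ℕ} {q : ℝ[X]} {w : ℝ → ℝ} {I : Set ℝ} (hq : HasRootsIn q n I) :
    Multiset.card (place t i q w) = n := by
  rw [place, Multiset.card_map, hq.1]

lemma card_placeRefl {t : ℕ → ℝ} {i n : ℕ} {q : ℝ[X]} {w : ℝ → ℝ} {I : Set ℝ}
    (hq : HasRootsIn q n I) : Multiset.card (placeRefl t i q w) = n := by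
  rw [placeRefl, Multiset.card_map, hq.1]

lemma mem_Icc_of_mem_place {S : ℕ} {t : ℕ → ℝ} (ht : StrictMonoOn t (Set.Iic S)) {i n : ℕ}
    (hi : i < S) {q : ℝ[X]} {w : ℝ → ℝ} {I : Set ℝ} (hI : I ⊆ Set.Icc (-1) 1)
    (hq : HasRootsIn q n I) {u : ℝ × ℝ} (hu : u ∈ place t i q w) : u.1 ∈ Set.Icc (t 0) (t S) := by
  obtain ⟨x, hx, rfl⟩ := Multiset.mem_map.1 hu
  exact Set.Icc_subset_Icc (knot_mono ht (Nat.zero_le i) hi.le) (knot_mono ht hi le_rfl)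
    (place_node_mem (knot_mono ht (Nat.le_succ i) hi) (hI (hq.2.2 x hx)))

lemma mem_Icc_of_mem_placeRefl {S : ℕ} {t : ℕ → ℝ} (ht : StrictMonoOn t (Set.Iic S)) {i n : ℕ}
    (hi : i < S) {q : ℝ[X]} {w : ℝ → ℝ} {I : Set ℝ} (hI : I ⊆ Set.Icc (-1) 1)
    (hq : HasRootsIn q n I) {u : ℝ × ℝ} (hu : u ∈ placeRefl t i q w) :
    u.1 ∈ Set.Icc (t 0) (t S) := by
  obtain ⟨x, hx, rfl⟩ := Multiset.mem_map.1 hu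
  have hx' := hI (hq.2.2 x hx)
  exact Set.Icc_subset_Icc (knot_mono ht (Nat.zero_le i) hi.le) (knot_mono ht hi le_rfl)
    (place_node_mem (knot_mono ht (Nat.le_succ i) hi) ⟨by linarith [hx'.2], by linarith [hx'.1]⟩)

lemma jet_neg (σ L α β x : ℝ) (P : ℝ[X]) : jet σ L (-α) β x P = -jet (-σ) L α β x P := by
  simp only [jet]
  ring

/-- The rule of a middle subinterval, with corrections at both of its knots. -/
lemma quadSum_place_knotInteg {S : ℕ} {t : ℕ → ℝ} (ht : StrictMonoOn t (Set.Iic S)) {i n : ℕ}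
    (hi : i < S) {f : ℝ → ℝ} {q P : ℝ[X]} {w : ℝ → ℝ} {I : Set ℝ} (hI : I ⊆ Set.Icc (-1) 1)
    (hq : HasRootsIn q n I) {αL βL αR βR : ℝ}
    (hf : ∀ x ∈ Set.Icc (t i) (t (i + 1)), f x = P.eval x)
    (hw : (q.roots.map fun x => w x * (P.comp (aff (t i) (t (i + 1)))).eval x).sum =
      knotInteg αL βL αR βR (P.comp (aff (t i) (t (i + 1))))) :
    quadSum f (place t i q w) = (∫ x in t i..t (i + 1), P.eval x) +
      jet 1 (len t i) αL βL (t i) P + jet (-1) (len t i) αR βR (t (i + 1)) P := by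
  rw [quadSum_place w hI hq (knot_mono ht (Nat.le_succ i) hi) hf, hw,
    mul_knotInteg_comp_aff (σ := 1) (one_mul 1) (by rw [len, one_mul]), jet_neg, one_mul,
    sub_neg_eq_add]

namespace C1

variable {N l r S : ℕ} {t : ℕ → ℝ} {ω : ℕ → ℝ}

lemma mem_Icc_of_mem_leftRule (ht : StrictMonoOn t (Set.Iic S)) (hl : 2 * l ≤ S)
    (hok : SideOK N l (C0.lenL t) ω) {u : ℝ × ℝ} (hu : u ∈ leftRule N l t ω) :
    u.1 ∈ Set.Icc (t 0) (t S) := by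
  obtain ⟨k, hk, hu⟩ := Multiset.mem_sum.1 hu
  rw [Finset.mem_range] at hk
  rcases Multiset.mem_add.1 hu with hu | hu
  · exact mem_Icc_of_mem_place ht (by omega) Set.Ico_subset_Icc_self (hok k hk).2.1 hu
  · exact mem_Icc_of_mem_place ht (by omega) Set.Ico_subset_Icc_self (hok k hk).2.2 hu

lemma mem_Icc_of_mem_rightRule (ht : StrictMonoOn t (Set.Iic S)) (hr : 2 * r ≤ S)
    (hok : SideOK N r (C0.lenR S t) ω) {u : ℝ × ℝ} (hu : u ∈ rightRule N r S t ω) :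
    u.1 ∈ Set.Icc (t 0) (t S) := by
  obtain ⟨k, hk, hu⟩ := Multiset.mem_sum.1 hu
  rw [Finset.mem_range] at hk
  rcases Multiset.mem_add.1 hu with hu | hu
  · exact mem_Icc_of_mem_placeRefl ht (by omega) Set.Ico_subset_Icc_self (hok k hk).2.1 hu
  · exact mem_Icc_of_mem_placeRefl ht (by omega) Set.Ico_subset_Icc_self (hok k hk).2.2 hu

lemma card_leftRule (hN : 1 ≤ N) (hok : SideOK N l (C0.lenL t) ω) :
    Multiset.card (leftRule N l t ω) = l * (2 * N - 1) := by
  rw [leftRule, Multiset.card_sum, Finset.sum_congr rfl (g := fun _ => 2 * N - 1),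
    Finset.sum_const, Finset.card_range, smul_eq_mul]
  intro k hk
  obtain ⟨-, h1, h2⟩ := hok k (Finset.mem_range.1 hk)
  rw [Multiset.card_add, card_place h1, card_place h2]
  omega

lemma card_rightRule (hN : 1 ≤ N) (hok : SideOK N r (C0.lenR S t) ω) :
    Multiset.card (rightRule N r S t ω) = r * (2 * N - 1) := by
  rw [rightRule, Multiset.card_sum, Finset.sum_congr rfl (g := fun _ => 2 * N - 1),
    Finset.sum_const, Finset.card_range, smul_eq_mul]
  intro k hk
  obtain ⟨-, h1, h2⟩ := hok k (Finset.mem_range.1 hk)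
  rw [Multiset.card_add, card_placeRefl h1, card_placeRefl h2]
  omega

end C1

namespace C0

variable {N l r S : ℕ} {t : ℕ → ℝ}

lemma mem_Icc_of_mem_leftRule (ht : StrictMonoOn t (Set.Iic S)) (hl : 2 * l ≤ S)
    (hok : SideOK N l (lenL t)) {u : ℝ × ℝ} (hu : u ∈ leftRule N l t) :
    u.1 ∈ Set.Icc (t 0) (t S) := by
  obtain ⟨k, hk, hu⟩ := Multiset.mem_sum.1 hu
  rw [Finset.mem_range] at hk
  rcases Multiset.mem_add.1 hu with hu | hu
  · exact mem_Icc_of_mem_place ht (by omega) Set.Ico_subset_Icc_self (hok k hk).1 hu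
  · exact mem_Icc_of_mem_place ht (by omega) Set.Ico_subset_Icc_self (hok k hk).2 hu

lemma mem_Icc_of_mem_rightRule (ht : StrictMonoOn t (Set.Iic S)) (hr : 2 * r ≤ S)
    (hok : SideOK N r (lenR S t)) {u : ℝ × ℝ} (hu : u ∈ rightRule N r S t) :
    u.1 ∈ Set.Icc (t 0) (t S) := by
  obtain ⟨k, hk, hu⟩ := Multiset.mem_sum.1 hu
  rw [Finset.mem_range] at hk
  rcases Multiset.mem_add.1 hu with hu | hu
  · exact mem_Icc_of_mem_placeRefl ht (by omega) Set.Ico_subset_Icc_self (hok k hk).1 hu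
  · exact mem_Icc_of_mem_placeRefl ht (by omega) Set.Ico_subset_Icc_self (hok k hk).2 hu

lemma card_leftRule (hN : 1 ≤ N) (hok : SideOK N l (lenL t)) :
    Multiset.card (leftRule N l t) = l * (2 * N - 1) := by
  rw [leftRule, Multiset.card_sum, Finset.sum_congr rfl (g := fun _ => 2 * N - 1),
    Finset.sum_const, Finset.card_range, smul_eq_mul]
  intro k hk
  obtain ⟨h1, h2⟩ := hok k (Finset.mem_range.1 hk)
  rw [Multiset.card_add, card_place h1, card_place h2]
  omega

lemma card_rightRule (hN : 1 ≤ N) (hok : SideOK N r (lenR S t)) :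
    Multiset.card (rightRule N r S t) = r * (2 * N - 1) := by
  rw [rightRule, Multiset.card_sum, Finset.sum_congr rfl (g := fun _ => 2 * N - 1),
    Finset.sum_const, Finset.card_range, smul_eq_mul]
  intro k hk
  obtain ⟨h1, h2⟩ := hok k (Finset.mem_range.1 hk)
  rw [Multiset.card_add, card_placeRefl h1, card_placeRefl h2]
  omega

end C0

lemma sum_split_odd (g : ℕ → ℝ) (l r : ℕ) : ∑ i ∈ Finset.range (2 * (l + r) + 1), g i =
    ∑ i ∈ Finset.range (2 * l), g i + g (2 * l) +
      ∑ i ∈ Finset.Ico (2 * l + 1) (2 * (l + r) + 1), g i := by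
  rw [← Finset.sum_range_succ, Finset.sum_range_add_sum_Ico _ (by omega)]

lemma sum_split_even (g : ℕ → ℝ) (l r : ℕ) : ∑ i ∈ Finset.range (2 * (l + r) + 2), g i =
    ∑ i ∈ Finset.range (2 * l), g i + g (2 * l) + g (2 * l + 1) +
      ∑ i ∈ Finset.Ico (2 * l + 2) (2 * (l + r) + 2), g i := by
  rw [← Finset.sum_range_succ, ← Finset.sum_range_succ, Finset.sum_range_add_sum_Ico _ (by omega)]

namespace C1

variable {N l r : ℕ} {t : ℕ → ℝ} {ωL ωR : ℕ → ℝ}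

lemma isExact_oddRule {ω : ℝ} (hN : 1 ≤ N) (ht : StrictMonoOn t (Set.Iic (2 * (l + r) + 1)))
    (hok : OddOK N l r t ωL ωR ω) :
    IsExact (2 * (l + r) + 1) (2 * N) 1 t (oddRule N l r t ωL ωR ω) := by
  obtain ⟨hL, hR, hM⟩ := hok
  refine isExact_of_pieces (fun u hu => ?_) fun f p hp => ?_
  · rcases Multiset.mem_add.1 hu with hu | hu
    · rcases Multiset.mem_add.1 hu with hu | hu
      · exact mem_Icc_of_mem_leftRule ht (by omega) hL hu
      · exact mem_Icc_of_mem_place ht (by omega) le_rfl hM hu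
    · exact mem_Icc_of_mem_rightRule ht (by omega) hR hu
  · rw [hp.integral_eq ht, sum_split_odd, oddRule, map_add, map_add,
      quadSum_leftRule hN ht (by omega) hL hp, quadSum_rightRule hN ht (by omega) hR hp,
      quadSum_place_knotInteg ht (by omega) le_rfl hM (hp.1 (2 * l) (by omega)).2
        (sum_weightM_Mω N _ _ _ _ ω hM
          ((natDegree_comp_aff_le _ _ _).trans (hp.1 (2 * l) (by omega)).1)),
      show 2 * (l + r) + 1 - 1 - 2 * r = 2 * l by omega,
      show 2 * (l + r) + 1 - 2 * r = 2 * l + 1 by omega]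
    ring

lemma H_comm (n αL αR βL βR : ℝ) : H n αL αR βL βR = H n αR αL βR βL := by
  simp only [H]
  ring

/-- The equations at the knot between the middle subintervals say that the norms of both middle
polynomials vanish. The powers of `lam` in the second equation come from the stretching. -/
lemma IsMiddle.H_eq_zero {n lam α β : ℝ} {L R : ℝ × ℝ} (h : IsMiddle n lam L R α β)
    (hl : lam ≠ 0) : H (n + 1) L.1 α L.2 β = 0 ∧
      H (n + 1) (-α / lam) R.1 (β / lam ^ 2) R.2 = 0 := by
  have h1 := middle_eq n L.1 α L.2 β
  have h2 := middle_eq n R.1 (-α / lam) R.2 (β / lam ^ 2)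
  rw [h.1] at h1
  refine ⟨by linarith, ?_⟩
  rw [H_comm]
  have e : lam ^ 4 * (mA n R.1 R.2 * (β / lam ^ 2) ^ 2 + mB n R.1 R.2 * (β / lam ^ 2) +
      mC n R.1 R.2 + mD n R.1 R.2 * (-α / lam)) = 0 := by
    rw [← h.2]
    field_simp
  rw [h2] at e
  have := (mul_eq_zero.1 e).resolve_left (pow_ne_zero 4 hl)
  linarith

lemma isExact_evenRule {α β : ℝ} (hN : 1 ≤ N) (ht : StrictMonoOn t (Set.Iic (2 * (l + r) + 2)))
    (hok : EvenOK N l r t ωL ωR α β) :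
    IsExact (2 * (l + r) + 2) (2 * N) 1 t (evenRule N l r t ωL ωR α β) := by
  obtain ⟨hL, hR, hm, hM₁, hM₂⟩ := hok
  have l0 := len_pos ht (show 2 * l < 2 * (l + r) + 2 by omega)
  have l1 := len_pos ht (show 2 * l + 1 < 2 * (l + r) + 2 by omega)
  have hlam : C0.stretch (C0.lenL t) (2 * l) ≠ 0 := (div_pos l1 l0).ne'
  obtain ⟨H₁, H₂⟩ := hm.H_eq_zero hlam
  refine isExact_of_pieces (fun u hu => ?_) fun f p hp => ?_
  · rcases Multiset.mem_add.1 hu with hu | hu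
    · rcases Multiset.mem_add.1 hu with hu | hu
      · rcases Multiset.mem_add.1 hu with hu | hu
        · exact mem_Icc_of_mem_leftRule ht (by omega) hL hu
        · exact mem_Icc_of_mem_place ht (by omega) le_rfl hM₁ hu
      · exact mem_Icc_of_mem_place ht (by omega) le_rfl hM₂ hu
    · exact mem_Icc_of_mem_rightRule ht (by omega) hR hu
  · obtain ⟨k, rfl⟩ : ∃ k, N = k + 1 := ⟨N - 1, by omega⟩
    have ek : ((k + 1 : ℕ) : ℝ) + 1 = k + 2 := by push_cast; ring
    rw [ek] at H₁ H₂
    -- passing the knot between the middle subintervals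
    have hj : jet 1 (len t (2 * l + 1)) (-α / C0.stretch (C0.lenL t) (2 * l))
        (β / C0.stretch (C0.lenL t) (2 * l) ^ 2) (t (2 * l + 1)) (p (2 * l + 1)) =
        -jet (-1) (len t (2 * l)) α β (t (2 * l + 1)) (p (2 * l)) := by
      rw [← jet_neg, ← jet_congr (hp.eval_eq (i := 2 * l) (by omega))
        (Or.inr (hp.derivative_eval_eq le_rfl (by omega))), ← jet_stretch l0.ne']
      rw [show len t (2 * l + 1) / len t (2 * l) = C0.stretch (C0.lenL t) (2 * l) from rfl,
        mul_div_cancel₀ _ hlam, mul_div_cancel₀ _ (pow_ne_zero 2 hlam)]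
    rw [hp.integral_eq ht, sum_split_even, evenRule, map_add, map_add, map_add,
      quadSum_leftRule hN ht (by omega) hL hp, quadSum_rightRule hN ht (by omega) hR hp,
      quadSum_place_knotInteg ht (by omega) le_rfl hM₁ (hp.1 (2 * l) (by omega)).2
        (sum_weightM_M k _ _ _ _ H₁ hM₁
          ((natDegree_comp_aff_le _ _ _).trans (hp.1 (2 * l) (by omega)).1)),
      quadSum_place_knotInteg ht (by omega) le_rfl hM₂ (hp.1 (2 * l + 1) (by omega)).2
        (sum_weightM_M k _ _ _ _ H₂ hM₂
          ((natDegree_comp_aff_le _ _ _).trans (hp.1 (2 * l + 1) (by omega)).1)), hj,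
      show 2 * (l + r) + 2 - 1 - 2 * r = 2 * l + 1 by omega,
      show 2 * (l + r) + 2 - 2 * r = 2 * l + 2 by omega]
    ring

end C1

namespace C0

variable {N l r : ℕ} {t : ℕ → ℝ}

lemma isExact_oddRule (hN : 1 ≤ N) (ht : StrictMonoOn t (Set.Iic (2 * (l + r) + 1)))
    (hok : OddOK N l r t) :
    IsExact (2 * (l + r) + 1) (2 * N - 1) 0 t (oddRule N l r t) := by
  obtain ⟨hL, hR, hM⟩ := hok
  refine isExact_of_pieces (fun u hu => ?_) fun f p hp => ?_
  · rcases Multiset.mem_add.1 hu with hu | hu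
    · rcases Multiset.mem_add.1 hu with hu | hu
      · exact mem_Icc_of_mem_leftRule ht (by omega) hL hu
      · exact mem_Icc_of_mem_place ht (by omega) le_rfl hM hu
    · exact mem_Icc_of_mem_rightRule ht (by omega) hR hu
  · obtain ⟨k, rfl⟩ : ∃ k, N = k + 1 := ⟨N - 1, by omega⟩
    rw [hp.integral_eq ht, sum_split_odd, oddRule, map_add, map_add,
      quadSum_leftRule hN ht (by omega) hp, quadSum_rightRule hN ht (by omega) hp,
      quadSum_place_knotInteg ht (by omega) le_rfl hM (hp.1 (2 * l) (by omega)).2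
        (sum_weightM k _ _ hM
          ((natDegree_comp_aff_le _ _ _).trans (hp.1 (2 * l) (by omega)).1)),
      show 2 * (l + r) + 1 - 1 - 2 * r = 2 * l by omega,
      show 2 * (l + r) + 1 - 2 * r = 2 * l + 1 by omega]
    ring

lemma isExact_evenRule {ω : ℝ} (hN : 1 ≤ N) (ht : StrictMonoOn t (Set.Iic (2 * (l + r) + 2)))
    (hok : EvenOK N l r t ω) :
    IsExact (2 * (l + r) + 2) (2 * N - 1) 0 t (evenRule N l r t ω) := by
  obtain ⟨hL, hR, hM₁, hM₂⟩ := hok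
  have l0 := len_pos ht (show 2 * l < 2 * (l + r) + 2 by omega)
  have l1 := len_pos ht (show 2 * l + 1 < 2 * (l + r) + 2 by omega)
  have hlam : stretch (lenL t) (2 * l) ≠ 0 := (div_pos l1 l0).ne'
  refine isExact_of_pieces (fun u hu => ?_) fun f p hp => ?_
  · rcases Multiset.mem_add.1 hu with hu | hu
    · rcases Multiset.mem_add.1 hu with hu | hu
      · rcases Multiset.mem_add.1 hu with hu | hu
        · exact mem_Icc_of_mem_leftRule ht (by omega) hL hu
        · exact mem_Icc_of_mem_place ht (by omega) le_rfl hM₁ hu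
      · exact mem_Icc_of_mem_place ht (by omega) le_rfl hM₂ hu
    · exact mem_Icc_of_mem_rightRule ht (by omega) hR hu
  · obtain ⟨k, rfl⟩ : ∃ k, N = k + 1 := ⟨N - 1, by omega⟩
    have hj : jet 1 (len t (2 * l + 1)) (-ω / stretch (lenL t) (2 * l)) 0 (t (2 * l + 1))
        (p (2 * l + 1)) = -jet (-1) (len t (2 * l)) ω 0 (t (2 * l + 1)) (p (2 * l)) := by
      have h := jet_stretch (σ := 1) (L' := len t (2 * l + 1)) (β := 0) (x := t (2 * l + 1))
        (α := -ω / stretch (lenL t) (2 * l)) l0.ne' (p (2 * l))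
      rw [show len t (2 * l + 1) / len t (2 * l) = stretch (lenL t) (2 * l) from rfl,
        mul_div_cancel₀ _ hlam, mul_zero] at h
      rw [← jet_neg, ← jet_congr (hp.eval_eq (i := 2 * l) (by omega)) (Or.inl rfl), h]
    rw [hp.integral_eq ht, sum_split_even, evenRule, map_add, map_add, map_add,
      quadSum_leftRule hN ht (by omega) hp, quadSum_rightRule hN ht (by omega) hp,
      quadSum_place_knotInteg ht (by omega) le_rfl hM₁ (hp.1 (2 * l) (by omega)).2
        (sum_weightM k _ _ hM₁
          ((natDegree_comp_aff_le _ _ _).trans (hp.1 (2 * l) (by omega)).1)),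
      quadSum_place_knotInteg ht (by omega) le_rfl hM₂ (hp.1 (2 * l + 1) (by omega)).2
        (sum_weightM k _ _ hM₂
          ((natDegree_comp_aff_le _ _ _).trans (hp.1 (2 * l + 1) (by omega)).1)), hj,
      show 2 * (l + r) + 2 - 1 - 2 * r = 2 * l + 1 by omega,
      show 2 * (l + r) + 2 - 2 * r = 2 * l + 2 by omega]
    ring

end C0

/-! ### Admissibility, injectivity and closed forms -/

namespace C0

variable {N l r : ℕ} {t : ℕ → ℝ}

lemma sideOK_lenL {S : ℕ} (hN : 1 ≤ N) (ht : StrictMonoOn t (Set.Iic S)) (hl : 2 * l < S) :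
    SideOK N l (lenL t) ∧ 0 ≤ param N (lenL t) l :=
  ⟨sideOK hN fun _ _ => len_pos ht (by omega),
    (param_nonneg hN fun _ _ => len_pos ht (by omega)).1⟩

lemma sideOK_lenR {S : ℕ} (hN : 1 ≤ N) (ht : StrictMonoOn t (Set.Iic S)) (hr : 2 * r < S) :
    SideOK N r (lenR S t) ∧ 0 ≤ param N (lenR S t) r :=
  ⟨sideOK hN fun i _ => len_pos (i := S - 1 - i) ht (by omega),
    (param_nonneg hN fun i _ => len_pos (i := S - 1 - i) ht (by omega)).1⟩

lemma oddOK (hN : 1 ≤ N) (ht : StrictMonoOn t (Set.Iic (2 * (l + r) + 1))) : OddOK N l r t := by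
  obtain ⟨h1, h2⟩ := sideOK_lenL (l := l) hN ht (by omega)
  obtain ⟨h3, h4⟩ := sideOK_lenR (r := r) hN ht (by omega)
  exact ⟨h1, h3, (hasRootsIn_M h2 h4 hN).mono Set.Ioo_subset_Icc_self⟩

lemma exists_evenOK (hN : 1 ≤ N) (ht : StrictMonoOn t (Set.Iic (2 * (l + r) + 2))) :
    ∃ ε > 0, ∀ ω : ℝ, |ω| < ε → EvenOK N l r t ω := by
  obtain ⟨h1, h2⟩ := sideOK_lenL (l := l) hN ht (by omega)
  obtain ⟨h3, h4⟩ := sideOK_lenR (r := r) hN ht (by omega)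
  obtain ⟨ε, hε, h⟩ := exists_hasRootsIn_M hN
  have hl : 0 < stretch (lenL t) (2 * l) :=
    div_pos (len_pos ht (by omega)) (len_pos ht (by omega))
  refine ⟨min ε (ε * stretch (lenL t) (2 * l)), by positivity, fun ω hω => ⟨h1, h3,
    (h _ h2 ω (hω.trans_le (min_le_left _ _))).1, (h _ h4 _ ?_).2⟩⟩
  rw [abs_div, abs_neg, abs_of_pos hl, div_lt_iff₀ hl]
  exact hω.trans_le (min_le_right _ _)

/-- The value at `1` does not depend on `αR`; it is positive if `αL` is nonnegative. -/
lemma M_eval_one (n : ℕ) (αL αR : ℝ) : (M n αL αR).eval 1 = 1 + n * (n + 1) * αL := by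
  have h := (C1.jacobi_zero_derivative_eval n).2.1
  simp only [M, eval_add, eval_sub, eval_mul, eval_C, eval_one, eval_X, jacobi_zero_eval_one, h, H,
    H₁, H₂]
  ring

lemma injOn_evenRule (hN : 1 ≤ N) (ht : StrictMonoOn t (Set.Iic (2 * (l + r) + 2))) :
    Set.InjOn (evenRule N l r t) {ω | EvenOK N l r t ω} := by
  intro ω h ω' h' heq
  obtain ⟨-, h2⟩ := sideOK_lenL (l := l) hN ht (by omega)
  have l0 := len_pos ht (show 2 * l < 2 * (l + r) + 2 by omega)
  have l1 := len_pos ht (show 2 * l + 1 < 2 * (l + r) + 2 by omega)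
  obtain ⟨k, rfl⟩ : ∃ k, N = k + 1 := ⟨N - 1, by omega⟩
  -- the sum of the weights left of the middle knot determines the parameter; this knot may be a
  -- node of the second middle subinterval, but never of the first, see `M_eval_one`
  let f : ℝ → ℝ := (Set.Iio (t (2 * l + 1))).indicator 1
  have key : ∀ ω, EvenOK (k + 1) l r t ω →
      quadSum f (place t (2 * l) (M (k + 1) (param (k + 1) (lenL t) l) ω)
        (weightM (k + 1 : ℕ) (param (k + 1) (lenL t) l) ω)) = len t (2 * l) / 2 *
          (2 + 2 * param (k + 1) (lenL t) l + 2 * ω) ∧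
      quadSum f (place t (2 * l + 1) (M (k + 1) (-ω / stretch (lenL t) (2 * l))
        (param (k + 1) (lenR (2 * (l + r) + 2) t) r)) (weightM (k + 1 : ℕ)
          (-ω / stretch (lenL t) (2 * l)) (param (k + 1) (lenR (2 * (l + r) + 2) t) r))) = 0 := by
    rintro ω ⟨-, -, hM₁, hM₂⟩
    constructor
    · have hs := sum_weightM k (param (k + 1) (lenL t) l) ω hM₁ (f := 1) (by simp)
      rw [knotInteg_apply, integ_one] at hs
      simp only [eval_one, mul_one, derivative_one, eval_zero, mul_zero, sub_zero, add_zero] at hs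
      rw [← hs, quadSum_apply, place, Multiset.map_map, ← Multiset.sum_map_mul_left]
      refine congrArg _ (Multiset.map_congr rfl fun x hx => ?_)
      have hx1 : x < 1 := by
        refine lt_of_le_of_ne (hM₁.2.2 x hx).2 fun hx1 => ?_
        have h3 := (mem_roots'.1 hx).2
        rw [hx1, IsRoot.def, M_eval_one] at h3
        have : 0 < 1 + ((k + 1 : ℕ) : ℝ) * ((k + 1 : ℕ) + 1) * param (k + 1) (lenL t) l := by
          positivity
        linarith
      have hmem : t (2 * l) + (1 + x) / 2 * len t (2 * l) ∈ Set.Iio (t (2 * l + 1)) := by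
        have : t (2 * l + 1) = t (2 * l) + len t (2 * l) := by rw [len]; ring
        rw [Set.mem_Iio, this]
        nlinarith
      simp only [Function.comp_apply, f, Set.indicator_of_mem hmem, Pi.one_apply]
      ring
    · rw [quadSum_apply, place, Multiset.map_map, Multiset.map_congr (g := fun _ => (0 : ℝ)) rfl]
      · simp
      · intro x hx
        have hmem := (place_node_mem (t := t) (i := 2 * l + 1)
          (sub_nonneg.1 l1.le) (hM₂.2.2 x hx)).1
        simp only [Function.comp_apply, f]
        rw [Set.indicator_of_notMem (Set.notMem_Iio.2 hmem), mul_zero]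
  obtain ⟨a1, a2⟩ := key ω h
  obtain ⟨b1, b2⟩ := key ω' h'
  have hq := congrArg (quadSum f) heq
  simp only [evenRule, map_add] at hq
  rw [a1, a2, b1, b2] at hq
  have hq' : len t (2 * l) * (ω - ω') = 0 := by linear_combination hq
  exact sub_eq_zero.1 ((mul_eq_zero.1 hq').resolve_left l0.ne')

end C0

lemma roots_eq_of_place_eq {t : ℕ → ℝ} {i : ℕ} (h : len t i ≠ 0) {p q : ℝ[X]} {w w' : ℝ → ℝ}
    (hpq : place t i p w = place t i q w') : p.roots = q.roots := by
  have h1 := congrArg (Multiset.map fun u : ℝ × ℝ => (u.1 - t i) / len t i * 2 - 1) hpq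
  simp only [place, Multiset.map_map, Function.comp_def] at h1
  have h2 : ∀ x : ℝ, (t i + (1 + x) / 2 * len t i - t i) / len t i * 2 - 1 = x := fun x => by
    field_simp
    ring
  simpa only [h2, Multiset.map_id'] using h1

namespace C1

variable {N l r : ℕ} {t : ℕ → ℝ} {ωL ωR : ℕ → ℝ}

/-- The assumption says that the norm of `M_n` is not zero. -/
lemma M_ne_zero {n : ℕ} {αL αR βL βR : ℝ} (h : H (n + 1) αL αR βL βR ≠ 0) :
    M n αL αR βL βR ≠ 0 := by
  intro h0
  have h1 := knotInteg_M_mul n αL βL αR βR (p := X ^ n) (natDegree_X_pow_le n)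
  rw [h0, zero_mul, map_zero, coeff_X_pow, if_pos rfl, one_mul] at h1
  refine mul_ne_zero ?_ h h1.symm
  have h2 := jacobi_zero_leading_mul_moment n
  intro h3
  rw [h3] at h2
  have : (2 : ℝ) / (n + 1) ≠ 0 := by positivity
  simp at h2

/-- The leading coefficient of `M_{ω,n}` does not depend on `ω`, so the roots determine the
polynomial, and thereby `ω`. -/
lemma eq_of_roots_Mω_eq {n : ℕ} {αL αR βL βR ω ω' : ℝ} {I J : Set ℝ}
    (h : HasRootsIn (Mω (n + 1) αL αR βL βR ω) (n + 1) I)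
    (h' : HasRootsIn (Mω (n + 1) αL αR βL βR ω') (n + 1) J)
    (heq : (Mω (n + 1) αL αR βL βR ω).roots = (Mω (n + 1) αL αR βL βR ω').roots) : ω = ω' := by
  have hd := natDegree_Mω_le n αL αR βL βR
  have hc := Mω_coeff n αL αR βL βR
  have hnd : ∀ {ω I}, HasRootsIn (Mω (n + 1) αL αR βL βR ω) (n + 1) I →
      (Mω (n + 1) αL αR βL βR ω).natDegree = n + 1 := by
    intro ω I h
    have hco := coeff_ne_zero_of_card_roots (hd ω) h.1
    exact le_antisymm (hd ω) (le_natDegree_of_ne_zero hco)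
  have hH : H (n + 1) αL αR βL βR ≠ 0 := by
    have hco := coeff_ne_zero_of_card_roots (hd ω) h.1
    rw [hc] at hco
    exact left_ne_zero_of_mul hco
  have e1 := C_leadingCoeff_mul_prod_multiset_X_sub_C (h.1.trans (hnd h).symm)
  have e2 := C_leadingCoeff_mul_prod_multiset_X_sub_C (h'.1.trans (hnd h').symm)
  rw [leadingCoeff, hnd h, hc, heq] at e1
  rw [leadingCoeff, hnd h', hc, e1] at e2
  rw [Mω, Mω, add_right_inj, Nat.add_sub_cancel] at e2
  exact C_injective (mul_right_cancel₀ (M_ne_zero hH) e2)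

lemma injOn_oddRule (ht : StrictMonoOn t (Set.Iic (2 * (l + r) + 1))) :
    Set.InjOn (oddRule N l r t ωL ωR) {ω | OddOK N l r t ωL ωR ω} := by
  rintro ω ⟨-, -, h⟩ ω' ⟨-, -, h'⟩ heq
  have := add_left_cancel (add_right_cancel heq)
  exact eq_of_roots_Mω_eq h h' (roots_eq_of_place_eq (len_pos ht (by omega)).ne' this)

lemma isOmega_closed_form {n lam α β σ : ℝ} (hσ : σ = 1 ∨ σ = -1) (hA : ωA n lam α β ≠ 0)
    (hD : 0 ≤ ωB n lam α β ^ 2 - 4 * ωA n lam α β * ωC n lam α β) :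
    IsOmega n lam α β ((-ωB n lam α β +
      σ * √(ωB n lam α β ^ 2 - 4 * ωA n lam α β * ωC n lam α β)) / (2 * ωA n lam α β)) := by
  have hs := Real.mul_self_sqrt hD
  have h := quadratic_eq_zero_iff (a := ωA n lam α β) (b := ωB n lam α β) (c := ωC n lam α β) hA
    (by rw [discrim]; exact hs.symm)
    ((-ωB n lam α β + σ * √(ωB n lam α β ^ 2 - 4 * ωA n lam α β * ωC n lam α β)) /
      (2 * ωA n lam α β))
  rw [← pow_two] at h
  refine h.2 ?_
  rcases hσ with rfl | rfl
  · left; rw [one_mul]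
  · right; rw [neg_one_mul, ← sub_eq_add_neg]

/-- Elimination of `α` from the two equations gives a quadratic equation for `β`, and elimination of
`β ^ 2` gives `α`. As `mD₄ = -mA₃` is not zero, the two original equations follow from these. -/
lemma isMiddle_closed_form {n lam : ℝ} {L R : ℝ × ℝ} (hA : mA₃ n lam L R ≠ 0)
    (hD : 0 ≤ mSQ n lam L R) : IsMiddle n lam L R (midα n lam L R) (midβ n lam L R) := by
  have hs := Real.mul_self_sqrt hD
  have hq : mA₃ n lam L R * midβ n lam L R ^ 2 + mB₃ n lam L R * midβ n lam L R +
      mC₃ n lam L R = 0 := by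
    rw [pow_two, quadratic_eq_zero_iff hA (s := √(mSQ n lam L R)) (by rw [hs, mSQ, discrim])]
    right
    rw [midβ]
    field_simp
  have hD₄ : mD₄ n lam L R = -mA₃ n lam L R := by rw [mD₄, mA₃]; ring
  have hα : mD₄ n lam L R * midα n lam L R = -(mC₄ n lam L R + mB₄ n lam L R * midβ n lam L R) := by
    rw [midα, mul_div_cancel₀]
    rw [hD₄]
    exact neg_ne_zero.2 hA
  have hD0 : mD₄ n lam L R ≠ 0 := by rw [hD₄]; exact neg_ne_zero.2 hA
  generalize midα n lam L R = α at *
  generalize midβ n lam L R = β at *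
  constructor
  · refine (mul_eq_zero.1 ?_).resolve_left hD0
    have : mD₄ n lam L R * (mA n L.1 L.2 * β ^ 2 + mB n L.1 L.2 * β + mC n L.1 L.2 +
        mD n L.1 L.2 * α) = 0 := by
      simp only [mD₄, mA₃, mB₃, mC₃, mB₄, mC₄] at *
      linear_combination (-mA n L.1 L.2) * hq + mD n L.1 L.2 * hα
    exact this
  · refine (mul_eq_zero.1 ?_).resolve_left hD0
    simp only [mD₄, mA₃, mB₃, mC₃, mB₄, mC₄] at *
    linear_combination (-mA n R.1 R.2) * hq + (-lam ^ 3 * mD n R.1 R.2) * hα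

end C1

/-! ### Optimality -/

lemma C0.isOptimal_oddRule {N l r : ℕ} {t : ℕ → ℝ} (hN : 1 ≤ N)
    (ht : StrictMonoOn t (Set.Iic (2 * (l + r) + 1))) (hok : OddOK N l r t) :
    IsOptimal (2 * (l + r) + 1) (2 * N - 1) 0 t (oddRule N l r t) := by
  have hcard : 2 * Multiset.card (oddRule N l r t) = (2 * N - 1) * (2 * (l + r) + 1) + 1 := by
    rw [oddRule, Multiset.card_add, Multiset.card_add, card_leftRule hN hok.1,
      card_rightRule hN hok.2.1, card_place hok.2.2]
    obtain ⟨k, rfl⟩ : ∃ k, N = k + 1 := ⟨N - 1, by omega⟩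
    rw [show 2 * (k + 1) - 1 = 2 * k + 1 by omega]
    ring
  exact ⟨(isExact_oddRule hN ht hok).isMinimal_zero (by omega) hN ht (by omega),
    by rw [hcard, finrank_splineSpace_zero (by omega) ht]⟩

lemma C0.isOneParamOptimal_evenRule {N l r : ℕ} {t : ℕ → ℝ} {ω : ℝ} (hN : 1 ≤ N)
    (ht : StrictMonoOn t (Set.Iic (2 * (l + r) + 2))) (hok : EvenOK N l r t ω) :
    IsOneParamOptimal (2 * (l + r) + 2) (2 * N - 1) 0 t (evenRule N l r t ω) := by
  have hcard : 2 * Multiset.card (evenRule N l r t ω) =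
      (2 * N - 1) * (2 * (l + r) + 2) + 2 := by
    rw [evenRule, Multiset.card_add, Multiset.card_add, Multiset.card_add, card_leftRule hN hok.1,
      card_rightRule hN hok.2.1, card_place hok.2.2.1, card_place hok.2.2.2]
    obtain ⟨k, rfl⟩ : ∃ k, N = k + 1 := ⟨N - 1, by omega⟩
    rw [show 2 * (k + 1) - 1 = 2 * k + 1 by omega]
    ring
  exact ⟨(isExact_evenRule hN ht hok).isMinimal_zero (by omega) hN ht (by omega),
    by rw [hcard, finrank_splineSpace_zero (by omega) ht]⟩

lemma C1.isOneParamOptimal_oddRule {N l r : ℕ} {t : ℕ → ℝ} {ωL ωR : ℕ → ℝ} {ω : ℝ} (hN : 1 ≤ N)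
    (ht : StrictMonoOn t (Set.Iic (2 * (l + r) + 1))) (hok : OddOK N l r t ωL ωR ω) :
    IsOneParamOptimal (2 * (l + r) + 1) (2 * N) 1 t (oddRule N l r t ωL ωR ω) := by
  have hcard : 2 * Multiset.card (oddRule N l r t ωL ωR ω) =
      (2 * N - 1) * (2 * (l + r) + 1) + 3 := by
    rw [oddRule, Multiset.card_add, Multiset.card_add, card_leftRule hN hok.1,
      card_rightRule hN hok.2.1, card_place hok.2.2]
    obtain ⟨k, rfl⟩ : ∃ k, N = k + 1 := ⟨N - 1, by omega⟩
    rw [show 2 * (k + 1) - 1 = 2 * k + 1 by omega]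
    ring
  exact ⟨(isExact_oddRule hN ht hok).isMinimal_one (by omega) hN ht (by omega),
    by rw [hcard, finrank_splineSpace_one (by omega) hN ht]⟩

lemma C1.isOptimal_evenRule {N l r : ℕ} {t : ℕ → ℝ} {ωL ωR : ℕ → ℝ} {α β : ℝ} (hN : 1 ≤ N)
    (ht : StrictMonoOn t (Set.Iic (2 * (l + r) + 2))) (hok : EvenOK N l r t ωL ωR α β) :
    IsOptimal (2 * (l + r) + 2) (2 * N) 1 t (evenRule N l r t ωL ωR α β) := by
  have hcard : 2 * Multiset.card (evenRule N l r t ωL ωR α β) =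
      (2 * N - 1) * (2 * (l + r) + 2) + 2 := by
    rw [evenRule, Multiset.card_add, Multiset.card_add, Multiset.card_add, card_leftRule hN hok.1,
      card_rightRule hN hok.2.1, card_place hok.2.2.2.1, card_place hok.2.2.2.2]
    obtain ⟨k, rfl⟩ : ∃ k, N = k + 1 := ⟨N - 1, by omega⟩
    rw [show 2 * (k + 1) - 1 = 2 * k + 1 by omega]
    ring
  exact ⟨(isExact_evenRule hN ht hok).isMinimal_one (by omega) hN ht (by omega),
    by rw [hcard, finrank_splineSpace_one (by omega) hN ht]⟩

end

end SplineQuad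

theorem mainTheorem2 (N l r : ℕ) (hN : 1 ≤ N) (t : ℕ → ℝ) :
    -- continuity class 0, an odd number of subintervals
    (StrictMonoOn t (Set.Iic (2 * (l + r) + 1)) →
      SplineQuad.C0.OddOK N l r t ∧
      SplineQuad.IsOptimal (2 * (l + r) + 1) (2 * N - 1) 0 t (SplineQuad.C0.oddRule N l r t)) ∧
    -- continuity class 0, an even number of subintervals
    (StrictMonoOn t (Set.Iic (2 * (l + r) + 2)) →
      (∃ ε > 0, ∀ ω : ℝ, |ω| < ε → SplineQuad.C0.EvenOK N l r t ω) ∧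
      (∀ ω : ℝ, SplineQuad.C0.EvenOK N l r t ω →
        SplineQuad.IsOneParamOptimal (2 * (l + r) + 2) (2 * N - 1) 0 t
          (SplineQuad.C0.evenRule N l r t ω)) ∧
      Set.InjOn (SplineQuad.C0.evenRule N l r t) {ω | SplineQuad.C0.EvenOK N l r t ω}) ∧
    -- continuity class 1, an odd number of subintervals
    (StrictMonoOn t (Set.Iic (2 * (l + r) + 1)) →
      ∀ ωL ωR : ℕ → ℝ,
        (∀ ω : ℝ, SplineQuad.C1.OddOK N l r t ωL ωR ω →
          SplineQuad.IsOneParamOptimal (2 * (l + r) + 1) (2 * N) 1 t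
            (SplineQuad.C1.oddRule N l r t ωL ωR ω)) ∧
        Set.InjOn (SplineQuad.C1.oddRule N l r t ωL ωR)
          {ω | SplineQuad.C1.OddOK N l r t ωL ωR ω}) ∧
    -- continuity class 1, an even number of subintervals
    (StrictMonoOn t (Set.Iic (2 * (l + r) + 2)) →
      ∀ (ωL ωR : ℕ → ℝ) (α β : ℝ), SplineQuad.C1.EvenOK N l r t ωL ωR α β →
        SplineQuad.IsOptimal (2 * (l + r) + 2) (2 * N) 1 t
          (SplineQuad.C1.evenRule N l r t ωL ωR α β)) ∧
    -- the closed forms solve the defining equations of continuity class 1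
    (∀ lam α β σ : ℝ, σ = 1 ∨ σ = -1 → SplineQuad.C1.ωA N lam α β ≠ 0 →
      0 ≤ SplineQuad.C1.ωB N lam α β ^ 2 -
        4 * SplineQuad.C1.ωA N lam α β * SplineQuad.C1.ωC N lam α β →
      SplineQuad.C1.IsOmega N lam α β
        ((-SplineQuad.C1.ωB N lam α β +
            σ * √(SplineQuad.C1.ωB N lam α β ^ 2 -
              4 * SplineQuad.C1.ωA N lam α β * SplineQuad.C1.ωC N lam α β)) /
          (2 * SplineQuad.C1.ωA N lam α β))) ∧
    (∀ (lam : ℝ) (L R : ℝ × ℝ), SplineQuad.C1.mA₃ N lam L R ≠ 0 →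
      0 ≤ SplineQuad.C1.mSQ N lam L R →
      SplineQuad.C1.IsMiddle N lam L R (SplineQuad.C1.midα N lam L R)
        (SplineQuad.C1.midβ N lam L R)) := by
  refine ⟨fun ht => ?_, fun ht => ⟨SplineQuad.C0.exists_evenOK hN ht, fun ω hok => ?_,
    SplineQuad.C0.injOn_evenRule hN ht⟩, fun ht ωL ωR => ⟨fun ω hok => ?_,
    SplineQuad.C1.injOn_oddRule ht⟩, fun ht ωL ωR α β hok => ?_,
    fun lam α β σ hσ hA hD => SplineQuad.C1.isOmega_closed_form hσ hA hD,
    fun lam L R hA hD => SplineQuad.C1.isMiddle_closed_form hA hD⟩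
  · have hok := SplineQuad.C0.oddOK hN ht
    exact ⟨hok, SplineQuad.C0.isOptimal_oddRule hN ht hok⟩
  · exact SplineQuad.C0.isOneParamOptimal_evenRule hN ht hok
  · exact SplineQuad.C1.isOneParamOptimal_oddRule hN ht hok
  · exact SplineQuad.C1.isOptimal_evenRule hN ht hok
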